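/- Let $N\ge 1$. Call a polynomial $F\in\mathbb C[z]$ typically real if it is real on $(-1,1)$ and $\operatorname{Im}z\cdot\operatorname{Im}F(z)>0$ for all non-real $z$ with $|z|<1$. Let $T_N$ be the set of typically real polynomials of degree $N$ with $F(0)=0$, $F'(0)=1$, and let $U_n$ be the Chebyshev polynomial of the second kind, $U_n(\cos t)=\sin((n+1)t)/\sin t$. For $F\in T_N$ one has $\sup_{|z|<1}|F(z)|=\max_t|F(e^{it})|$. The maximum $$J_N=\max_{F\in T_N}\ \sup_{|z|<1}|F(z)|$$ exists, and $$J_N=\tfrac14\csc^2\frac{\pi}{2(N+2)}\quad(N\text{ odd}),\qquad J_N=\frac1{4\nu^2}\quad(N\text{ even}),$$ where $\nu$ is the least positive root of $U'_{N+1}$ (which exists for $N$ even). The auxiliary problem of maximizing $\sum_{j=1}^N\alpha_j$ over all real $\alpha_1=1,\alpha_2,\dots,\alpha_N$ with $\sum_{j=1}^N\alpha_j\sin jt\ge0$ for $t\in[0,\pi]$ has exactly one solution, and this solution has $\alpha_k>0$ for $k=1,\dots,N$. Put $F^{(1)}(z)=\sum_{j=1}^N\alpha_jz^j$. Then the polynomials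 $F\in T_N$ with $\sup_{|z|<1}|F(z)|=J_N$ are exactly $F^{(1)}(z)$ and $F^{(2)}(z)=-F^{(1)}(-z)$. For $N\ge2$ these two are distinct; for $N=1$ both are equal to $z$. The maximum and the set of extremal polynomials are the same over the larger class of normalized typically real polynomials of degree at most $N$. The coefficients of $F^{(1)}$ are, for $k=1,\dots,N$ (empty sums being $0$), $$\alpha_k=\frac{\sum_{j=1}^{N-k+1}z_jz_{j+k-1}-\sum_{j=1}^{N-k-1}z_jz_{j+k+1}}{\sum_{j=1}^{N}z_j^2-\sum_{j=1}^{N-2}z_jz_{j+2}},$$ where, for $N$ odd, $z_k=(-1)^{k-1}U_{k-1}(\mu)U_k(\mu)$ with $\mu=\sin\frac{\pi}{2(N+2)}$, and, for $N$ even, $$z_k=(-1)^{k-1}\Bigl(U_{k-1}(\nu)U_k(\nu)-U_{N-k}(\nu)U_{N-k+1}(\nu)+\tfrac{N+1-2k}{N+1}U_N(\nu)U_{N+1}(\nu)\Bigr).$$ -/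

import Mathlib

open Polynomial

noncomputable section

/-- A complex polynomial is typically real in the open unit disk: it is real on the real diameter,
and off the real axis the imaginary part of its value has the sign of the imaginary part of the
point. -/
def IsTypicallyReal (F : ℂ[X]) : Prop :=
  ∀ z ∈ Metric.ball (0 : ℂ) 1,
    (z.im = 0 → (F.eval z).im = 0) ∧ (z.im ≠ 0 → 0 < z.im * (F.eval z).im)

/-- Typically real polynomials of degree exactly `N` with `F(0) = 0` and `F'(0) = 1`. -/
def typicallyRealPolys (N : ℕ) : Set ℂ[X] :=
  {F | F.natDegree = N ∧ F.eval 0 = 0 ∧ F.derivative.eval 0 = 1 ∧ IsTypicallyReal F}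

/-- Typically real polynomials of degree at most `N` with `F(0) = 0` and `F'(0) = 1`. -/
def typicallyRealPolysLE (N : ℕ) : Set ℂ[X] :=
  {F | F.natDegree ≤ N ∧ F.eval 0 = 0 ∧ F.derivative.eval 0 = 1 ∧ IsTypicallyReal F}

/-- The supremum of `|F|` on the open unit disk (the set is nonempty and bounded). -/
def diskSup (F : ℂ[X]) : ℝ :=
  sSup ((fun z : ℂ => ‖F.eval z‖) '' Metric.ball (0 : ℂ) 1)

/-- The extremal value `J_N` over polynomials of degree `N`. That the supremum is finite and
attained is asserted in the theorem. -/
def extremalValue (N : ℕ) : ℝ :=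
  sSup (diskSup '' typicallyRealPolys N)

/-- The members of a class of polynomials that maximize `sup |F|` on the disk over the class. -/
def extremalPolys (T : Set ℂ[X]) : Set ℂ[X] :=
  {F | F ∈ T ∧ ∀ G ∈ T, diskSup G ≤ diskSup F}

/-- Admissible polynomials `∑ α_j z^j` of the auxiliary problem: `α_1 = 1` and
`∑ α_j sin (j t) ≥ 0` on `[0, π]`. -/
def auxAdmissible (N : ℕ) : Set ℝ[X] :=
  {P | P.natDegree ≤ N ∧ P.coeff 0 = 0 ∧ P.coeff 1 = 1 ∧
    ∀ t ∈ Set.Icc (0 : ℝ) Real.pi,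
      0 ≤ ∑ j ∈ Finset.Icc 1 N, P.coeff j * Real.sin (j * t)}

/-- `P` maximizes `∑ α_j` among the admissible polynomials of the auxiliary problem. -/
def IsAuxExtremal (N : ℕ) (P : ℝ[X]) : Prop :=
  P ∈ auxAdmissible N ∧ ∀ Q ∈ auxAdmissible N,
    ∑ j ∈ Finset.Icc 1 N, Q.coeff j ≤ ∑ j ∈ Finset.Icc 1 N, P.coeff j

/-- The value at `x` of the Chebyshev polynomial of the second kind `U_n`. -/
def chebU (n : ℤ) (x : ℝ) : ℝ := (Chebyshev.U ℝ n).eval x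

/-- Coordinates (`k = 1, …, N`) of the vector that gives the coefficients for odd `N`. -/
def vecOdd (x : ℝ) (k : ℕ) : ℝ :=
  (-1) ^ (k + 1) * (chebU (k - 1) x * chebU k x)

/-- Coordinates (`k = 1, …, N`) of the vector that gives the coefficients for even `N`. -/
def vecEven (N : ℕ) (x : ℝ) (k : ℕ) : ℝ :=
  (-1) ^ (k + 1) * (chebU (k - 1) x * chebU k x - chebU (N - k) x * chebU (N - k + 1) x
    + ((N : ℝ) + 1 - 2 * k) / (N + 1) * (chebU N x * chebU (N + 1) x))

/-- The `k`-th coefficient (`1 ≤ k ≤ N`) built from the vector `(z 1, …, z N)`. A sum whose upper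
limit is zero or negative is empty. -/
def coeffOfVec (N : ℕ) (z : ℕ → ℝ) (k : ℕ) : ℝ :=
  (∑ j ∈ Finset.Icc 1 (N + 1 - k), z j * z (j + k - 1)
      - ∑ j ∈ Finset.Icc 1 (N - k - 1), z j * z (j + k + 1)) /
    (∑ j ∈ Finset.Icc 1 N, z j * z j - ∑ j ∈ Finset.Icc 1 (N - 2), z j * z (j + 2))

/-- `ν` is the least positive root of `U'_{N+1}`. -/
def IsLeastPosRootDerivU (N : ℕ) (ν : ℝ) : Prop :=
  IsLeast {x : ℝ | 0 < x ∧ (derivative (Chebyshev.U ℝ ((N : ℤ) + 1))).eval x = 0} ν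

end

/-! On the unit circle a normalized typically real polynomial is `∑ a_j z^j` with real `a_j`, `a_1 =
1`, whose imaginary part S(t) = `∑ a_j sin (j t)` is nonnegative on [0, π]. One direction is a
radial limit. For the other, discrete sine inversion at the nodes kπ/L writes F as a convex
combination of truncations of the kernels z/(1 - 2cz + z²), which are typically real, and L tends to
infinity.

The value F(1) is bounded by a quadratic form. By Fejér–Riesz, S(t)/sin t is a squared modulus on
the circle; averaging over ±t makes it a sum of two squared moduli with real coefficient vectors. If
c_d are the autocorrelations of such a vector, it contributes c_0 - c_2 to a_1 and c_0 + c_1 to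
F(1). Hence F(1) ≤ J follows once J(c_0 - c_2) - (c_0 + c_1) is nonnegative. A positive vector z in
the kernel of this form turns it into a weighted sum of squares of differences of v_j/z_j
(`IsGroundState.form_eq`), so it is nonnegative and vanishes only on multiples of z. This gives both
the maximum and its uniqueness.

The kernel vector is explicit. The Toeplitz equation is solved by cos((2k - N - 1)ψ) with J = 1/(4
sin² ψ), and an alternating affine sequence may be added freely. Vanishing at the two sites on
either side of 1, …, N fixes ψ: it is π/(2(N+2)) for odd N, and sin ψ is the least positive root of
`U'_{N+1}` for even N. Products of Chebyshev values give the same vector up to a factor. Its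
symmetry and its monotonicity along each parity class make all coefficients of the extremal
polynomial positive (`corrCoeff_pos`).

It remains to see that |F| on the circle reaches J only at ±1. With L = N + 2 nodes, |F(e^{iτ})|² =
(cos(Lτ/2) O)² + (sin(Lτ/2) E)², where O and E are sums over the odd and even nodes, each of total
weight 1/2, and O = F(1) at τ = 0 (`norm_sq_sum_exp_eq`, `sum_filter_nodeWeight`, `oddNodeSum_one`).
For N ≥ 3 three arcs covering 0 < τ ≤ π/2 are estimated separately; the symmetries under conjugation
and z ↦ -z give the rest. For N ≤ 2 the triangle inequality is enough. -/

/-! ### Discrete sine inversion and node weights -/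

/-- The sine polynomial `∑_{j=1}^N a_j sin (j t)`. -/
noncomputable def sineSum (N : ℕ) (a : ℕ → ℝ) (t : ℝ) : ℝ :=
  ∑ j ∈ Finset.Icc 1 N, a j * Real.sin (j * t)

theorem two_mul_sin_mul_sum_cos (x : ℝ) (L : ℕ) :
    2 * Real.sin (x / 2) * ∑ k ∈ Finset.range L, Real.cos (k * x) =
      Real.sin ((L - 1 / 2) * x) + Real.sin (x / 2) := by
  induction L with
  | zero =>
    have : ((0 : ℕ) - 1 / 2 : ℝ) * x = -(x / 2) := by push_cast; ring
    rw [this, Real.sin_neg]; simp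
  | succ n ih =>
    rw [Finset.sum_range_succ, mul_add, ih]
    have h1 : ((n + 1 : ℕ) - 1 / 2 : ℝ) * x = n * x + x / 2 := by push_cast; ring
    have h2 : (n - 1 / 2 : ℝ) * x = n * x - x / 2 := by ring
    rw [h1, h2, Real.sin_add, Real.sin_sub]; ring

/-- With x = nπ/L the closed form collapses, since sin((L - 1/2)x) = -(-1)^n sin(x/2). Only the
parity of n survives, so the terms for j - l and j + l cancel in the orthogonality relation. -/
theorem sum_cos_int_mul_pi_div (L : ℕ) (n : ℤ) (h0 : 0 < n) (h1 : n < 2 * L) :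
    ∑ k ∈ Finset.range L, Real.cos (k * (n * Real.pi / L)) = (1 - (-1) ^ n) / 2 := by
  have hL : (0 : ℝ) < L := by
    have : (0 : ℤ) < L := by omega
    exact_mod_cast this
  have hn0 : (0 : ℝ) < n := by exact_mod_cast h0
  have hn1 : (n : ℝ) < 2 * L := by exact_mod_cast h1
  have hs : 0 < Real.sin (n * Real.pi / L / 2) := by
    apply Real.sin_pos_of_pos_of_lt_pi
    · positivity
    · rw [div_div, div_lt_iff₀ (by positivity)]
      nlinarith [Real.pi_pos]
  have h := two_mul_sin_mul_sum_cos (n * Real.pi / L) L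
  have h2 : (L - 1 / 2 : ℝ) * (n * Real.pi / L) = n * Real.pi - n * Real.pi / L / 2 := by
    field_simp
  rw [h2, Real.sin_sub, Real.sin_int_mul_pi, Real.cos_int_mul_pi] at h
  have h3 : Real.sin (n * Real.pi / L / 2) * (2 * ∑ k ∈ Finset.range L,
      Real.cos (k * (n * Real.pi / L))) = Real.sin (n * Real.pi / L / 2) * (1 - (-1) ^ n) := by
    linear_combination h
  have := mul_left_cancel₀ hs.ne' h3
  linarith

/-- Discrete orthogonality of the sine functions. -/
theorem sum_sin_mul_sin (L j l : ℕ) (hj : 1 ≤ j) (hjL : j < L) (hl : 1 ≤ l) (hlL : l < L) :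
    ∑ k ∈ Finset.range L, Real.sin (j * (k * Real.pi / L)) * Real.sin (l * (k * Real.pi / L)) =
      if j = l then (L : ℝ) / 2 else 0 := by
  wlog h : l ≤ j generalizing j l
  · have := this l j hl hlL hj hjL (by omega)
    simp only [eq_comm (a := j) (b := l)]
    rw [← this]
    exact Finset.sum_congr rfl fun k _ => mul_comm _ _
  have hL : (L : ℝ) ≠ 0 := by
    have : L ≠ 0 := by omega
    exact_mod_cast this
  have key : ∀ k : ℕ, Real.sin (j * (k * Real.pi / L)) * Real.sin (l * (k * Real.pi / L)) =
      (Real.cos (k * (((j - l : ℤ) : ℝ) * Real.pi / L)) -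
        Real.cos (k * (((j + l : ℤ) : ℝ) * Real.pi / L))) / 2 := by
    intro k
    have e1 : (k : ℝ) * (((j - l : ℤ) : ℝ) * Real.pi / L) =
      j * (k * Real.pi / L) - l * (k * Real.pi / L) := by push_cast; ring
    have e2 : (k : ℝ) * (((j + l : ℤ) : ℝ) * Real.pi / L) =
      j * (k * Real.pi / L) + l * (k * Real.pi / L) := by push_cast; ring
    rw [e1, e2, Real.cos_sub, Real.cos_add]; ring
  simp_rw [key]
  rw [← Finset.sum_div, Finset.sum_sub_distrib,
    sum_cos_int_mul_pi_div L (j + l) (by omega) (by omega)]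
  split_ifs with hjl
  · subst hjl
    have : ((-1 : ℝ) ^ ((j : ℤ) + j)) = 1 := Even.neg_one_zpow ⟨(j : ℤ), rfl⟩
    simp [this]
  · rw [sum_cos_int_mul_pi_div L (j - l) (by omega) (by omega)]
    have : ((-1 : ℝ) ^ ((j : ℤ) + l)) = (-1) ^ ((j : ℤ) - l) := by
      rw [show (j : ℤ) + l = (j - l) + 2 * l by ring, zpow_add₀ (by norm_num), zpow_mul]
      norm_num
    rw [this]; ring

/-- Recovering the coefficients of a sine polynomial from its values at `k π / L`. -/
theorem sineSum_inversion (N L : ℕ) (hNL : N < L) (a : ℕ → ℝ) (j : ℕ) (hj : 1 ≤ j) (hjL : j < L) :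
    2 / L * ∑ k ∈ Finset.range L, sineSum N a (k * Real.pi / L) * Real.sin (j * (k * Real.pi / L))
      = if j ≤ N then a j else 0 := by
  have hL : (L : ℝ) ≠ 0 := by
    have : L ≠ 0 := by omega
    exact_mod_cast this
  simp only [sineSum, Finset.sum_mul]
  rw [Finset.sum_comm]
  have : ∀ i ∈ Finset.Icc 1 N, ∑ k ∈ Finset.range L, a i * Real.sin (i * (k * Real.pi / L)) *
      Real.sin (j * (k * Real.pi / L)) = if i = j then a i * (L / 2) else 0 := by
    intro i hi
    rw [Finset.mem_Icc] at hi
    simp_rw [mul_assoc]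
    rw [← Finset.mul_sum, sum_sin_mul_sin L i j hi.1 (by omega) hj hjL]
    split_ifs <;> simp
  rw [Finset.sum_congr rfl this, Finset.sum_ite_eq']
  by_cases h : j ≤ N
  · rw [if_pos (Finset.mem_Icc.mpr ⟨hj, h⟩), if_pos h]; field_simp
  · rw [if_neg (by simp [h]), if_neg h]; simp

theorem sineSum_coeff_unique (N : ℕ) (a b : ℕ → ℝ)
    (h : ∀ t ∈ Set.Ioo (0 : ℝ) Real.pi, sineSum N a t = sineSum N b t)
    (j : ℕ) (hj : j ∈ Finset.Icc 1 N) : a j = b j := by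
  rw [Finset.mem_Icc] at hj
  have ha := sineSum_inversion N (N + 1) (by omega) a j hj.1 (by omega)
  have hb := sineSum_inversion N (N + 1) (by omega) b j hj.1 (by omega)
  rw [if_pos hj.2] at ha hb
  rw [← ha, ← hb]
  congr 1
  refine Finset.sum_congr rfl fun k hk => ?_
  rw [Finset.mem_range] at hk
  rcases Nat.eq_zero_or_pos k with rfl | hk0
  · simp
  · rw [h]
    have h1 : (0 : ℝ) < k := by exact_mod_cast hk0
    have h2 : (k : ℝ) < (N + 1 : ℕ) := by exact_mod_cast hk
    constructor
    · positivity
    · rw [div_lt_iff₀ (by positivity), mul_comm]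
      exact mul_lt_mul_of_pos_left h2 Real.pi_pos

/-- The weights of the representation of a sine polynomial by its values at `k π / L`. -/
noncomputable def nodeWeight (N L : ℕ) (a : ℕ → ℝ) (k : ℕ) : ℝ :=
  2 / L * (sineSum N a (k * Real.pi / L) * Real.sin (k * Real.pi / L))

theorem node_mem_Icc {L k : ℕ} (hk : k < L) : (k * Real.pi / L : ℝ) ∈ Set.Icc 0 Real.pi := by
  have h2 : (k : ℝ) < L := by exact_mod_cast hk
  have h0 : (0 : ℝ) ≤ k := k.cast_nonneg
  constructor
  · have := Real.pi_pos
    positivity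
  · rw [div_le_iff₀ (by linarith), mul_comm]
    exact mul_le_mul_of_nonneg_left h2.le Real.pi_pos.le

theorem nodeWeight_nonneg {N L : ℕ} {a : ℕ → ℝ}
    (ha : ∀ t ∈ Set.Icc (0 : ℝ) Real.pi, 0 ≤ sineSum N a t) {k : ℕ} (hk : k < L) :
    0 ≤ nodeWeight N L a k := by
  have := node_mem_Icc hk
  exact mul_nonneg (by positivity)
    (mul_nonneg (ha _ this) (Real.sin_nonneg_of_nonneg_of_le_pi this.1 this.2))

theorem nodeWeight_zero (N L : ℕ) (a : ℕ → ℝ) : nodeWeight N L a 0 = 0 := by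
  simp [nodeWeight]

/-- Since U_{j-1}(cos θ) sin θ = sin jθ, this is sine inversion read as moments of a discrete
measure. The zero moments for N < j < L matter as much as the others. -/
theorem sum_nodeWeight_mul_U (N L : ℕ) (hNL : N < L) (a : ℕ → ℝ) (j : ℕ) (hj : 1 ≤ j)
    (hjL : j < L) :
    ∑ k ∈ Finset.range L, nodeWeight N L a k *
      (Chebyshev.U ℝ (j - 1)).eval (Real.cos (k * Real.pi / L)) = if j ≤ N then a j else 0 := by
  rw [← sineSum_inversion N L hNL a j hj hjL, Finset.mul_sum]
  refine Finset.sum_congr rfl fun k _ => ?_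
  have h := Chebyshev.U_real_cos (k * Real.pi / L) (j - 1)
  have e : ((((j : ℤ) - 1 : ℤ) : ℝ) + 1) * (k * Real.pi / L) = j * (k * Real.pi / L) := by
    push_cast; ring
  rw [e] at h
  rw [nodeWeight, ← h]; ring

theorem sum_nodeWeight (N L : ℕ) (hN : 1 ≤ N) (hNL : N < L) (a : ℕ → ℝ) (h1 : a 1 = 1) :
    ∑ k ∈ Finset.range L, nodeWeight N L a k = 1 := by
  have := sum_nodeWeight_mul_U N L hNL a 1 le_rfl (by omega)
  simpa [hN, h1] using this

/-- At a node sin Lθ = 0, so the boundary terms of `mul_sum_U_mul_pow` with n = L - 1 become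
explicit: this one vanishes and `U_sub_two_node` leaves only a sign. -/
theorem U_sub_one_node {L k : ℕ} (hk0 : 1 ≤ k) (hk : k < L) :
    (Chebyshev.U ℝ (L - 1)).eval (Real.cos (k * Real.pi / L)) = 0 := by
  have hL : (0 : ℝ) < L := by exact_mod_cast (by omega : 0 < L)
  have h2 : (k : ℝ) < L := by exact_mod_cast hk
  have h0 : (0 : ℝ) < k := by exact_mod_cast hk0
  have hs : 0 < Real.sin (k * Real.pi / L) := by
    apply Real.sin_pos_of_pos_of_lt_pi
    · positivity
    · rw [div_lt_iff₀ hL, mul_comm]; exact mul_lt_mul_of_pos_left h2 Real.pi_pos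
  have h := Chebyshev.U_real_cos (k * Real.pi / L) (L - 1)
  have e : ((((L : ℤ) - 1 : ℤ) : ℝ) + 1) * (k * Real.pi / L) = k * Real.pi := by
    push_cast; field_simp; ring
  rw [e, Real.sin_nat_mul_pi] at h
  exact (mul_eq_zero.mp h).resolve_right hs.ne'

theorem U_sub_two_node {L k : ℕ} (hk0 : 1 ≤ k) (hk : k < L) :
    (Chebyshev.U ℝ (L - 2)).eval (Real.cos (k * Real.pi / L)) = -(-1) ^ k := by
  have hL : (0 : ℝ) < L := by exact_mod_cast (by omega : 0 < L)
  have h2 : (k : ℝ) < L := by exact_mod_cast hk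
  have h0 : (0 : ℝ) < k := by exact_mod_cast hk0
  have hs : 0 < Real.sin (k * Real.pi / L) := by
    apply Real.sin_pos_of_pos_of_lt_pi
    · positivity
    · rw [div_lt_iff₀ hL, mul_comm]; exact mul_lt_mul_of_pos_left h2 Real.pi_pos
  have h := Chebyshev.U_real_cos (k * Real.pi / L) (L - 2)
  have e : ((((L : ℤ) - 2 : ℤ) : ℝ) + 1) * (k * Real.pi / L) =
      k * Real.pi - k * Real.pi / L := by
    push_cast; field_simp; ring
  rw [e, Real.sin_sub, Real.sin_nat_mul_pi, Real.cos_nat_mul_pi] at h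
  apply mul_right_cancel₀ hs.ne'
  rw [h]; ring

/-- Partial sums of the generating function of the Chebyshev polynomials of the second kind. -/
theorem mul_sum_U_mul_pow (x : ℝ) (z : ℂ) (n : ℕ) :
    (1 - 2 * x * z + z ^ 2) *
        ∑ j ∈ Finset.Icc 1 n, (((Chebyshev.U ℝ (j - 1)).eval x : ℝ) : ℂ) * z ^ j =
      z - (((Chebyshev.U ℝ n).eval x : ℝ) : ℂ) * z ^ (n + 1)
        + (((Chebyshev.U ℝ (n - 1)).eval x : ℝ) : ℂ) * z ^ (n + 2) := by
  induction n with
  | zero => simp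
  | succ n ih =>
    rw [Finset.sum_Icc_succ_top (by omega), mul_add, ih]
    have h := congrArg (fun p => (eval (x : ℂ) p)) (Chebyshev.U_add_one ℂ n)
    simp only [eval_sub, eval_mul, eval_X, eval_ofNat] at h
    push_cast
    rw [h]
    simp only [add_sub_cancel_right]
    ring

/-- The representation of `∑ a_j z^j` through the node weights. -/
theorem sum_coeff_mul_pow_eq (N L : ℕ) (hNL : N < L) (a : ℕ → ℝ) (f : ℕ → ℂ) :
    ∑ j ∈ Finset.Icc 1 N, (a j : ℂ) * f j = ∑ k ∈ Finset.range L, (nodeWeight N L a k : ℂ) *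
      ∑ j ∈ Finset.Icc 1 (L - 1),
        (((Chebyshev.U ℝ (j - 1)).eval (Real.cos (k * Real.pi / L)) : ℝ) : ℂ) * f j := by
  simp_rw [Finset.mul_sum]
  rw [Finset.sum_comm]
  have : ∀ j ∈ Finset.Icc 1 (L - 1), ∑ k ∈ Finset.range L, (nodeWeight N L a k : ℂ) *
      ((((Chebyshev.U ℝ (j - 1)).eval (Real.cos (k * Real.pi / L)) : ℝ) : ℂ) * f j) =
      if j ≤ N then (a j : ℂ) * f j else 0 := by
    intro j hj
    rw [Finset.mem_Icc] at hj
    have h := sum_nodeWeight_mul_U N L hNL a j hj.1 (by omega)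
    have h' := congrArg (fun x : ℝ => (x : ℂ) * f j) h
    simp only [Complex.ofReal_sum, Finset.sum_mul, Complex.ofReal_mul] at h'
    simp_rw [← mul_assoc]
    rw [h']
    split_ifs <;> simp
  rw [Finset.sum_congr rfl this, ← Finset.sum_filter]
  refine Finset.sum_congr ?_ fun _ _ => rfl
  ext j
  simp only [Finset.mem_Icc, Finset.mem_filter]
  omega

/-! ### Typically real polynomials and nonnegative sine polynomials -/

theorem eval_map_ofReal {N : ℕ} {P : ℝ[X]} (hd : P.natDegree ≤ N) (h0 : P.coeff 0 = 0) (z : ℂ) :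
    (P.map Complex.ofRealHom).eval z = ∑ j ∈ Finset.Icc 1 N, (P.coeff j : ℂ) * z ^ j := by
  have h : (P.map Complex.ofRealHom).natDegree < N + 1 :=
    lt_of_le_of_lt (natDegree_map_le) (by omega)
  rw [eval_eq_sum_range' h]
  symm
  refine (Finset.sum_subset (fun j hj => ?_) fun j hj hj' => ?_).trans
    (Finset.sum_congr rfl fun j _ => by simp)
  · simp only [Finset.mem_Icc, Finset.mem_range] at hj ⊢
    omega
  · simp only [Finset.mem_Icc, Finset.mem_range] at hj hj'
    obtain rfl : j = 0 := by omega
    simp [h0]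

theorem eval_map_ofReal_conj (P : ℝ[X]) (z : ℂ) :
    (P.map Complex.ofRealHom).eval (starRingEnd ℂ z) =
      starRingEnd ℂ ((P.map Complex.ofRealHom).eval z) := by
  rw [eval_map, eval_map, hom_eval₂]
  congr 1
  ext x
  simp

theorem im_sum_mul_pow (N : ℕ) (a : ℕ → ℝ) (r t : ℝ) :
    (∑ j ∈ Finset.Icc 1 N, (a j : ℂ) * (r * Complex.exp (t * Complex.I)) ^ j).im =
      ∑ j ∈ Finset.Icc 1 N, a j * r ^ j * Real.sin (j * t) := by
  rw [Complex.im_sum]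
  refine Finset.sum_congr rfl fun j _ => ?_
  rw [mul_pow, ← Complex.exp_nat_mul, ← Complex.ofReal_pow, Complex.im_ofReal_mul,
    Complex.im_ofReal_mul, show (j : ℂ) * (t * Complex.I) = ((j * t : ℝ) : ℂ) * Complex.I by
      push_cast; ring, Complex.exp_ofReal_mul_I_im]
  ring

theorem sineSum_zero (N : ℕ) (a : ℕ → ℝ) : sineSum N a 0 = 0 := by simp [sineSum]

theorem sineSum_pi (N : ℕ) (a : ℕ → ℝ) : sineSum N a Real.pi = 0 := by
  simp [sineSum, Real.sin_nat_mul_pi]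

/-- A normalized typically real polynomial comes from an admissible real polynomial. -/
theorem exists_auxAdmissible_of_typicallyReal {N : ℕ} {F : ℂ[X]}
    (hF : F ∈ typicallyRealPolysLE N) : ∃ P ∈ auxAdmissible N, F = P.map Complex.ofRealHom := by
  obtain ⟨hd, h0, h1, hT⟩ := hF
  -- F and its conjugate polynomial agree on the infinite set (-1, 1), so the coefficients are real.
  have hconj : F.map (starRingEnd ℂ) = F := by
    apply Polynomial.eq_of_infinite_eval_eq
    have hinf : ((fun x : ℝ => (x : ℂ)) '' Set.Ioo (-1) 1).Infinite :=
      (Set.Ioo_infinite (by norm_num)).image (Complex.ofReal_injective.injOn)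
    refine hinf.mono ?_
    rintro _ ⟨x, hx, rfl⟩
    have hb : (x : ℂ) ∈ Metric.ball (0 : ℂ) 1 := by
      rw [mem_ball_zero_iff, Complex.norm_real]
      exact abs_lt.mpr hx
    have him := (hT _ hb).1 (Complex.ofReal_im x)
    have e : (F.map (starRingEnd ℂ)).eval (x : ℂ) = starRingEnd ℂ (F.eval (x : ℂ)) := by
      have := Polynomial.eval_map_apply (starRingEnd ℂ) (x : ℂ) (p := F)
      simpa using this
    change (F.map (starRingEnd ℂ)).eval (x : ℂ) = F.eval (x : ℂ)
    rw [e]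
    exact Complex.conj_eq_iff_im.mpr him
  have hl : F ∈ Polynomial.lifts Complex.ofRealHom := by
    rw [Polynomial.lifts_iff_coeff_lifts]
    intro n
    have : starRingEnd ℂ (F.coeff n) = F.coeff n := by
      conv_rhs => rw [← hconj]
      rw [coeff_map]
    obtain ⟨r, hr⟩ := Complex.conj_eq_iff_real.mp this
    exact ⟨r, by simp [hr]⟩
  obtain ⟨P, hP⟩ := (Polynomial.mem_lifts _).mp hl
  subst hP
  have hinj : Function.Injective Complex.ofRealHom := Complex.ofRealHom.injective
  have hd' : P.natDegree ≤ N := by rwa [natDegree_map_eq_of_injective hinj] at hd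
  have h0' : P.coeff 0 = 0 := by
    rw [← coeff_zero_eq_eval_zero, coeff_map] at h0
    exact hinj (by simpa using h0)
  have h1' : P.coeff 1 = 1 := by
    rw [← coeff_zero_eq_eval_zero, coeff_derivative, coeff_map] at h1
    exact hinj (by simpa using h1)
  refine ⟨P, ⟨hd', h0', h1', ?_⟩, rfl⟩
  intro t ht
  change 0 ≤ sineSum N P.coeff t
  rcases eq_or_lt_of_le ht.1 with h | ht0
  · rw [← h, sineSum_zero]
  rcases eq_or_lt_of_le ht.2 with h | htp
  · rw [h, sineSum_pi]
  -- The strict inequality inside the disk survives at radius 1 only as a weak one.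
  have hlim : Filter.Tendsto (fun r : ℝ => ∑ j ∈ Finset.Icc 1 N, P.coeff j * r ^ j *
      Real.sin (j * t)) (nhdsWithin 1 (Set.Iio 1)) (nhds (sineSum N P.coeff t)) := by
    have : Continuous (fun r : ℝ => ∑ j ∈ Finset.Icc 1 N, P.coeff j * r ^ j *
      Real.sin (j * t)) := by fun_prop
    have h := (this.tendsto 1).mono_left (nhdsWithin_le_nhds (s := Set.Iio 1))
    simpa [sineSum] using h
  refine ge_of_tendsto hlim ?_
  have hmem : Set.Ioo (0 : ℝ) 1 ∈ nhdsWithin (1 : ℝ) (Set.Iio 1) :=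
    Ioo_mem_nhdsLT (by norm_num)
  filter_upwards [hmem] with r hr
  rw [← im_sum_mul_pow, ← eval_map_ofReal hd' h0']
  have hs := Real.sin_pos_of_pos_of_lt_pi ht0 htp
  have him : ((r : ℂ) * Complex.exp (t * Complex.I)).im = r * Real.sin t := by
    rw [Complex.im_ofReal_mul, Complex.exp_ofReal_mul_I_im]
  have hpos : 0 < ((r : ℂ) * Complex.exp (t * Complex.I)).im := by
    rw [him]; exact mul_pos hr.1 hs
  have hb : (r : ℂ) * Complex.exp (t * Complex.I) ∈ Metric.ball (0 : ℂ) 1 := by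
    rw [mem_ball_zero_iff, norm_mul, Complex.norm_exp_ofReal_mul_I, Complex.norm_real, mul_one,
      Real.norm_eq_abs, abs_of_pos hr.1]
    exact hr.2
  exact (pos_of_mul_pos_right ((hT _ hb).2 hpos.ne') hpos.le).le

/-- With c = cos s the quadratic factors as (z - e^{is})(z - e^{-is}), and each factor has modulus
between 1 - |z| and 2. -/
theorem normSq_one_sub_two_mul_add_sq_bounds {c : ℝ} (hc : |c| ≤ 1) {z : ℂ} (hz : ‖z‖ < 1) :
    (1 - ‖z‖) ^ 2 ≤ ‖1 - 2 * c * z + z ^ 2‖ ∧ ‖1 - 2 * c * z + z ^ 2‖ ≤ 4 := by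
  obtain ⟨h1, h2⟩ := abs_le.mp hc
  set s := Real.arccos c
  have hcs : (c : ℂ) = (Complex.exp (s * Complex.I) + Complex.exp (-s * Complex.I)) / 2 := by
    rw [← Complex.cos, ← Complex.ofReal_cos, Real.cos_arccos h1 h2]
  have hfac : 1 - 2 * c * z + z ^ 2 =
      (z - Complex.exp (s * Complex.I)) * (z - Complex.exp (-s * Complex.I)) := by
    have : Complex.exp (s * Complex.I) * Complex.exp (-s * Complex.I) = 1 := by
      rw [← Complex.exp_add]; simp
    rw [hcs]; linear_combination -this
  have n1 : ‖Complex.exp (s * Complex.I)‖ = 1 := Complex.norm_exp_ofReal_mul_I s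
  have n2 : ‖Complex.exp (-s * Complex.I)‖ = 1 := by
    have := Complex.norm_exp_ofReal_mul_I (-s)
    simpa using this
  rw [hfac, norm_mul]
  have b1 : 1 - ‖z‖ ≤ ‖z - Complex.exp (s * Complex.I)‖ := by
    rw [norm_sub_rev]
    have := norm_sub_norm_le (Complex.exp (s * Complex.I)) z
    rwa [n1] at this
  have b2 : 1 - ‖z‖ ≤ ‖z - Complex.exp (-s * Complex.I)‖ := by
    rw [norm_sub_rev]
    have := norm_sub_norm_le (Complex.exp (-s * Complex.I)) z
    rwa [n2] at this
  have u1 := norm_sub_le z (Complex.exp (s * Complex.I))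
  have u2 := norm_sub_le z (Complex.exp (-s * Complex.I))
  rw [n1] at u1
  rw [n2] at u2
  constructor
  · rw [sq]
    exact mul_le_mul b1 b2 (by linarith) (norm_nonneg _)
  · calc _ ≤ (2 : ℝ) * 2 := mul_le_mul (by linarith) (by linarith) (norm_nonneg _) (by norm_num)
      _ = 4 := by norm_num

theorem im_div_one_sub_two_mul_add_sq {c : ℝ} {z : ℂ} :
    (z / (1 - 2 * c * z + z ^ 2)).im =
      z.im * (1 - ‖z‖ ^ 2) / ‖1 - 2 * c * z + z ^ 2‖ ^ 2 := by
  rw [Complex.div_im, ← Complex.normSq_eq_norm_sq, ← Complex.normSq_eq_norm_sq,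
    Complex.normSq_apply z]
  simp [pow_two]
  ring

/-- At a node the truncated kernel is z/D - (-1)^k z^{L+1}/D with D = 1 - 2cz + z². The first part
has positive imaginary part, bounded below through |D| ≤ 4; the second is small because |D| ≥ (1 -
|z|)². The bound does not depend on k, so it can be averaged over the weights. -/
theorem le_im_kernel {L : ℕ} {k : ℕ} (hk0 : 1 ≤ k) (hk : k < L) {z : ℂ} (hz : ‖z‖ < 1)
    (hi : 0 < z.im) :
    z.im * (1 - ‖z‖ ^ 2) / 16 - ‖z‖ ^ L / (1 - ‖z‖) ^ 2 ≤ (∑ j ∈ Finset.Icc 1 (L - 1),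
      (((Chebyshev.U ℝ (j - 1)).eval (Real.cos (k * Real.pi / L)) : ℝ) : ℂ) * z ^ j).im := by
  set c := Real.cos (k * Real.pi / L)
  have hc : |c| ≤ 1 := Real.abs_cos_le_one _
  obtain ⟨lo, hi4⟩ := normSq_one_sub_two_mul_add_sq_bounds hc hz
  have hr : 0 < 1 - ‖z‖ := by linarith
  set D := 1 - 2 * (c : ℂ) * z + z ^ 2
  have hDpos : 0 < ‖D‖ := lt_of_lt_of_le (by positivity) lo
  have hD : D ≠ 0 := norm_pos_iff.mp hDpos
  have h := mul_sum_U_mul_pow c z (L - 1)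
  have e1 : ((L - 1 : ℕ) : ℤ) = (L : ℤ) - 1 := by omega
  rw [e1, U_sub_one_node hk0 hk, show (L : ℤ) - 1 - 1 = L - 2 by ring, U_sub_two_node hk0 hk,
    show L - 1 + 2 = L + 1 by omega] at h
  have hK : (∑ j ∈ Finset.Icc 1 (L - 1), (((Chebyshev.U ℝ (j - 1)).eval c : ℝ) : ℂ) * z ^ j) =
      z / D + (-(-1) ^ k * z ^ (L + 1)) / D := by
    rw [← add_div, eq_div_iff hD, mul_comm]
    rw [h]; push_cast; ring
  rw [hK, Complex.add_im, im_div_one_sub_two_mul_add_sq]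
  have hz0 : 0 ≤ ‖z‖ := norm_nonneg z
  have hz2 : 0 < 1 - ‖z‖ ^ 2 := by nlinarith
  have b1 : z.im * (1 - ‖z‖ ^ 2) / 16 ≤ z.im * (1 - ‖z‖ ^ 2) / ‖D‖ ^ 2 := by
    apply div_le_div_of_nonneg_left (by positivity) (by positivity)
    nlinarith
  have b2 : ‖(-(-1) ^ k * z ^ (L + 1)) / D‖ ≤ ‖z‖ ^ L / (1 - ‖z‖) ^ 2 := by
    rw [norm_div, norm_mul, norm_neg, norm_pow, norm_pow, norm_neg, norm_one, one_pow, one_mul]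
    apply div_le_div₀ (by positivity) _ (by positivity) lo
    exact pow_le_pow_of_le_one hz0 hz.le (by omega)
  have b3 := (abs_le.mp ((Complex.abs_im_le_norm ((-(-1) ^ k * z ^ (L + 1)) / D)).trans b2)).1
  linarith

/-- The node weights are nonnegative with sum 1, so the kernel bound passes to F for every L > N;
the error term dies as L → ∞ while the main term stays positive. -/
theorem im_pos_of_sineSum_nonneg {N : ℕ} (hN : 1 ≤ N) {a : ℕ → ℝ} (h1 : a 1 = 1)
    (ha : ∀ t ∈ Set.Icc (0 : ℝ) Real.pi, 0 ≤ sineSum N a t) {z : ℂ} (hz : ‖z‖ < 1)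
    (hi : 0 < z.im) : 0 < (∑ j ∈ Finset.Icc 1 N, (a j : ℂ) * z ^ j).im := by
  have hz0 : 0 ≤ ‖z‖ := norm_nonneg z
  have hz2 : 0 < 1 - ‖z‖ ^ 2 := by nlinarith
  have hbound : ∀ L : ℕ, N < L → z.im * (1 - ‖z‖ ^ 2) / 16 - ‖z‖ ^ L / (1 - ‖z‖) ^ 2 ≤
      (∑ j ∈ Finset.Icc 1 N, (a j : ℂ) * z ^ j).im := by
    intro L hL
    rw [sum_coeff_mul_pow_eq N L hL a, Complex.im_sum]
    have hsum := sum_nodeWeight N L hN hL a h1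
    calc z.im * (1 - ‖z‖ ^ 2) / 16 - ‖z‖ ^ L / (1 - ‖z‖) ^ 2
        = ∑ k ∈ Finset.range L, nodeWeight N L a k *
          (z.im * (1 - ‖z‖ ^ 2) / 16 - ‖z‖ ^ L / (1 - ‖z‖) ^ 2) := by
            rw [← Finset.sum_mul, hsum, one_mul]
      _ ≤ _ := by
        refine Finset.sum_le_sum fun k hk => ?_
        rw [Finset.mem_range] at hk
        rw [Complex.im_ofReal_mul]
        rcases Nat.eq_zero_or_pos k with rfl | hk0
        · simp [nodeWeight_zero]
        · exact mul_le_mul_of_nonneg_left (le_im_kernel hk0 hk hz hi) (nodeWeight_nonneg ha hk)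
  have hlim : Filter.Tendsto (fun L : ℕ => z.im * (1 - ‖z‖ ^ 2) / 16 - ‖z‖ ^ L / (1 - ‖z‖) ^ 2)
      Filter.atTop (nhds (z.im * (1 - ‖z‖ ^ 2) / 16)) := by
    have := (tendsto_pow_atTop_nhds_zero_of_lt_one hz0 hz).div_const ((1 - ‖z‖) ^ 2)
    simpa using this.const_sub (z.im * (1 - ‖z‖ ^ 2) / 16)
  have := le_of_tendsto hlim (Filter.eventually_atTop.mpr ⟨N + 1, fun L hL => hbound L hL⟩)
  exact lt_of_lt_of_le (by positivity) this

/-- Admissible real polynomials are typically real. -/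
theorem map_mem_typicallyRealPolysLE {N : ℕ} (hN : 1 ≤ N) {P : ℝ[X]} (hP : P ∈ auxAdmissible N) :
    P.map Complex.ofRealHom ∈ typicallyRealPolysLE N := by
  obtain ⟨hd, h0, h1, hS⟩ := hP
  refine ⟨natDegree_map_le.trans hd, ?_, ?_, ?_⟩
  · rw [← coeff_zero_eq_eval_zero, coeff_map, h0]; simp
  · rw [← coeff_zero_eq_eval_zero, coeff_derivative, coeff_map]; simp [h1]
  · intro z hz
    rw [mem_ball_zero_iff] at hz
    refine ⟨fun hzi => ?_, fun hzi => ?_⟩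
    · rw [← Complex.conj_eq_iff_im] at hzi ⊢
      rw [← eval_map_ofReal_conj, hzi]
    · rcases lt_or_gt_of_ne hzi with h | h
      · have := im_pos_of_sineSum_nonneg hN h1 hS (z := starRingEnd ℂ z)
          (by simpa using hz) (by simpa using h)
        rw [← eval_map_ofReal hd h0, eval_map_ofReal_conj, Complex.conj_im] at this
        exact mul_pos_of_neg_of_neg h (by linarith)
      · have := im_pos_of_sineSum_nonneg hN h1 hS hz h
        rw [← eval_map_ofReal hd h0] at this
        exact mul_pos h this

/-- The supremum of `|F|` on the open disk is its maximum on the unit circle. -/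
theorem isGreatest_diskSup (F : ℂ[X]) :
    IsGreatest (Set.range fun t : ℝ => ‖F.eval (Complex.exp (t * Complex.I))‖) (diskSup F) := by
  have hdiff : DiffContOnCl ℂ (fun z => F.eval z) (Metric.ball (0 : ℂ) 1) :=
    F.differentiable.diffContOnCl
  obtain ⟨w, hw, hmax⟩ := Complex.exists_mem_frontier_isMaxOn_norm
    (Metric.isBounded_ball (x := (0 : ℂ)) (r := 1)) ⟨0, by simp⟩ hdiff
  rw [frontier_ball (0 : ℂ) one_ne_zero, mem_sphere_zero_iff_norm] at hw
  rw [closure_ball (0 : ℂ) one_ne_zero] at hmax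
  have hle : ∀ z : ℂ, ‖z‖ ≤ 1 → ‖F.eval z‖ ≤ ‖F.eval w‖ := fun z hz =>
    hmax (show z ∈ Metric.closedBall (0 : ℂ) 1 by simpa using hz)
  have hsup : diskSup F = ‖F.eval w‖ := by
    have hbdd : BddAbove ((fun z : ℂ => ‖F.eval z‖) '' Metric.ball (0 : ℂ) 1) :=
      ⟨‖F.eval w‖, by rintro _ ⟨z, hz, rfl⟩; exact hle z (by simpa using (mem_ball_zero_iff.mp hz).le)⟩
    apply le_antisymm
    · refine csSup_le (Set.Nonempty.image _ ⟨0, by simp⟩) ?_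
      rintro _ ⟨z, hz, rfl⟩
      exact hle z (by simpa using (mem_ball_zero_iff.mp hz).le)
    · have hcont : Continuous fun r : ℝ => ‖F.eval ((r : ℂ) * w)‖ := by fun_prop
      have hlim := (hcont.tendsto 1).mono_left (nhdsWithin_le_nhds (s := Set.Iio 1))
      rw [Complex.ofReal_one, one_mul] at hlim
      refine le_of_tendsto hlim ?_
      filter_upwards [Ioo_mem_nhdsLT (show (0 : ℝ) < 1 by norm_num)] with r hr
      apply le_csSup hbdd
      refine ⟨(r : ℂ) * w, ?_, rfl⟩
      rw [mem_ball_zero_iff, norm_mul, hw, Complex.norm_real, Real.norm_eq_abs, abs_of_pos hr.1]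
      simpa using hr.2
  rw [hsup]
  constructor
  · refine ⟨w.arg, ?_⟩
    have : Complex.exp (w.arg * Complex.I) = w := by
      have := Complex.norm_mul_exp_arg_mul_I w
      rwa [hw, Complex.ofReal_one, one_mul] at this
    simp only [this]
  · rintro _ ⟨t, rfl⟩
    exact hle _ (Complex.norm_exp_ofReal_mul_I t).le

/-! ### Fejér–Riesz factorization -/

/-- A negative value of Q at an interior point persists nearby and would force D to vanish on a
whole neighbourhood; the endpoints follow by closure. This lets a factor be divided out even where
it has zeros in the interval. -/
theorem eval_nonneg_of_mul_nonneg {D Q : ℝ[X]} (hD : D ≠ 0)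
    (hD0 : ∀ x ∈ Set.Icc (-1 : ℝ) 1, 0 ≤ D.eval x)
    (h : ∀ x ∈ Set.Icc (-1 : ℝ) 1, 0 ≤ (D * Q).eval x) :
    ∀ x ∈ Set.Icc (-1 : ℝ) 1, 0 ≤ Q.eval x := by
  have hIoo : ∀ x ∈ Set.Ioo (-1 : ℝ) 1, 0 ≤ Q.eval x := by
    intro x hx
    by_contra! hneg
    have hev : ∀ᶠ y in nhds x, Q.eval y < 0 ∧ y ∈ Set.Ioo (-1 : ℝ) 1 :=
      (Q.continuous.continuousAt.eventually_lt continuousAt_const hneg).and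
        (Ioo_mem_nhds hx.1 hx.2)
    apply hD
    apply Polynomial.eq_zero_of_infinite_isRoot
    refine (infinite_of_mem_nhds x hev).mono ?_
    rintro y ⟨hy1, hy2⟩
    have hy := Set.Ioo_subset_Icc_self hy2
    have h1 := hD0 y hy
    have h2 := h y hy
    rw [eval_mul] at h2
    exact le_antisymm (nonpos_of_mul_nonneg_left h2 hy1) h1
  intro x hx
  have hc : IsClosed {x : ℝ | 0 ≤ Q.eval x} := isClosed_le continuous_const Q.continuous
  have : closure (Set.Ioo (-1 : ℝ) 1) ⊆ {x : ℝ | 0 ≤ Q.eval x} :=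
    closure_minimal hIoo hc
  rw [closure_Ioo (by norm_num)] at this
  exact this hx

/-- The quadratic takes the value e^{it}(cos t - z), so every factor cos t - z, real or complex, is
the modulus of a polynomial in e^{it}. -/
theorem norm_sq_cos_sub (t : ℝ) (z : ℂ) :
    ‖((C (1 / 2 : ℂ)) * (X ^ 2 - C (2 * z) * X + 1)).eval (Complex.exp (t * Complex.I))‖ =
      ‖(Real.cos t : ℂ) - z‖ := by
  have h : ((C (1 / 2 : ℂ)) * (X ^ 2 - C (2 * z) * X + 1)).eval (Complex.exp (t * Complex.I)) =
      Complex.exp (t * Complex.I) * ((Real.cos t : ℂ) - z) := by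
    have hm : Complex.exp (t * Complex.I) * Complex.exp (-t * Complex.I) = 1 := by
      rw [← Complex.exp_add]; simp
    rw [Complex.ofReal_cos, Complex.cos]
    simp only [eval_mul, eval_C, eval_add, eval_sub, eval_pow, eval_X, eval_one]
    linear_combination (-1 / 2 : ℂ) * hm
  rw [h, norm_mul, Complex.norm_exp_ofReal_mul_I, one_mul]

theorem normSq_exp_add (t a b : ℝ) :
    ‖(C (a : ℂ) + C (b : ℂ) * X).eval (Complex.exp (t * Complex.I))‖ ^ 2 =
      a ^ 2 + b ^ 2 + 2 * a * b * Real.cos t := by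
  rw [← Complex.normSq_eq_norm_sq, Complex.normSq_apply]
  simp only [eval_add, eval_mul, eval_C, eval_X, Complex.add_re, Complex.add_im,
    Complex.re_ofReal_mul, Complex.im_ofReal_mul, Complex.exp_ofReal_mul_I_re,
    Complex.exp_ofReal_mul_I_im, Complex.ofReal_re, Complex.ofReal_im]
  linear_combination b ^ 2 * Real.sin_sq_add_cos_sq t

/-- **Fejér–Riesz**: a real polynomial that is nonnegative on `[-1, 1]` is, after the substitution
`x = cos t`, the squared modulus of a polynomial of no larger degree on the unit circle. -/
theorem exists_eval_cos_eq_norm_sq (n : ℕ) (G : ℝ[X]) (hn : G.natDegree ≤ n)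
    (hG : ∀ x ∈ Set.Icc (-1 : ℝ) 1, 0 ≤ G.eval x) :
    ∃ h : ℂ[X], h.natDegree ≤ n ∧
      ∀ t : ℝ, G.eval (Real.cos t) = ‖h.eval (Complex.exp (t * Complex.I))‖ ^ 2 := by
  induction n using Nat.strong_induction_on generalizing G with
  | _ n ih =>
  by_cases hdeg : G.natDegree = 0
  · rw [natDegree_eq_zero] at hdeg
    obtain ⟨c, rfl⟩ := hdeg
    have hc : 0 ≤ c := by simpa using hG 0 (by norm_num)
    refine ⟨C (Real.sqrt c : ℂ), by simp, fun t => ?_⟩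
    simp [abs_of_nonneg (Real.sqrt_nonneg c), Real.sq_sqrt hc]
  have hG0 : G ≠ 0 := by rintro rfl; simp at hdeg
  -- The induction peels off a real divisor D that already is a squared modulus; the quotient stays
  -- nonnegative. The remaining cases only choose D from a root of G.
  have step : ∀ (D : ℝ[X]) (k : ℂ[X]), D ∣ G → D.natDegree ≠ 0 → k.natDegree ≤ D.natDegree →
      (∀ t : ℝ, D.eval (Real.cos t) = ‖k.eval (Complex.exp (t * Complex.I))‖ ^ 2) →
      ∃ h : ℂ[X], h.natDegree ≤ n ∧
        ∀ t : ℝ, G.eval (Real.cos t) = ‖h.eval (Complex.exp (t * Complex.I))‖ ^ 2 := by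
    rintro D k ⟨Q, rfl⟩ hD hk hDk
    have hD0 : D ≠ 0 := left_ne_zero_of_mul hG0
    have hQ0 : Q ≠ 0 := right_ne_zero_of_mul hG0
    rw [natDegree_mul hD0 hQ0] at hn
    have hDn : ∀ x ∈ Set.Icc (-1 : ℝ) 1, 0 ≤ D.eval x := by
      intro x hx
      rw [← Real.cos_arccos hx.1 hx.2, hDk]
      positivity
    obtain ⟨h, hh, hQh⟩ := ih (n - D.natDegree) (by omega) Q (by omega)
      (eval_nonneg_of_mul_nonneg hD0 hDn hG)
    refine ⟨k * h, natDegree_mul_le.trans (by omega), fun t => ?_⟩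
    rw [eval_mul, eval_mul, hDk, hQh, norm_mul, mul_pow]
  have hquad : ∀ z : ℂ, ((C (1 / 2 : ℂ)) * (X ^ 2 - C (2 * z) * X + 1)).natDegree ≤ 2 := by
    intro z; compute_degree
  obtain ⟨z, hz⟩ := IsAlgClosed.exists_aeval_eq_zero ℂ G
    (fun h => hdeg (natDegree_eq_zero_iff_degree_le_zero.mpr h.le))
  by_cases him : z.im = 0
  · obtain ⟨a, rfl⟩ : ∃ a : ℝ, (a : ℂ) = z := ⟨z.re, Complex.ext rfl (by simp [him])⟩
    have hroot : G.IsRoot a := by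
      have h : aeval (algebraMap ℝ ℂ a) G = 0 := hz
      rw [aeval_algebraMap_apply] at h
      have := (algebraMap ℝ ℂ).injective (h.trans (map_zero _).symm)
      simpa [IsRoot] using this
    rcases le_or_gt a (-1) with ha | ha
    -- The squares (-a ± s)/2 have sum -a and product 1/4, so |A + Be^{it}|² = A² + B² + 2AB cos t
    -- equals cos t - a. For a ≥ 1 the sign of B is reversed.
    · set s := Real.sqrt (a ^ 2 - 1)
      have hs : s ^ 2 = a ^ 2 - 1 := Real.sq_sqrt (by nlinarith)
      have hs0 : 0 ≤ s := Real.sqrt_nonneg _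
      have h1 : 0 ≤ (-a + s) / 2 := by linarith
      have h2 : 0 ≤ (-a - s) / 2 := by nlinarith
      refine step (X - C a) (C ((Real.sqrt ((-a + s) / 2) : ℝ) : ℂ) +
        C ((Real.sqrt ((-a - s) / 2) : ℝ) : ℂ) * X) (dvd_iff_isRoot.mpr hroot) (by simp) ?_ ?_
      · rw [natDegree_X_sub_C]; compute_degree
      · intro t
        rw [normSq_exp_add, Real.sq_sqrt h1, Real.sq_sqrt h2, mul_assoc 2, ← Real.sqrt_mul h1,
          show (-a + s) / 2 * ((-a - s) / 2) = (1 / 2) ^ 2 by nlinarith,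
          Real.sqrt_sq (by norm_num)]
        simp; ring
    rcases le_or_gt 1 a with ha1 | ha1
    · set s := Real.sqrt (a ^ 2 - 1)
      have hs : s ^ 2 = a ^ 2 - 1 := Real.sq_sqrt (by nlinarith)
      have hs0 : 0 ≤ s := Real.sqrt_nonneg _
      have h1 : 0 ≤ (a + s) / 2 := by linarith
      have h2 : 0 ≤ (a - s) / 2 := by nlinarith
      refine step (-(X - C a)) (C ((Real.sqrt ((a + s) / 2) : ℝ) : ℂ) +
        C ((-Real.sqrt ((a - s) / 2) : ℝ) : ℂ) * X) ?_ (by rw [natDegree_neg]; simp) ?_ ?_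
      · rw [neg_dvd]; exact dvd_iff_isRoot.mpr hroot
      · rw [natDegree_neg, natDegree_X_sub_C]; compute_degree
      · intro t
        rw [normSq_exp_add, neg_sq, Real.sq_sqrt h1, Real.sq_sqrt h2, mul_neg, mul_assoc 2,
          ← Real.sqrt_mul h1, show (a + s) / 2 * ((a - s) / 2) = (1 / 2) ^ 2 by nlinarith,
          Real.sqrt_sq (by norm_num)]
        simp; ring
    -- A root inside (-1, 1) is a local minimum of a nonnegative function, hence at least double.
    · have hmin : IsLocalMin (fun x => G.eval x) a := by
        filter_upwards [Icc_mem_nhds ha ha1] with x hx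
        have := hG x hx
        rw [hroot.eq_zero]; exact this
      have hder : (derivative G).IsRoot a := by
        have := hmin.deriv_eq_zero
        rwa [Polynomial.deriv] at this
      have hdvd : (X - C a) ^ 2 ∣ G := by
        rw [← le_rootMultiplicity_iff hG0]
        exact (one_lt_rootMultiplicity_iff_isRoot hG0).mpr ⟨hroot, hder⟩
      refine step _ _ hdvd (by simp) ((hquad a).trans (by simp)) fun t => ?_
      rw [norm_sq_cos_sub, ← Complex.ofReal_sub, Complex.norm_real, Real.norm_eq_abs, sq_abs]
      simp
  · refine step _ _ (Polynomial.quadratic_dvd_of_aeval_eq_zero_im_ne_zero G hz him) ?_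
      ((hquad z).trans ?_) fun t => ?_
    · rw [show (X ^ 2 - C (2 * z.re) * X + C (‖z‖ ^ 2) : ℝ[X]).natDegree = 2 by
        compute_degree!]
      norm_num
    · rw [show (X ^ 2 - C (2 * z.re) * X + C (‖z‖ ^ 2) : ℝ[X]).natDegree = 2 by
        compute_degree!]
    · rw [norm_sq_cos_sub, ← Complex.normSq_eq_norm_sq ((Real.cos t : ℂ) - z),
        Complex.normSq_apply]
      rw [← Complex.normSq_eq_norm_sq z, Complex.normSq_apply]
      simp only [eval_add, eval_sub, eval_pow, eval_X, eval_mul, eval_C, Complex.sub_re,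
        Complex.sub_im, Complex.ofReal_re, Complex.ofReal_im]
      ring

/-- The cosine polynomial `S(t) / sin t` written as a polynomial in `cos t`. -/
theorem exists_poly_of_sineSum (N : ℕ) (hN : 1 ≤ N) (a : ℕ → ℝ) :
    ∃ G : ℝ[X], G.natDegree ≤ N - 1 ∧
      ∀ t : ℝ, sineSum N a t = G.eval (Real.cos t) * Real.sin t := by
  refine ⟨∑ j ∈ Finset.Icc 1 N, C (a j) * Chebyshev.U ℝ (j - 1), ?_, fun t => ?_⟩
  · refine natDegree_sum_le_of_forall_le _ _ fun j hj => ?_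
    rw [Finset.mem_Icc] at hj
    refine (natDegree_C_mul_le _ _).trans ?_
    rw [show (j : ℤ) - 1 = ((j - 1 : ℕ) : ℤ) by omega, Chebyshev.natDegree_U_natCast]
    omega
  · rw [sineSum, eval_finsetSum, Finset.sum_mul]
    refine Finset.sum_congr rfl fun j _ => ?_
    rw [eval_mul, eval_C, mul_assoc, Chebyshev.U_real_cos]
    push_cast
    ring_nf

/-- S(t)/sin t is a polynomial in cos t, nonnegative on (-1, 1) where sin t > 0 and by continuity at
±1, so Fejér–Riesz applies. -/
theorem exists_sineSum_eq_norm_sq (N : ℕ) (hN : 1 ≤ N) (a : ℕ → ℝ)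
    (ha : ∀ t ∈ Set.Icc (0 : ℝ) Real.pi, 0 ≤ sineSum N a t) :
    ∃ h : ℂ[X], h.natDegree ≤ N - 1 ∧ ∀ t : ℝ,
      sineSum N a t = ‖h.eval (Complex.exp (t * Complex.I))‖ ^ 2 * Real.sin t := by
  obtain ⟨G, hd, hG⟩ := exists_poly_of_sineSum N hN a
  have hIoo : ∀ x ∈ Set.Ioo (-1 : ℝ) 1, 0 ≤ G.eval x := by
    intro x hx
    have h := ha (Real.arccos x) ⟨Real.arccos_nonneg x, Real.arccos_le_pi x⟩
    rw [hG, Real.cos_arccos hx.1.le hx.2.le, Real.sin_arccos] at h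
    exact nonneg_of_mul_nonneg_left h (Real.sqrt_pos.mpr (by nlinarith [hx.1, hx.2]))
  have hcl : closure (Set.Ioo (-1 : ℝ) 1) ⊆ {x : ℝ | 0 ≤ G.eval x} :=
    closure_minimal hIoo (isClosed_le continuous_const G.continuous)
  rw [closure_Ioo (by norm_num)] at hcl
  obtain ⟨h, hh, hGh⟩ := exists_eval_cos_eq_norm_sq (N - 1) G hd hcl
  exact ⟨h, hh, fun t => by rw [hG, hGh]⟩

/-! ### Autocorrelations -/

/-- Sums over ℤ of finitely supported functions are translation invariant; the hypotheses say that
the two finite sets contain the supports. -/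
theorem sum_shift {f : ℤ → ℝ} {s s' : Finset ℤ} (k : ℤ) (hs : ∀ j, j ∉ s → f j = 0)
    (hs' : ∀ j, j ∉ s' → f (j + k) = 0) : ∑ j ∈ s', f (j + k) = ∑ j ∈ s, f j := by
  rw [← finsum_eq_sum_of_support_subset (s := s) f
      (fun j hj => by by_contra h; exact hj (hs j h)),
    ← finsum_eq_sum_of_support_subset (s := s') (fun j => f (j + k))
      (fun j hj => by by_contra h; exact hj (hs' j h))]
  exact finsum_comp_equiv (Equiv.addRight k)

/-- `v` vanishes outside `1, …, N`. -/
def SupportedIn (N : ℕ) (v : ℤ → ℝ) : Prop := ∀ j : ℤ, j ∉ Finset.Icc (1 : ℤ) N → v j = 0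

/-- The autocorrelation of a sequence supported in `1, …, N`. -/
noncomputable def autocorr (N : ℕ) (v : ℤ → ℝ) (k : ℤ) : ℝ :=
  ∑ j ∈ Finset.Icc (1 : ℤ) N, v j * v (j + k)

theorem autocorr_neg {N : ℕ} {v : ℤ → ℝ} (hv : SupportedIn N v) (k : ℤ) :
    autocorr N v (-k) = autocorr N v k := by
  unfold autocorr
  rw [← sum_shift (f := fun j => v j * v (j + -k)) (s' := Finset.Icc (1 : ℤ) N) k]
  · refine Finset.sum_congr rfl fun j _ => ?_
    rw [show j + k + -k = j by ring, mul_comm]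
  · intro j hj; simp only [hv j hj, zero_mul]
  · intro j hj
    rw [show j + k + -k = j by ring, hv j hj, mul_zero]

theorem autocorr_eq_zero {N : ℕ} {v : ℤ → ℝ} (hv : SupportedIn N v) {k : ℤ} (hk : (N : ℤ) ≤ |k|) :
    autocorr N v k = 0 := by
  refine Finset.sum_eq_zero fun j hj => ?_
  rw [hv (j + k), mul_zero]
  simp only [Finset.mem_Icc] at hj ⊢
  rcases abs_cases k with h | h <;> omega

/-- The squared modulus of `∑ v_j e^{ijt}`. -/
noncomputable def trigSq (N : ℕ) (v : ℤ → ℝ) (t : ℝ) : ℝ :=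
  (∑ j ∈ Finset.Icc (1 : ℤ) N, v j * Real.cos (j * t)) ^ 2 +
    (∑ j ∈ Finset.Icc (1 : ℤ) N, v j * Real.sin (j * t)) ^ 2

theorem trigSq_eq_sum_autocorr {N : ℕ} {v : ℤ → ℝ} (hv : SupportedIn N v) (t : ℝ) :
    trigSq N v t = ∑ d ∈ Finset.Icc (-(N : ℤ)) N, autocorr N v d * Real.cos (d * t) := by
  have h1 : trigSq N v t = ∑ j ∈ Finset.Icc (1 : ℤ) N, ∑ l ∈ Finset.Icc (1 : ℤ) N,
      v j * (v l * Real.cos ((l - j : ℤ) * t)) := by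
    rw [trigSq, sq, sq, Finset.sum_mul_sum, Finset.sum_mul_sum, ← Finset.sum_add_distrib]
    refine Finset.sum_congr rfl fun j _ => ?_
    rw [← Finset.sum_add_distrib]
    refine Finset.sum_congr rfl fun l _ => ?_
    rw [show ((l - j : ℤ) : ℝ) * t = l * t - j * t by push_cast; ring, Real.cos_sub]
    ring
  have h2 : ∀ j ∈ Finset.Icc (1 : ℤ) N, ∑ l ∈ Finset.Icc (1 : ℤ) N,
      v j * (v l * Real.cos ((l - j : ℤ) * t)) =
      ∑ d ∈ Finset.Icc (-(N : ℤ)) N, v j * v (j + d) * Real.cos (d * t) := by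
    intro j hj
    rw [← sum_shift (f := fun l => v j * (v l * Real.cos ((l - j : ℤ) * t)))
      (s' := Finset.Icc (-(N : ℤ)) N) j]
    · refine Finset.sum_congr rfl fun d _ => ?_
      rw [show d + j - j = d by ring, add_comm d j]; ring
    · intro l hl; simp only [hv l hl]; ring
    · intro d hd
      rw [hv (d + j)]
      · ring
      · simp only [Finset.mem_Icc] at hj hd ⊢; omega
  rw [h1, Finset.sum_congr rfl h2, Finset.sum_comm]
  simp_rw [autocorr, Finset.sum_mul]

/-- The sine coefficients of `|∑ v_j e^{ijt}|² sin t`. -/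
noncomputable def corrCoeff (N : ℕ) (v : ℤ → ℝ) (k : ℕ) : ℝ :=
  autocorr N v (k - 1) - autocorr N v (k + 1)

/-- Multiplying by sin t turns each cosine into half the difference of two neighbouring sines. The
resulting terms g(k) are even in k, so half the two-sided sum is the one-sided sum. -/
theorem trigSq_mul_sin {N : ℕ} {v : ℤ → ℝ} (hv : SupportedIn N v) (t : ℝ) :
    trigSq N v t * Real.sin t = sineSum N (corrCoeff N v) t := by
  have e1 : ∑ d ∈ Finset.Icc (-(N : ℤ)) N, autocorr N v d * Real.sin ((d + 1 : ℤ) * t) =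
      ∑ k ∈ Finset.Icc (-((N + 1 : ℕ) : ℤ)) (N + 1 : ℕ),
        autocorr N v (k - 1) * Real.sin (k * t) := by
    rw [← sum_shift (f := fun k : ℤ => autocorr N v (k - 1) * Real.sin (k * t))
      (s' := Finset.Icc (-(N : ℤ)) N) 1]
    · refine Finset.sum_congr rfl fun d _ => ?_
      rw [add_sub_cancel_right]
    · intro k hk
      simp only [Finset.mem_Icc] at hk
      rw [autocorr_eq_zero hv (by rcases abs_cases (k - 1) with h | h <;> omega), zero_mul]
    · intro k hk
      simp only [Finset.mem_Icc] at hk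
      rw [autocorr_eq_zero hv (by rcases abs_cases (k + 1 - 1) with h | h <;> omega), zero_mul]
  have e2 : ∑ d ∈ Finset.Icc (-(N : ℤ)) N, autocorr N v d * Real.sin ((d - 1 : ℤ) * t) =
      ∑ k ∈ Finset.Icc (-((N + 1 : ℕ) : ℤ)) (N + 1 : ℕ),
        autocorr N v (k + 1) * Real.sin (k * t) := by
    rw [← sum_shift (f := fun k : ℤ => autocorr N v (k + 1) * Real.sin (k * t))
      (s' := Finset.Icc (-(N : ℤ)) N) (-1)]
    · refine Finset.sum_congr rfl fun d _ => ?_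
      rw [show d + -1 + 1 = d by ring, show d - 1 = d + -1 by ring]
    · intro k hk
      simp only [Finset.mem_Icc] at hk
      rw [autocorr_eq_zero hv (by rcases abs_cases (k + 1) with h | h <;> omega), zero_mul]
    · intro k hk
      simp only [Finset.mem_Icc] at hk
      rw [autocorr_eq_zero hv (by rcases abs_cases (k + -1 + 1) with h | h <;> omega), zero_mul]
  set g : ℤ → ℝ := fun k => (autocorr N v (k - 1) - autocorr N v (k + 1)) * Real.sin (k * t)
  have hg : Function.Even g := by
    intro k
    symm
    simp only [g]
    rw [show -k - 1 = -(k + 1) by ring, show -k + 1 = -(k - 1) by ring, autocorr_neg hv,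
      autocorr_neg hv]
    push_cast
    rw [neg_mul, Real.sin_neg]; ring
  have h3 : trigSq N v t * Real.sin t =
      (∑ k ∈ Finset.Icc (-((N + 1 : ℕ) : ℤ)) (N + 1 : ℕ), g k) / 2 := by
    have : ∑ k ∈ Finset.Icc (-((N + 1 : ℕ) : ℤ)) (N + 1 : ℕ), g k =
        ∑ d ∈ Finset.Icc (-(N : ℤ)) N, autocorr N v d * Real.sin ((d + 1 : ℤ) * t) -
        ∑ d ∈ Finset.Icc (-(N : ℤ)) N, autocorr N v d * Real.sin ((d - 1 : ℤ) * t) := by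
      rw [e1, e2, ← Finset.sum_sub_distrib]
      refine Finset.sum_congr rfl fun k _ => ?_
      simp only [g]; ring
    rw [this, ← Finset.sum_sub_distrib, Finset.sum_div, trigSq_eq_sum_autocorr hv, Finset.sum_mul]
    refine Finset.sum_congr rfl fun d _ => ?_
    rw [show ((d + 1 : ℤ) : ℝ) * t = d * t + t by push_cast; ring,
      show ((d - 1 : ℤ) : ℝ) * t = d * t - t by push_cast; ring, Real.sin_add, Real.sin_sub]
    ring
  have hg0 : g 0 = 0 := by simp [g]
  have hgN : g (N + 1 : ℕ) = 0 := by
    simp only [g]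
    rw [autocorr_eq_zero hv, autocorr_eq_zero hv]
    · ring
    · rcases abs_cases (((N + 1 : ℕ) : ℤ) + 1) with h | h <;> omega
    · rcases abs_cases (((N + 1 : ℕ) : ℤ) - 1) with h | h <;> omega
  rw [h3, Finset.sum_Icc_of_even_eq_range hg, Finset.sum_range_succ, hgN, hg0, sineSum]
  have : ∑ m ∈ Finset.range (N + 1), g m = ∑ j ∈ Finset.Icc 1 N, g j := by
    symm
    refine Finset.sum_subset (fun j hj => ?_) fun j hj hj' => ?_
    · simp only [Finset.mem_Icc, Finset.mem_range] at hj ⊢; omega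
    · simp only [Finset.mem_Icc, Finset.mem_range] at hj hj'
      obtain rfl : j = 0 := by omega
      exact hg0
  rw [this]
  simp [g, corrCoeff]

/-- The sum telescopes in steps of two, and autocorrelations at distance at least N vanish. -/
theorem sum_corrCoeff {N : ℕ} (hN : 1 ≤ N) {v : ℤ → ℝ} (hv : SupportedIn N v) :
    ∑ k ∈ Finset.Icc 1 N, corrCoeff N v k = autocorr N v 0 + autocorr N v 1 := by
  have : ∀ n : ℕ, ∑ k ∈ Finset.Icc 1 n, corrCoeff N v k = autocorr N v 0 + autocorr N v 1 -
      autocorr N v n - autocorr N v (n + 1) := by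
    intro n
    induction n with
    | zero => simp
    | succ n ih =>
      rw [Finset.sum_Icc_succ_top (by omega), ih, corrCoeff]
      push_cast
      rw [add_sub_cancel_right]; ring
  rw [this, autocorr_eq_zero hv (k := N) (by simp), autocorr_eq_zero hv (k := N + 1) (by
    rcases abs_cases ((N : ℤ) + 1) with h | h <;> omega)]
  ring

theorem corrCoeff_one (N : ℕ) (v : ℤ → ℝ) :
    corrCoeff N v 1 = autocorr N v 0 - autocorr N v 2 := by
  simp [corrCoeff]

theorem autocorr_smul (N : ℕ) (v : ℤ → ℝ) (c : ℝ) (k : ℤ) :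
    autocorr N (fun j => c * v j) k = c ^ 2 * autocorr N v k := by
  rw [autocorr, autocorr, Finset.mul_sum]
  exact Finset.sum_congr rfl fun j _ => by ring

theorem corrCoeff_smul (N : ℕ) (v : ℤ → ℝ) (c : ℝ) (k : ℕ) :
    corrCoeff N (fun j => c * v j) k = c ^ 2 * corrCoeff N v k := by
  rw [corrCoeff, corrCoeff, autocorr_smul, autocorr_smul]; ring

/-! ### The quadratic form and its ground state -/

/-- The data of a positive vector in the kernel of the quadratic form
`J (c₀ - c₂) - (c₀ + c₁)` of autocorrelations. -/
structure IsGroundState (N : ℕ) (J : ℝ) (z : ℤ → ℝ) : Prop where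
  J_pos : 0 < J
  supp : SupportedIn N z
  pos : ∀ j ∈ Finset.Icc (1 : ℤ) N, 0 < z j
  eigen : ∀ j ∈ Finset.Icc (1 : ℤ) N,
    z j + (z (j - 1) + z (j + 1)) / 2 = J * (z j - (z (j - 2) + z (j + 2)) / 2)

/-- Expanding the square, the terms with u_{j+d}² are reindexed by a shift, which replaces the
neighbour j + d by j - d. This is the discrete integration by parts behind `IsGroundState.form_eq`.
-/
theorem sum_mul_sub_sq {N : ℕ} {z u : ℤ → ℝ} (hz : SupportedIn N z) (d : ℤ) :
    ∑ j ∈ Finset.Icc (1 : ℤ) N, z j * z (j + d) * (u j - u (j + d)) ^ 2 =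
      ∑ j ∈ Finset.Icc (1 : ℤ) N, u j ^ 2 * z j * (z (j + d) + z (j - d)) -
        2 * autocorr N (fun j => u j * z j) d := by
  have h : ∑ j ∈ Finset.Icc (1 : ℤ) N, z j * z (j + d) * u (j + d) ^ 2 =
      ∑ j ∈ Finset.Icc (1 : ℤ) N, z j * z (j - d) * u j ^ 2 := by
    rw [← sum_shift (f := fun j => z j * z (j - d) * u j ^ 2) (s' := Finset.Icc (1 : ℤ) N) d]
    · refine Finset.sum_congr rfl fun j _ => ?_
      rw [add_sub_cancel_right]; ring
    · intro j hj; simp only [hz j hj]; ring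
    · intro j hj; rw [add_sub_cancel_right, hz j hj]; ring
  have h2 : ∑ j ∈ Finset.Icc (1 : ℤ) N, u j ^ 2 * z j * (z (j + d) + z (j - d)) =
      ∑ j ∈ Finset.Icc (1 : ℤ) N, z j * z (j + d) * u j ^ 2 +
      ∑ j ∈ Finset.Icc (1 : ℤ) N, z j * z (j + d) * u (j + d) ^ 2 := by
    rw [h, ← Finset.sum_add_distrib]
    exact Finset.sum_congr rfl fun j _ => by ring
  rw [h2, autocorr, Finset.mul_sum, ← Finset.sum_add_distrib, ← Finset.sum_sub_distrib]
  exact Finset.sum_congr rfl fun j _ => by ring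

/-- Ground state representation of the quadratic form `J (c₀ - c₂) - (c₀ + c₁)`. -/
theorem IsGroundState.form_eq {N : ℕ} {J : ℝ} {z : ℤ → ℝ} (hz : IsGroundState N J z)
    (u : ℤ → ℝ) :
    J * (autocorr N (fun j => u j * z j) 0 - autocorr N (fun j => u j * z j) 2) -
        (autocorr N (fun j => u j * z j) 0 + autocorr N (fun j => u j * z j) 1) =
      1 / 2 * ∑ j ∈ Finset.Icc (1 : ℤ) N, z j * z (j + 1) * (u j - u (j + 1)) ^ 2 +
      J / 2 * ∑ j ∈ Finset.Icc (1 : ℤ) N, z j * z (j + 2) * (u j - u (j + 2)) ^ 2 := by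
  rw [sum_mul_sub_sq hz.supp, sum_mul_sub_sq hz.supp]
  -- The eigenvalue equation, multiplied by u_j² z_j and summed, cancels the diagonal terms.
  have h0 : (J - 1) * autocorr N (fun j => u j * z j) 0 =
      1 / 2 * ∑ j ∈ Finset.Icc (1 : ℤ) N, u j ^ 2 * z j * (z (j + 1) + z (j - 1)) +
      J / 2 * ∑ j ∈ Finset.Icc (1 : ℤ) N, u j ^ 2 * z j * (z (j + 2) + z (j - 2)) := by
    rw [autocorr, Finset.mul_sum, Finset.mul_sum, Finset.mul_sum, ← Finset.sum_add_distrib]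
    refine Finset.sum_congr rfl fun j hj => ?_
    have := hz.eigen j hj
    rw [add_zero]
    linear_combination -(u j) ^ 2 * z j * this
  linear_combination h0

theorem SupportedIn.eq_div_mul {N : ℕ} {J : ℝ} {z v : ℤ → ℝ} (hz : IsGroundState N J z)
    (hv : SupportedIn N v) : v = fun j => v j / z j * z j := by
  funext j
  by_cases hj : j ∈ Finset.Icc (1 : ℤ) N
  · rw [div_mul_cancel₀ _ (hz.pos j hj).ne']
  · rw [hv j hj]; simp

theorem IsGroundState.nonneg {N : ℕ} {J : ℝ} {z : ℤ → ℝ} (hz : IsGroundState N J z) (j : ℤ) :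
    0 ≤ z j := by
  by_cases hj : j ∈ Finset.Icc (1 : ℤ) N
  · exact (hz.pos j hj).le
  · rw [hz.supp j hj]

theorem IsGroundState.form_nonneg {N : ℕ} {J : ℝ} {z v : ℤ → ℝ} (hz : IsGroundState N J z)
    (hv : SupportedIn N v) :
    autocorr N v 0 + autocorr N v 1 ≤ J * (autocorr N v 0 - autocorr N v 2) := by
  have h := hz.form_eq (fun j => v j / z j)
  simp only [← hv.eq_div_mul hz] at h
  have hJ := hz.J_pos
  have h1 : 0 ≤ ∑ j ∈ Finset.Icc (1 : ℤ) N,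
      z j * z (j + 1) * (v j / z j - v (j + 1) / z (j + 1)) ^ 2 :=
    Finset.sum_nonneg fun j _ =>
      mul_nonneg (mul_nonneg (hz.nonneg _) (hz.nonneg _)) (sq_nonneg _)
  have h2 : 0 ≤ ∑ j ∈ Finset.Icc (1 : ℤ) N,
      z j * z (j + 2) * (v j / z j - v (j + 2) / z (j + 2)) ^ 2 :=
    Finset.sum_nonneg fun j _ =>
      mul_nonneg (mul_nonneg (hz.nonneg _) (hz.nonneg _)) (sq_nonneg _)
  have h3 := mul_nonneg (half_pos hJ).le h2
  linarith

/-- When the form vanishes, the distance-one squares alone force v_j/z_j to be the same for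
neighbouring j, because z_j z_{j+1} > 0; hence the quotient is constant. -/
theorem IsGroundState.eq_smul {N : ℕ} {J : ℝ} {z v : ℤ → ℝ} (hz : IsGroundState N J z)
    (hv : SupportedIn N v)
    (heq : autocorr N v 0 + autocorr N v 1 = J * (autocorr N v 0 - autocorr N v 2)) :
    ∃ c : ℝ, v = fun j => c * z j := by
  have h := hz.form_eq (fun j => v j / z j)
  simp only [← hv.eq_div_mul hz] at h
  have hJ := hz.J_pos
  have h1 : ∀ j ∈ Finset.Icc (1 : ℤ) N,
      0 ≤ z j * z (j + 1) * (v j / z j - v (j + 1) / z (j + 1)) ^ 2 := fun j _ =>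
      mul_nonneg (mul_nonneg (hz.nonneg _) (hz.nonneg _)) (sq_nonneg _)
  have h2 : 0 ≤ ∑ j ∈ Finset.Icc (1 : ℤ) N,
      z j * z (j + 2) * (v j / z j - v (j + 2) / z (j + 2)) ^ 2 :=
    Finset.sum_nonneg fun j _ =>
      mul_nonneg (mul_nonneg (hz.nonneg _) (hz.nonneg _)) (sq_nonneg _)
  have h3 := mul_nonneg (half_pos hJ).le h2
  have h4 := Finset.sum_nonneg h1
  have h5 : ∑ j ∈ Finset.Icc (1 : ℤ) N,
      z j * z (j + 1) * (v j / z j - v (j + 1) / z (j + 1)) ^ 2 = 0 := by linarith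
  rw [Finset.sum_eq_zero_iff_of_nonneg h1] at h5
  have hstep : ∀ n : ℕ, n + 1 ≤ N → v (n + 1) / z (n + 1) = v 1 / z 1 := by
    intro n
    induction n with
    | zero => intro _; simp
    | succ n ih =>
      intro hn
      rw [← ih (by omega)]
      have hm : ((n : ℤ) + 1) ∈ Finset.Icc (1 : ℤ) N := by rw [Finset.mem_Icc]; omega
      have hm' : ((n : ℤ) + 1 + 1) ∈ Finset.Icc (1 : ℤ) N := by rw [Finset.mem_Icc]; omega
      have := h5 _ hm
      rw [mul_eq_zero] at this
      have := this.resolve_left (mul_pos (hz.pos _ hm) (hz.pos _ hm')).ne'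
      push_cast
      linarith [pow_eq_zero_iff (two_ne_zero) |>.mp this]
  refine ⟨v 1 / z 1, ?_⟩
  funext j
  by_cases hj : j ∈ Finset.Icc (1 : ℤ) N
  · have hj' := Finset.mem_Icc.mp hj
    have := hstep (j - 1).toNat (by omega)
    rw [show (((j - 1).toNat : ℕ) : ℤ) + 1 = j by omega] at this
    rw [← this, div_mul_cancel₀ _ (hz.pos j hj).ne']
  · rw [hv j hj, hz.supp j hj, mul_zero]

/-- The constant multiplier u = 1 makes every difference vanish. -/
theorem IsGroundState.form_self {N : ℕ} {J : ℝ} {z : ℤ → ℝ} (hz : IsGroundState N J z) :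
    autocorr N z 0 + autocorr N z 1 = J * (autocorr N z 0 - autocorr N z 2) := by
  have h := hz.form_eq (fun _ => 1)
  simp at h
  linarith

/-- Autocorrelations of a sequence that is symmetric about `(N + 1) / 2` and unimodal along each
parity class decrease in steps of two. -/
theorem corrCoeff_pos {N : ℕ} {z : ℤ → ℝ} (hsupp : SupportedIn N z)
    (hpos : ∀ j ∈ Finset.Icc (1 : ℤ) N, 0 < z j) (hsymm : ∀ j, z (N + 1 - j) = z j)
    (hmono : ∀ a b : ℤ, Even (b - a) → |2 * a - N - 1| ≤ |2 * b - N - 1| → z b ≤ z a)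
    {k : ℕ} (hk1 : 1 ≤ k) (hkN : k ≤ N) : 0 < corrCoeff N z k := by
  have e1 : corrCoeff N z k = ∑ i ∈ Finset.Icc (0 : ℤ) (N + 1),
      z (i - k) * (z (i - 1) - z (i + 1)) := by
    rw [← sum_shift (f := fun i => z (i - k) * (z (i - 1) - z (i + 1)))
      (s' := Finset.Icc (1 : ℤ) N) k]
    · rw [corrCoeff, autocorr, autocorr, ← Finset.sum_sub_distrib]
      refine Finset.sum_congr rfl fun j _ => ?_
      rw [add_sub_cancel_right, add_sub_assoc, add_assoc]; ring
    · intro i hi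
      simp only [Finset.mem_Icc] at hi
      have h1 : z (i - 1) = 0 := hsupp _ (by simp only [Finset.mem_Icc]; omega)
      have h2 : z (i + 1) = 0 := hsupp _ (by simp only [Finset.mem_Icc]; omega)
      simp only [h1, h2]; ring
    · intro j hj
      rw [add_sub_cancel_right, hsupp j hj, zero_mul]
  -- Reflection i ↦ N + 1 - i; averaging both expressions gives a product of two differences that
  -- are monotone in the same direction.
  have e2 : ∑ i ∈ Finset.Icc (0 : ℤ) (N + 1), z (i - k) * (z (i - 1) - z (i + 1)) =
      ∑ i ∈ Finset.Icc (0 : ℤ) (N + 1), -(z (i + k) * (z (i - 1) - z (i + 1))) := by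
    refine Finset.sum_bij' (fun i _ => N + 1 - i) (fun i _ => N + 1 - i) ?_ ?_ ?_ ?_ ?_
    · intro i hi; simp only [Finset.mem_Icc] at hi ⊢; omega
    · intro i hi; simp only [Finset.mem_Icc] at hi ⊢; omega
    · intro i _; ring
    · intro i _; ring
    · intro i _
      rw [← hsymm (i - k), ← hsymm (i - 1), ← hsymm (i + 1)]
      rw [show (N : ℤ) + 1 - (i - k) = N + 1 - i + k by ring,
        show (N : ℤ) + 1 - (i - 1) = N + 1 - i + 1 by ring,
        show (N : ℤ) + 1 - (i + 1) = N + 1 - i - 1 by ring]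
      ring
  have e3 : 2 * corrCoeff N z k = ∑ i ∈ Finset.Icc (0 : ℤ) (N + 1),
      (z (i - k) - z (i + k)) * (z (i - 1) - z (i + 1)) := by
    have : 2 * corrCoeff N z k = corrCoeff N z k + corrCoeff N z k := by ring
    rw [this]
    nth_rewrite 2 [e1]
    rw [e2, e1, ← Finset.sum_add_distrib]
    exact Finset.sum_congr rfl fun i _ => by ring
  have hterm : ∀ i ∈ Finset.Icc (0 : ℤ) (N + 1),
      0 ≤ (z (i - k) - z (i + k)) * (z (i - 1) - z (i + 1)) := by
    intro i _
    rcases le_total ((N : ℤ) + 1) (2 * i) with h | h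
    · apply mul_nonneg <;> rw [sub_nonneg] <;> apply hmono
      · exact ⟨k, by ring⟩
      · rcases abs_cases (2 * (i - k) - N - 1) with h1 | h1 <;>
        rcases abs_cases (2 * (i + k) - N - 1) with h2 | h2 <;> omega
      · exact ⟨1, by ring⟩
      · rcases abs_cases (2 * (i - 1) - N - 1) with h1 | h1 <;>
        rcases abs_cases (2 * (i + 1) - N - 1) with h2 | h2 <;> omega
    · apply mul_nonneg_of_nonpos_of_nonpos <;> rw [sub_nonpos] <;> apply hmono
      · exact ⟨-k, by ring⟩
      · rcases abs_cases (2 * (i - k) - N - 1) with h1 | h1 <;>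
        rcases abs_cases (2 * (i + k) - N - 1) with h2 | h2 <;> omega
      · exact ⟨-1, by ring⟩
      · rcases abs_cases (2 * (i - 1) - N - 1) with h1 | h1 <;>
        rcases abs_cases (2 * (i + 1) - N - 1) with h2 | h2 <;> omega
  -- The term i = N + 1 supplies strictness: it equals z_{N+1-k} z_N.
  have hlast : 0 < (z ((N + 1 : ℤ) - k) - z ((N + 1 : ℤ) + k)) *
      (z ((N + 1 : ℤ) - 1) - z ((N + 1 : ℤ) + 1)) := by
    rw [hsupp ((N + 1 : ℤ) + k) (by simp only [Finset.mem_Icc]; omega),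
      hsupp ((N + 1 : ℤ) + 1) (by simp only [Finset.mem_Icc]; omega), sub_zero, sub_zero]
    apply mul_pos <;> apply hpos <;> simp only [Finset.mem_Icc] <;> omega
  have := Finset.sum_pos' hterm ⟨(N + 1 : ℤ), by simp only [Finset.mem_Icc]; omega, hlast⟩
  linarith

/-! ### The auxiliary extremal problem -/

/-- A nonnegative sine polynomial has coefficients of the form `corrCoeff`. -/
theorem exists_corrCoeff_of_sineSum_nonneg {N : ℕ} (hN : 1 ≤ N) {a : ℕ → ℝ}
    (ha : ∀ t ∈ Set.Icc (0 : ℝ) Real.pi, 0 ≤ sineSum N a t) :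
    ∃ v w : ℤ → ℝ, SupportedIn N v ∧ SupportedIn N w ∧
      ∀ k ∈ Finset.Icc 1 N, a k = corrCoeff N v k + corrCoeff N w k := by
  obtain ⟨h, hd, hh⟩ := exists_sineSum_eq_norm_sq N hN a ha
  set v : ℤ → ℝ := fun j => if j ∈ Finset.Icc (1 : ℤ) N then (h.coeff (j - 1).toNat).re else 0
  set w : ℤ → ℝ := fun j => if j ∈ Finset.Icc (1 : ℤ) N then (h.coeff (j - 1).toNat).im else 0
  have hv : SupportedIn N v := fun j hj => if_neg hj
  have hw : SupportedIn N w := fun j hj => if_neg hj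
  refine ⟨v, w, hv, hw, ?_⟩
  have hexp : ∀ t : ℝ, Complex.exp (t * Complex.I) * h.eval (Complex.exp (t * Complex.I)) =
      ∑ j ∈ Finset.Icc (1 : ℤ) N, ((v j : ℂ) + w j * Complex.I) *
        ((Real.cos (j * t) : ℂ) + Real.sin (j * t) * Complex.I) := by
    intro t
    rw [eval_eq_sum_range' (show h.natDegree < N by omega), Finset.mul_sum]
    refine Finset.sum_bij' (fun i _ => (i : ℤ) + 1) (fun j _ => (j - 1).toNat) ?_ ?_ ?_ ?_ ?_
    · intro i hi; simp only [Finset.mem_range, Finset.mem_Icc] at hi ⊢; omega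
    · intro i hi; simp only [Finset.mem_range, Finset.mem_Icc] at hi ⊢; omega
    · intro i _; omega
    · intro j hj; simp only [Finset.mem_Icc] at hj; omega
    · intro i hi
      have hm : ((i : ℤ) + 1) ∈ Finset.Icc (1 : ℤ) N := by
        simp only [Finset.mem_range, Finset.mem_Icc] at hi ⊢; omega
      simp only [v, w, if_pos hm]
      rw [show ((i : ℤ) + 1 - 1).toNat = i by omega, Complex.re_add_im, Complex.ofReal_cos,
        Complex.ofReal_sin, ← Complex.exp_mul_I, mul_left_comm, ← pow_succ', ← Complex.exp_nat_mul]
      push_cast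
      ring_nf
  have hnorm : ∀ t : ℝ, ‖h.eval (Complex.exp (t * Complex.I))‖ ^ 2 =
      (∑ j ∈ Finset.Icc (1 : ℤ) N, v j * Real.cos (j * t) -
        ∑ j ∈ Finset.Icc (1 : ℤ) N, w j * Real.sin (j * t)) ^ 2 +
      (∑ j ∈ Finset.Icc (1 : ℤ) N, v j * Real.sin (j * t) +
        ∑ j ∈ Finset.Icc (1 : ℤ) N, w j * Real.cos (j * t)) ^ 2 := by
    intro t
    have : ‖h.eval (Complex.exp (t * Complex.I))‖ =
        ‖Complex.exp (t * Complex.I) * h.eval (Complex.exp (t * Complex.I))‖ := by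
      rw [norm_mul, Complex.norm_exp_ofReal_mul_I, one_mul]
    rw [this, hexp, ← Complex.normSq_eq_norm_sq, Complex.normSq_apply, ← sq, ← sq, Complex.re_sum,
      Complex.im_sum, ← Finset.sum_sub_distrib, ← Finset.sum_add_distrib]
    congr 2
    · refine Finset.sum_congr rfl fun j _ => ?_
      simp only [Complex.mul_re, Complex.add_re, Complex.add_im, Complex.mul_im, Complex.ofReal_re,
        Complex.ofReal_im, Complex.I_re, Complex.I_im]
      ring
    · refine Finset.sum_congr rfl fun j _ => ?_
      simp only [Complex.mul_re, Complex.add_re, Complex.add_im, Complex.mul_im, Complex.ofReal_re,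
        Complex.ofReal_im, Complex.I_re, Complex.I_im]
      ring
  -- The Fejér–Riesz factor may have complex coefficients v + iw. Since S is odd, averaging the
  -- identity over t and -t removes the cross terms between v and w.
  have havg : ∀ t : ℝ, sineSum N a t = (trigSq N v t + trigSq N w t) * Real.sin t := by
    intro t
    have h1 := hh t
    have h2 := hh (-t)
    have h3 : sineSum N a (-t) = -sineSum N a t := by
      simp [sineSum, Finset.sum_neg_distrib]
    rw [h3, Real.sin_neg, hnorm] at h2
    rw [hnorm] at h1
    simp only [mul_neg, Real.cos_neg, Real.sin_neg, Finset.sum_neg_distrib] at h2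
    rw [trigSq, trigSq]
    linear_combination (1 / 2) * h1 - (1 / 2) * h2
  refine sineSum_coeff_unique N a (fun k => corrCoeff N v k + corrCoeff N w k) fun t _ => ?_
  rw [havg, add_mul, trigSq_mul_sin hv, trigSq_mul_sin hw, sineSum, sineSum, sineSum,
    ← Finset.sum_add_distrib]
  exact Finset.sum_congr rfl fun j _ => by ring

/-- The constraint a_1 = 1 says that the two values of c_0 - c_2 add up to 1, while the objective is
the sum of the two values of c_0 + c_1. -/
theorem IsGroundState.sum_le {N : ℕ} {J : ℝ} {z : ℤ → ℝ} (hN : 1 ≤ N) (hz : IsGroundState N J z)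
    {a : ℕ → ℝ} (h1 : a 1 = 1) (ha : ∀ t ∈ Set.Icc (0 : ℝ) Real.pi, 0 ≤ sineSum N a t) :
    ∑ k ∈ Finset.Icc 1 N, a k ≤ J := by
  obtain ⟨v, w, hv, hw, h⟩ := exists_corrCoeff_of_sineSum_nonneg hN ha
  rw [Finset.sum_congr rfl h, Finset.sum_add_distrib, sum_corrCoeff hN hv, sum_corrCoeff hN hw]
  have e := h 1 (by simp [hN])
  rw [corrCoeff_one, corrCoeff_one, h1] at e
  have := hz.form_nonneg hv
  have := hz.form_nonneg hw
  have : J = J * (autocorr N v 0 - autocorr N v 2) + J * (autocorr N w 0 - autocorr N w 2) := by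
    rw [← mul_add, ← e, mul_one]
  linarith

/-- Equality must hold for both vectors, so both are multiples of z; their coefficients are then
proportional to those of z, and a_1 = 1 fixes the factor. -/
theorem IsGroundState.eq_of_sum_eq {N : ℕ} {J : ℝ} {z : ℤ → ℝ} (hN : 1 ≤ N)
    (hz : IsGroundState N J z) {a : ℕ → ℝ} (h1 : a 1 = 1)
    (ha : ∀ t ∈ Set.Icc (0 : ℝ) Real.pi, 0 ≤ sineSum N a t)
    (hsum : ∑ k ∈ Finset.Icc 1 N, a k = J) :
    ∀ k ∈ Finset.Icc 1 N, a k = corrCoeff N z k / corrCoeff N z 1 := by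
  obtain ⟨v, w, hv, hw, h⟩ := exists_corrCoeff_of_sineSum_nonneg hN ha
  rw [Finset.sum_congr rfl h, Finset.sum_add_distrib, sum_corrCoeff hN hv,
    sum_corrCoeff hN hw] at hsum
  have e := h 1 (by simp [hN])
  rw [corrCoeff_one, corrCoeff_one, h1] at e
  have i1 := hz.form_nonneg hv
  have i2 := hz.form_nonneg hw
  have i3 : J = J * (autocorr N v 0 - autocorr N v 2) +
      J * (autocorr N w 0 - autocorr N w 2) := by
    rw [← mul_add, ← e, mul_one]
  obtain ⟨c, rfl⟩ := hz.eq_smul hv (by linarith)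
  obtain ⟨d, rfl⟩ := hz.eq_smul hw (by linarith)
  have e' := h 1 (by simp [hN])
  rw [h1, corrCoeff_smul, corrCoeff_smul] at e'
  have hne : corrCoeff N z 1 ≠ 0 := by rintro h0; rw [h0] at e'; simp at e'
  intro k hk
  rw [h k hk, corrCoeff_smul, corrCoeff_smul, eq_div_iff hne]
  linear_combination -corrCoeff N z k * e'

/-! ### Explicit ground states -/

theorem mul_sin_le_sin_mul {l y : ℝ} (hl0 : 0 ≤ l) (hl1 : l ≤ 1) (hy0 : 0 ≤ y)
    (hy : y ≤ Real.pi) : l * Real.sin y ≤ Real.sin (l * y) := by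
  have h := strictConcaveOn_sin_Icc.concaveOn.2 (x := y) ⟨hy0, hy⟩ (y := 0)
    ⟨le_rfl, Real.pi_pos.le⟩ hl0 (by linarith : 0 ≤ 1 - l) (by ring)
  simpa using h

theorem sin_le_sin_of_le_of_le_pi_sub {x y : ℝ} (hx0 : 0 ≤ x) (hxy : x ≤ y)
    (hy : y ≤ Real.pi - x) : Real.sin x ≤ Real.sin y := by
  rcases le_total y (Real.pi / 2) with h | h
  · exact Real.sin_le_sin_of_le_of_le_pi_div_two (by linarith [Real.pi_pos]) h hxy
  · rw [← Real.sin_pi_sub y]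
    exact Real.sin_le_sin_of_le_of_le_pi_div_two (by linarith [Real.pi_pos]) (by linarith)
      (by linarith)

/-- The sequence `cos (m ψ) ± (a + b m)`, `m = 2 k - N - 1`, with alternating sign. -/
noncomputable def waveVec (N : ℕ) (ψ a b : ℝ) (k : ℤ) : ℝ :=
  Real.cos ((2 * k - N - 1) * ψ) + (-1) ^ (k + 1) * (a + b * (2 * k - N - 1))

/-- `waveVec` cut off outside `1, …, N`. -/
noncomputable def waveVecCut (N : ℕ) (ψ a b : ℝ) (k : ℤ) : ℝ :=
  if k ∈ Finset.Icc (1 : ℤ) N then waveVec N ψ a b k else 0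

/-- On the cosine wave the two operators act as 1 + cos 2ψ = 2 cos² ψ and 1 - cos 4ψ = 8 sin² ψ cos²
ψ, whose quotient is 1/(4 sin² ψ). Both operators annihilate an alternating affine sequence, so a
and b remain free for the boundary conditions. -/
theorem waveVec_eigen (N : ℕ) {ψ : ℝ} (a b : ℝ) (hs : Real.sin ψ ≠ 0) (k : ℤ) :
    waveVec N ψ a b k + (waveVec N ψ a b (k - 1) + waveVec N ψ a b (k + 1)) / 2 =
      1 / (4 * Real.sin ψ ^ 2) *
        (waveVec N ψ a b k - (waveVec N ψ a b (k - 2) + waveVec N ψ a b (k + 2)) / 2) := by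
  have p1 : (-1 : ℝ) ^ (k - 1 + 1) = -(-1) ^ (k + 1) := by
    rw [show k - 1 + 1 = (k + 1) + (-1) by ring, zpow_add₀ (by norm_num)]; norm_num
  have p2 : (-1 : ℝ) ^ (k + 1 + 1) = -(-1) ^ (k + 1) := by
    rw [zpow_add₀ (by norm_num) (k + 1)]; norm_num
  have p3 : (-1 : ℝ) ^ (k - 2 + 1) = (-1) ^ (k + 1) := by
    rw [show k - 2 + 1 = (k + 1) + (-2) by ring, zpow_add₀ (by norm_num)]; norm_num
  have p4 : (-1 : ℝ) ^ (k + 2 + 1) = (-1) ^ (k + 1) := by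
    rw [show k + 2 + 1 = (k + 1) + 2 by ring, zpow_add₀ (by norm_num)]; norm_num
  simp only [waveVec, p1, p2, p3, p4]
  push_cast
  set x := (2 * (k : ℝ) - N - 1) * ψ with hx
  rw [show (2 * ((k : ℝ) - 1) - N - 1) * ψ = x - 2 * ψ by rw [hx]; ring,
    show (2 * ((k : ℝ) + 1) - N - 1) * ψ = x + 2 * ψ by rw [hx]; ring,
    show (2 * ((k : ℝ) - 2) - N - 1) * ψ = x - 2 * (2 * ψ) by rw [hx]; ring,
    show (2 * ((k : ℝ) + 2) - N - 1) * ψ = x + 2 * (2 * ψ) by rw [hx]; ring]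
  rw [Real.cos_add, Real.cos_sub, Real.cos_add, Real.cos_sub, Real.cos_two_mul (2 * ψ),
    Real.cos_two_mul ψ, Real.cos_sq' ψ]
  field_simp
  ring

/-- The equation reaches two sites to either side, so cutting off is harmless exactly because the
wave already vanishes at -1, 0, N + 1 and N + 2. -/
theorem isGroundState_waveVecCut {N : ℕ} {ψ a b : ℝ} (hs : Real.sin ψ ≠ 0)
    (hpos : ∀ k ∈ Finset.Icc (1 : ℤ) N, 0 < waveVec N ψ a b k)
    (h0 : waveVec N ψ a b 0 = 0) (h0' : waveVec N ψ a b (-1) = 0)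
    (h1 : waveVec N ψ a b (N + 1) = 0) (h1' : waveVec N ψ a b (N + 2) = 0) :
    IsGroundState N (1 / (4 * Real.sin ψ ^ 2)) (waveVecCut N ψ a b) := by
  have hext : ∀ k : ℤ, -1 ≤ k → k ≤ N + 2 → waveVecCut N ψ a b k = waveVec N ψ a b k := by
    intro k hk1 hk2
    unfold waveVecCut
    split_ifs with h
    · rfl
    · rw [Finset.mem_Icc] at h
      have : k = -1 ∨ k = 0 ∨ k = N + 1 ∨ k = N + 2 := by omega
      rcases this with rfl | rfl | rfl | rfl
      exacts [h0'.symm, h0.symm, h1.symm, h1'.symm]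
  refine ⟨by positivity, fun j hj => if_neg hj, fun j hj => ?_, fun j hj => ?_⟩
  · rw [waveVecCut, if_pos hj]; exact hpos j hj
  · rw [Finset.mem_Icc] at hj
    rw [hext j (by omega) (by omega), hext (j - 1) (by omega) (by omega),
      hext (j + 1) (by omega) (by omega), hext (j - 2) (by omega) (by omega),
      hext (j + 2) (by omega) (by omega)]
    exact waveVec_eigen N a b hs j

theorem waveVec_symm {N : ℕ} {ψ a b : ℝ} (h : (Odd N ∧ b = 0) ∨ (Even N ∧ a = 0)) (k : ℤ) :
    waveVec N ψ a b (N + 1 - k) = waveVec N ψ a b k := by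
  have e : (-1 : ℝ) ^ ((N : ℤ) + 1 - k + 1) = (-1) ^ (N + 1) * (-1) ^ (k + 1) := by
    rw [show (N : ℤ) + 1 - k + 1 = ((N + 1 : ℕ) : ℤ) + (k + 1) + (-2 * k) by push_cast; ring,
      zpow_add₀ (by norm_num), zpow_add₀ (by norm_num), zpow_natCast, zpow_mul]
    norm_num
  rw [waveVec, waveVec, e]
  push_cast
  rw [show (2 * ((N : ℝ) + 1 - k) - N - 1) * ψ = -((2 * k - N - 1) * ψ) by ring, Real.cos_neg]
  rcases h with ⟨hN, rfl⟩ | ⟨hN, rfl⟩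
  · rw [hN.add_one.neg_one_pow]; ring
  · rw [hN.add_one.neg_one_pow]; ring

theorem waveVecCut_symm {N : ℕ} {ψ a b : ℝ} (h : (Odd N ∧ b = 0) ∨ (Even N ∧ a = 0)) (k : ℤ) :
    waveVecCut N ψ a b (N + 1 - k) = waveVecCut N ψ a b k := by
  unfold waveVecCut
  rw [waveVec_symm h]
  congr 1
  simp only [Finset.mem_Icc, eq_iff_iff]
  omega

theorem waveVecCut_mono {N : ℕ} {ψ a b : ℝ}
    (hpos : ∀ k ∈ Finset.Icc (1 : ℤ) N, 0 < waveVec N ψ a b k)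
    (h : ∀ i ∈ Finset.Icc (1 : ℤ) N, ∀ j ∈ Finset.Icc (1 : ℤ) N, Even (j - i) →
      |2 * i - N - 1| ≤ |2 * j - N - 1| → waveVec N ψ a b j ≤ waveVec N ψ a b i) :
    ∀ i j : ℤ, Even (j - i) → |2 * i - N - 1| ≤ |2 * j - N - 1| →
      waveVecCut N ψ a b j ≤ waveVecCut N ψ a b i := by
  intro i j he hij
  by_cases hj : j ∈ Finset.Icc (1 : ℤ) N
  · have hi : i ∈ Finset.Icc (1 : ℤ) N := by
      rw [Finset.mem_Icc] at hj ⊢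
      rcases abs_cases (2 * i - N - 1) with h1 | h1 <;>
      rcases abs_cases (2 * j - N - 1) with h2 | h2 <;> omega
    rw [waveVecCut, waveVecCut, if_pos hj, if_pos hi]
    exact h i hi j hj he hij
  · rw [waveVecCut, if_neg hj, waveVecCut]
    split_ifs with hi
    exacts [(hpos i hi).le, le_rfl]

theorem neg_one_zpow_eq_of_even_sub {i j : ℤ} (h : Even (j - i)) : (-1 : ℝ) ^ j = (-1) ^ i := by
  rw [show j = i + (j - i) by ring, zpow_add₀ (by norm_num), h.neg_one_zpow, mul_one]

theorem neg_one_zpow_cases (k : ℤ) : (-1 : ℝ) ^ k = 1 ∨ (-1 : ℝ) ^ k = -1 := by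
  rcases Int.even_or_odd k with h | h
  · exact Or.inl h.neg_one_zpow
  · exact Or.inr h.neg_one_zpow

/-- The ground state data together with symmetry and unimodality. -/
structure IsUnimodalGroundState (N : ℕ) (J : ℝ) (z : ℤ → ℝ) : Prop extends
    IsGroundState N J z where
  symm : ∀ j, z (N + 1 - j) = z j
  mono : ∀ i j : ℤ, Even (j - i) → |2 * i - N - 1| ≤ |2 * j - N - 1| → z j ≤ z i

theorem abs_le_of_mem_Icc {N : ℕ} {k : ℤ} (hk : k ∈ Finset.Icc (1 : ℤ) N) :
    |(2 * k - N - 1 : ℝ)| ≤ N - 1 := by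
  rw [Finset.mem_Icc] at hk
  have h1 : (1 : ℝ) ≤ k := by exact_mod_cast hk.1
  have h2 : (k : ℝ) ≤ N := by exact_mod_cast hk.2
  rw [abs_le]; constructor <;> linarith

/-- Since (N + 2)ψ = π/2, the cosine is sin ψ at site N + 1 and -sin ψ at N + 2, so a constant
alternating term of size sin ψ cancels both. Inside, the cosine is at least sin 3ψ > sin ψ. -/
theorem isUnimodalGroundState_odd {N : ℕ} (hN : Odd N) :
    IsUnimodalGroundState N
      (1 / (4 * Real.sin (Real.pi / (2 * ((N : ℝ) + 2))) ^ 2))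
      (waveVecCut N (Real.pi / (2 * ((N : ℝ) + 2))) (Real.sin (Real.pi / (2 * ((N : ℝ) + 2)))) 0)
      := by
  set ψ := Real.pi / (2 * ((N : ℝ) + 2)) with hψ
  have hN1 : (1 : ℝ) ≤ N := by exact_mod_cast hN.pos
  have hM : ((N : ℝ) + 2) * ψ = Real.pi / 2 := by rw [hψ]; field_simp
  have hψ0 : 0 < ψ := by have := Real.pi_pos; positivity
  have hψ3 : 3 * ψ ≤ Real.pi / 2 := by rw [← hM]; nlinarith
  have hs : 0 < Real.sin ψ := Real.sin_pos_of_pos_of_lt_pi hψ0 (by linarith [Real.pi_pos])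
  have hpos : ∀ k ∈ Finset.Icc (1 : ℤ) N, 0 < waveVec N ψ (Real.sin ψ) 0 k := by
    intro k hk
    have hm := abs_le_of_mem_Icc hk
    have h1 : Real.cos ((N - 1) * ψ) ≤ Real.cos ((2 * k - N - 1) * ψ) := by
      rw [← Real.cos_abs ((2 * k - N - 1) * ψ), abs_mul, abs_of_pos hψ0]
      exact Real.cos_le_cos_of_nonneg_of_le_pi (by positivity)
        (by nlinarith [Real.pi_pos]) (by nlinarith)
    have h2 : Real.cos ((N - 1) * ψ) = Real.sin (3 * ψ) := by
      rw [← Real.cos_pi_div_two_sub, ← hM]; ring_nf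
    have h3 : Real.sin ψ < Real.sin (3 * ψ) :=
      Real.sin_lt_sin_of_lt_of_le_pi_div_two (by linarith [Real.pi_pos]) hψ3 (by linarith)
    rw [waveVec]
    rcases neg_one_zpow_cases (k + 1) with h | h <;> rw [h] <;> linarith
  have heven : Even ((N : ℤ) + 1) := by exact_mod_cast hN.add_one
  have hz1 : waveVec N ψ (Real.sin ψ) 0 (N + 1) = 0 := by
    rw [waveVec, show ((N : ℤ) + 1 + 1) = (N + 1) + 1 by ring, zpow_add₀ (by norm_num),
      heven.neg_one_zpow]
    push_cast
    rw [show (2 * ((N : ℝ) + 1) - N - 1) * ψ = Real.pi / 2 - ψ by rw [← hM]; ring,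
      Real.cos_pi_div_two_sub]
    ring
  have hz2 : waveVec N ψ (Real.sin ψ) 0 (N + 2) = 0 := by
    rw [waveVec, show ((N : ℤ) + 2 + 1) = (N + 1) + 2 by ring, zpow_add₀ (by norm_num),
      heven.neg_one_zpow]
    push_cast
    rw [show (2 * ((N : ℝ) + 2) - N - 1) * ψ = ψ + Real.pi / 2 by rw [← hM]; ring,
      Real.cos_add_pi_div_two]
    norm_num
  have hsym : (Odd N ∧ (0 : ℝ) = 0) ∨ (Even N ∧ Real.sin ψ = 0) := Or.inl ⟨hN, rfl⟩
  have hz0 : waveVec N ψ (Real.sin ψ) 0 0 = 0 := by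
    rw [← waveVec_symm hsym, sub_zero, hz1]
  have hz0' : waveVec N ψ (Real.sin ψ) 0 (-1) = 0 := by
    rw [← waveVec_symm hsym, sub_neg_eq_add, add_assoc, one_add_one_eq_two, hz2]
  refine ⟨isGroundState_waveVecCut hs.ne' hpos hz0 hz0' hz1 hz2, waveVecCut_symm hsym,
    waveVecCut_mono hpos fun i hi j hj he hij => ?_⟩
  rw [waveVec, waveVec, neg_one_zpow_eq_of_even_sub (i := i + 1) (j := j + 1) (by simpa using he)]
  have hij' : |(2 * i - N - 1 : ℝ)| ≤ |(2 * j - N - 1 : ℝ)| := by exact_mod_cast hij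
  have hm := abs_le_of_mem_Icc hj
  have : Real.cos ((2 * j - N - 1) * ψ) ≤ Real.cos ((2 * i - N - 1) * ψ) := by
    rw [← Real.cos_abs ((2 * j - N - 1) * ψ), ← Real.cos_abs ((2 * i - N - 1) * ψ), abs_mul,
      abs_mul, abs_of_pos hψ0]
    exact Real.cos_le_cos_of_nonneg_of_le_pi (by positivity) (by nlinarith [Real.pi_pos])
      (by nlinarith)
  linarith

/-- The function whose zeros `ψ` correspond to the zeros `sin ψ` of `U'_{N+1}` for even `N`. -/
noncomputable def critFun (N : ℕ) (ψ : ℝ) : ℝ :=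
  ((N : ℝ) + 2) * Real.cos (((N : ℝ) + 2) * ψ) * Real.cos ψ +
    Real.sin (((N : ℝ) + 2) * ψ) * Real.sin ψ

/-- In the product formula for the difference one sine is at least sin ψ and the other is bounded
below by concavity on [0, Mψ]. The bound is the change of the alternating linear term between two
points on the same side of the centre; `cos_sub_cos_ge_of_opp` exchanges the two factors and serves
opposite sides. -/
theorem cos_sub_cos_ge_of_same {M ψ p r : ℝ} (hM0 : 0 < M) (hψ0 : 0 < ψ)
    (hM : (M + 1) * ψ ≤ Real.pi) (hp : 0 ≤ p) (hpr : p + 2 ≤ r) (hr : r ≤ M) :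
    (r - p) * (Real.sin (M * ψ) * Real.sin ψ / M) ≤ Real.cos (p * ψ) - Real.cos (r * ψ) := by
  rw [Real.cos_sub_cos]
  rw [show (p * ψ + r * ψ) / 2 = (p + r) / 2 * ψ by ring,
    show (p * ψ - r * ψ) / 2 = -((r - p) / 2 * ψ) by ring, Real.sin_neg]
  have h1 : Real.sin ψ ≤ Real.sin ((p + r) / 2 * ψ) :=
    sin_le_sin_of_le_of_le_pi_sub hψ0.le (by nlinarith) (by nlinarith)
  have h2 := mul_sin_le_sin_mul (l := (r - p) / 2 / M) (y := M * ψ)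
    (div_nonneg (by linarith) hM0.le) (by rw [div_le_one hM0]; linarith) (by positivity)
    (by nlinarith)
  rw [show (r - p) / 2 / M * (M * ψ) = (r - p) / 2 * ψ by field_simp] at h2
  have hs : 0 ≤ Real.sin ψ := Real.sin_nonneg_of_nonneg_of_le_pi hψ0.le (by nlinarith)
  have hs2 : 0 ≤ (r - p) / 2 / M * Real.sin (M * ψ) :=
    mul_nonneg (div_nonneg (by linarith) hM0.le)
      (Real.sin_nonneg_of_nonneg_of_le_pi (by positivity) (by nlinarith))
  have h3 := mul_le_mul h1 h2 hs2 (hs.trans h1)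
  have e : (r - p) * (Real.sin (M * ψ) * Real.sin ψ / M) =
    2 * (Real.sin ψ * ((r - p) / 2 / M * Real.sin (M * ψ))) := by ring
  rw [e]; linarith

theorem cos_sub_cos_ge_of_opp {M ψ p r : ℝ} (hM0 : 0 < M) (hψ0 : 0 < ψ)
    (hM : (M + 1) * ψ ≤ Real.pi) (hp : 0 ≤ p) (hpr : p + 2 ≤ r) (hr : r ≤ M) :
    (r + p) * (Real.sin (M * ψ) * Real.sin ψ / M) ≤ Real.cos (p * ψ) - Real.cos (r * ψ) := by
  rw [Real.cos_sub_cos]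
  rw [show (p * ψ + r * ψ) / 2 = (p + r) / 2 * ψ by ring,
    show (p * ψ - r * ψ) / 2 = -((r - p) / 2 * ψ) by ring, Real.sin_neg]
  have h1 : Real.sin ψ ≤ Real.sin ((r - p) / 2 * ψ) :=
    sin_le_sin_of_le_of_le_pi_sub hψ0.le (by nlinarith) (by nlinarith)
  have h2 := mul_sin_le_sin_mul (l := (p + r) / 2 / M) (y := M * ψ)
    (div_nonneg (by linarith) hM0.le) (by rw [div_le_one hM0]; linarith) (by positivity)
    (by nlinarith)
  rw [show (p + r) / 2 / M * (M * ψ) = (p + r) / 2 * ψ by field_simp] at h2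
  have hs : 0 ≤ Real.sin ψ := Real.sin_nonneg_of_nonneg_of_le_pi hψ0.le (by nlinarith)
  have hs2 : 0 ≤ (p + r) / 2 / M * Real.sin (M * ψ) :=
    mul_nonneg (div_nonneg (by linarith) hM0.le)
      (Real.sin_nonneg_of_nonneg_of_le_pi (by positivity) (by nlinarith))
  have h3 := mul_le_mul h1 h2 hs2 (hs.trans h1)
  have e : (r + p) * (Real.sin (M * ψ) * Real.sin ψ / M) =
    2 * (Real.sin ψ * ((p + r) / 2 / M * Real.sin (M * ψ))) := by ring
  rw [e]; linarith

/-- `critFun N ψ = 0` is the compatibility condition for one slope ε to match both cos((N+1)ψ) =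
ε(N+1) and cos((N+3)ψ) = -ε(N+3). The bound 3π/4 keeps sin((N+2)ψ) positive and gives (N+3)ψ ≤ π, as
the monotonicity estimates need. -/
theorem isUnimodalGroundState_even {N : ℕ} (hN : Even N) (hN2 : 2 ≤ N) {ψ : ℝ} (hψ0 : 0 < ψ)
    (hψ1 : ((N : ℝ) + 2) * ψ ≤ 3 * Real.pi / 4) (hcrit : critFun N ψ = 0) :
    IsUnimodalGroundState N (1 / (4 * Real.sin ψ ^ 2)) (waveVecCut N ψ 0
      (-(Real.sin (((N : ℝ) + 2) * ψ) * Real.sin ψ / ((N : ℝ) + 2)))) := by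
  have hpi := Real.pi_pos
  have hN2' : (2 : ℝ) ≤ N := by exact_mod_cast hN2
  set M : ℝ := (N : ℝ) + 2 with hM
  have hM0 : 0 < M := by positivity
  have hMψ : 0 < M * ψ := by positivity
  have hM1 : (M + 1) * ψ ≤ Real.pi := by nlinarith
  have hs : 0 < Real.sin ψ := Real.sin_pos_of_pos_of_lt_pi hψ0 (by nlinarith)
  have hsM : 0 < Real.sin (M * ψ) := Real.sin_pos_of_pos_of_lt_pi hMψ (by linarith)
  set ε := Real.sin (M * ψ) * Real.sin ψ / M with hε
  have hε0 : 0 < ε := by positivity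
  have hεM : ε * M = Real.sin (M * ψ) * Real.sin ψ := by rw [hε]; field_simp
  have hcos : Real.cos (M * ψ) * Real.cos ψ = -ε := by
    have h : M * Real.cos (M * ψ) * Real.cos ψ + Real.sin (M * ψ) * Real.sin ψ = 0 := hcrit
    have : M * (Real.cos (M * ψ) * Real.cos ψ + ε) = 0 := by linear_combination h + hεM
    linarith [(mul_eq_zero.mp this).resolve_left hM0.ne']
  have hc1 : Real.cos ((N + 1) * ψ) = ε * (N + 1) := by
    rw [show ((N : ℝ) + 1) * ψ = M * ψ - ψ by rw [hM]; ring, Real.cos_sub, hcos, ← hεM, hM]; ring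
  have hc2 : Real.cos ((N + 3) * ψ) = -(ε * (N + 3)) := by
    rw [show ((N : ℝ) + 3) * ψ = M * ψ + ψ by rw [hM]; ring, Real.cos_add, hcos, ← hεM, hM]; ring
  have hpos : ∀ k ∈ Finset.Icc (1 : ℤ) N, 0 < waveVec N ψ 0 (-ε) k := by
    intro k hk
    have hm := abs_le_of_mem_Icc hk
    have h1 : Real.cos ((N + 1) * ψ) ≤ Real.cos ((2 * k - N - 1) * ψ) := by
      rw [← Real.cos_abs ((2 * k - N - 1) * ψ), abs_mul, abs_of_pos hψ0]
      exact Real.cos_le_cos_of_nonneg_of_le_pi (by positivity) (by nlinarith) (by nlinarith)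
    rw [hc1] at h1
    obtain ⟨h2, h3⟩ := abs_le.mp hm
    rw [waveVec]
    rcases neg_one_zpow_cases (k + 1) with h | h <;> rw [h] <;> nlinarith
  have hz1 : waveVec N ψ 0 (-ε) (N + 1) = 0 := by
    have he : Even ((N : ℤ) + 1 + 1) := by
      rw [add_assoc]; exact Even.add (by exact_mod_cast hN) (by decide)
    rw [waveVec, he.neg_one_zpow]
    push_cast
    rw [show (2 * ((N : ℝ) + 1) - N - 1) * ψ = (N + 1) * ψ by ring, hc1]
    ring
  have hz2 : waveVec N ψ 0 (-ε) (N + 2) = 0 := by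
    have he : Odd ((N : ℤ) + 2 + 1) := by
      rw [add_assoc]; exact Even.add_odd (by exact_mod_cast hN) (by decide)
    rw [waveVec, he.neg_one_zpow]
    push_cast
    rw [show (2 * ((N : ℝ) + 2) - N - 1) * ψ = (N + 3) * ψ by ring, hc2]
    ring
  have hsym : (Odd N ∧ -ε = 0) ∨ (Even N ∧ (0 : ℝ) = 0) := Or.inr ⟨hN, rfl⟩
  have hz0 : waveVec N ψ 0 (-ε) 0 = 0 := by
    rw [← waveVec_symm hsym, sub_zero, hz1]
  have hz0' : waveVec N ψ 0 (-ε) (-1) = 0 := by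
    rw [← waveVec_symm hsym, sub_neg_eq_add, add_assoc, one_add_one_eq_two, hz2]
  refine ⟨isGroundState_waveVecCut hs.ne' hpos hz0 hz0' hz1 hz2, waveVecCut_symm hsym,
    waveVecCut_mono hpos fun i hi j hj he hij => ?_⟩
  rw [waveVec, waveVec, neg_one_zpow_eq_of_even_sub (i := i + 1) (j := j + 1) (by simpa using he)]
  set m : ℤ := 2 * i - N - 1 with hm
  set n : ℤ := 2 * j - N - 1 with hn
  have em : (2 * i - N - 1 : ℝ) = m := by rw [hm]; push_cast; ring
  have en : (2 * j - N - 1 : ℝ) = n := by rw [hn]; push_cast; ring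
  have hnb := abs_le_of_mem_Icc hj
  rw [en] at hnb
  rw [em, en]
  obtain ⟨e, he⟩ := he
  obtain ⟨N', hN'⟩ := hN
  by_cases hmn : m = n
  · rw [hmn]
  -- Both m and n are odd and their difference is divisible by 4, so |m| = |n| would force m = n.
  have hpr : |m| + 2 ≤ |n| := by
    rcases abs_cases m with h1 | h1 <;> rcases abs_cases n with h2 | h2 <;> omega
  have hpr' : |(m : ℝ)| + 2 ≤ |(n : ℝ)| := by exact_mod_cast hpr
  have hsame := cos_sub_cos_ge_of_same hM0 hψ0 hM1 (abs_nonneg (m : ℝ)) hpr'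
    (hnb.trans (by rw [hM]; linarith))
  have hopp := cos_sub_cos_ge_of_opp hM0 hψ0 hM1 (abs_nonneg (m : ℝ)) hpr'
    (hnb.trans (by rw [hM]; linarith))
  rw [← hε] at hsame hopp
  have c1 : Real.cos (|(m : ℝ)| * ψ) = Real.cos (m * ψ) := by
    rw [← Real.cos_abs (m * ψ), abs_mul, abs_of_pos hψ0]
  have c2 : Real.cos (|(n : ℝ)| * ψ) = Real.cos (n * ψ) := by
    rw [← Real.cos_abs (n * ψ), abs_mul, abs_of_pos hψ0]
  rw [c1, c2] at hsame hopp
  have q1 : 0 ≤ ε * (|(n : ℝ)| - |(m : ℝ)|) := mul_nonneg hε0.le (by linarith)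
  have q2 : 0 ≤ ε * |(m : ℝ)| := mul_nonneg hε0.le (abs_nonneg _)
  rcases abs_cases (m : ℝ) with ⟨h1, -⟩ | ⟨h1, -⟩ <;>
  rcases abs_cases (n : ℝ) with ⟨h2, -⟩ | ⟨h2, -⟩ <;>
  rw [h1, h2] at hsame hopp q1 <;> rw [h1] at q2 <;>
  rcases neg_one_zpow_cases (i + 1) with h | h <;> rw [h] <;> linarith

/-! ### The vectors in Chebyshev form -/

theorem sum_mul_shift_eq_autocorr {N : ℕ} {y : ℕ → ℝ} {g : ℤ → ℝ} {c : ℝ}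
    (hg : SupportedIn N g) (h : ∀ j : ℕ, 1 ≤ j → j ≤ N → y j = c * g j) (d : ℕ) :
    ∑ j ∈ Finset.Icc 1 (N - d), y j * y (j + d) = c ^ 2 * autocorr N g d := by
  have e : autocorr N g d = ∑ j ∈ Finset.Icc 1 N, g j * g (j + d) := by
    symm
    refine Finset.sum_bij' (fun j _ => (j : ℤ)) (fun j _ => j.toNat) ?_ ?_ ?_ ?_ ?_
    · intro j hj; simp only [Finset.mem_Icc] at hj ⊢; omega
    · intro j hj; simp only [Finset.mem_Icc] at hj ⊢; omega
    · intro j _; simp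
    · intro j hj; simp only [Finset.mem_Icc] at hj; omega
    · intro j _; rfl
  have e2 : ∑ j ∈ Finset.Icc 1 N, g j * g (j + d) =
      ∑ j ∈ Finset.Icc 1 (N - d), g j * g (j + d) := by
    symm
    refine Finset.sum_subset (fun j hj => ?_) fun j hj hj' => ?_
    · simp only [Finset.mem_Icc] at hj ⊢; omega
    · simp only [Finset.mem_Icc] at hj hj'
      rw [hg (j + d), mul_zero]
      simp only [Finset.mem_Icc]; omega
  rw [e, e2, Finset.mul_sum]
  refine Finset.sum_congr rfl fun j hj => ?_
  rw [Finset.mem_Icc] at hj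
  rw [h j hj.1 (by omega), h (j + d) (by omega) (by omega)]
  push_cast
  ring

/-- The coefficients are homogeneous of degree zero in the vector, so proportionality to the ground
state is all that the Chebyshev formulas need. -/
theorem coeffOfVec_eq {N : ℕ} {y : ℕ → ℝ} {g : ℤ → ℝ} {c : ℝ} (hc : c ≠ 0)
    (hg : SupportedIn N g) (h : ∀ j : ℕ, 1 ≤ j → j ≤ N → y j = c * g j) {k : ℕ} (hk : 1 ≤ k) :
    coeffOfVec N y k = corrCoeff N g k / corrCoeff N g 1 := by
  have s1 := sum_mul_shift_eq_autocorr hg h (k - 1)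
  have s2 := sum_mul_shift_eq_autocorr hg h (k + 1)
  have s3 := sum_mul_shift_eq_autocorr hg h 0
  have s4 := sum_mul_shift_eq_autocorr hg h 2
  rw [coeffOfVec, corrCoeff_one, corrCoeff]
  have e1 : ∀ j, j + k - 1 = j + (k - 1) := fun j => by omega
  simp only [e1]
  rw [show N + 1 - k = N - (k - 1) by omega, show N - k - 1 = N - (k + 1) by omega, s1]
  simp only [add_assoc]
  rw [s2, s4]
  simp only [add_zero, Nat.sub_zero] at s3
  rw [s3, ← mul_sub, ← mul_sub, mul_div_mul_left _ _ (pow_ne_zero 2 hc)]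
  push_cast [Nat.cast_sub hk]
  rfl

theorem chebU_mul_sin (n : ℤ) (φ : ℝ) :
    chebU n (Real.cos φ) * Real.sin φ = Real.sin ((n + 1) * φ) := Chebyshev.U_real_cos φ n

theorem chebU_mul_chebU (n : ℤ) (φ : ℝ) :
    chebU (n - 1) (Real.cos φ) * chebU n (Real.cos φ) * Real.sin φ ^ 2 =
      (Real.cos φ - Real.cos ((2 * n + 1) * φ)) / 2 := by
  have h1 := chebU_mul_sin (n - 1) φ
  have h2 := chebU_mul_sin n φ
  rw [show ((n - 1 : ℤ) : ℝ) + 1 = n by push_cast; ring] at h1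
  have h3 : Real.sin (n * φ) * Real.sin ((n + 1) * φ) =
      (Real.cos φ - Real.cos ((2 * n + 1) * φ)) / 2 := by
    have a1 : Real.cos φ = Real.cos ((n + 1) * φ - n * φ) := by ring_nf
    have a2 : Real.cos ((2 * n + 1) * φ) = Real.cos ((n + 1) * φ + n * φ) := by ring_nf
    rw [a1, a2, Real.cos_sub, Real.cos_add]; ring
  rw [← h3, ← h1, ← h2]; ring

theorem cos_odd_mul_pi_div_two_sub (k : ℤ) (ψ : ℝ) :
    Real.cos ((2 * k + 1) * (Real.pi / 2 - ψ)) = (-1) ^ k * Real.sin ((2 * k + 1) * ψ) := by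
  rw [show (2 * (k : ℝ) + 1) * (Real.pi / 2 - ψ) =
    (Real.pi / 2 - (2 * k + 1) * ψ) + k * Real.pi by ring, Real.cos_add_int_mul_pi,
    Real.cos_pi_div_two_sub]

theorem sin_odd_mul_pi_div_two_sub (k : ℤ) (ψ : ℝ) :
    Real.sin ((2 * k + 1) * (Real.pi / 2 - ψ)) = (-1) ^ k * Real.cos ((2 * k + 1) * ψ) := by
  rw [show (2 * (k : ℝ) + 1) * (Real.pi / 2 - ψ) =
    (Real.pi / 2 - (2 * k + 1) * ψ) + k * Real.pi by ring, Real.sin_add_int_mul_pi,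
    Real.sin_pi_div_two_sub]

theorem vecOdd_eq {N : ℕ} {ψ : ℝ} (hM : ((N : ℝ) + 2) * ψ = Real.pi / 2) (hc : Real.cos ψ ≠ 0)
    (k : ℕ) :
    vecOdd (Real.sin ψ) k = 1 / (2 * Real.cos ψ ^ 2) * waveVec N ψ (Real.sin ψ) 0 k := by
  have h := chebU_mul_chebU k (Real.pi / 2 - ψ)
  have h2 := cos_odd_mul_pi_div_two_sub k ψ
  push_cast at h2 h
  rw [h2, Real.cos_pi_div_two_sub, Real.sin_pi_div_two_sub] at h
  have h3 : Real.cos ((2 * (k : ℝ) - N - 1) * ψ) = Real.sin ((2 * k + 1) * ψ) := by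
    rw [← Real.cos_pi_div_two_sub, ← Real.cos_neg, ← hM]; ring_nf
  have hsq : ((-1 : ℝ) ^ k) ^ 2 = 1 := by rw [← pow_mul, mul_comm, pow_mul]; norm_num
  have hz : ((-1 : ℝ) ^ ((k : ℤ) + 1)) = (-1) ^ k * (-1) := by
    rw [zpow_add₀ (by norm_num), zpow_natCast, zpow_one]
  rw [vecOdd, waveVec, hz]
  push_cast
  rw [h3, pow_succ]
  rw [zpow_natCast] at h
  generalize Real.sin ((2 * (k : ℝ) + 1) * ψ) = s at h ⊢
  field_simp
  linear_combination (-2 * (-1) ^ k) * h + s * hsq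

/-- With φ = π/2 - ψ, subtracting the two reflected products removes the constant cos φ and leaves
sin((N+2)φ) sin((2k-N-1)φ), which is the cosine wave in ψ. The third product carries the same factor
sin((N+2)φ) and supplies the linear term. -/
theorem vecEven_eq {N n : ℕ} (hn : N = 2 * n) {ψ ε : ℝ} (hc : Real.cos ψ ≠ 0)
    (hε : Real.cos ((N + 1) * ψ) = ε * (N + 1)) (k : ℕ) :
    vecEven N (Real.sin ψ) k = (-1) ^ n * Real.sin (((N : ℝ) + 2) * (Real.pi / 2 - ψ)) /
      Real.cos ψ ^ 2 * waveVec N ψ 0 (-ε) k := by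
  set φ := Real.pi / 2 - ψ with hφ
  have hcφ : Real.cos φ = Real.sin ψ := Real.cos_pi_div_two_sub ψ
  have hsφ : Real.sin φ = Real.cos ψ := Real.sin_pi_div_two_sub ψ
  have h1 := chebU_mul_chebU k φ
  have h2 := chebU_mul_chebU (N - k + 1) φ
  have h3 : chebU N (Real.cos φ) * chebU (N + 1) (Real.cos φ) * Real.sin φ ^ 2 =
      Real.sin ((N + 1) * φ) * Real.sin ((N + 2) * φ) := by
    have a1 := chebU_mul_sin N φ
    have a2 := chebU_mul_sin (N + 1) φ
    push_cast at a1 a2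
    rw [show ((N : ℝ) + 1 + 1) = N + 2 by ring] at a2
    rw [← a1, ← a2]; ring
  rw [show (N : ℤ) - k + 1 - 1 = N - k by ring] at h2
  push_cast at h1 h2
  rw [hcφ, hsφ] at h1 h2 h3
  have h4 : Real.cos ((2 * ((N : ℝ) - k + 1) + 1) * φ) - Real.cos ((2 * (k : ℝ) + 1) * φ) =
      2 * Real.sin ((N + 2) * φ) * Real.sin ((2 * k - N - 1) * φ) := by
    have a1 : Real.cos ((2 * ((N : ℝ) - k + 1) + 1) * φ) =
      Real.cos ((N + 2) * φ - (2 * k - N - 1) * φ) := by ring_nf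
    have a2 : Real.cos ((2 * (k : ℝ) + 1) * φ) =
      Real.cos ((N + 2) * φ + (2 * k - N - 1) * φ) := by ring_nf
    rw [a1, a2, Real.cos_sub, Real.cos_add]; ring
  have h5 : Real.sin ((2 * k - N - 1) * φ) = (-1) ^ k * (-1) ^ n * (-1) *
      Real.cos ((2 * k - N - 1) * ψ) := by
    have := sin_odd_mul_pi_div_two_sub (k - n - 1) ψ
    push_cast at this
    have e : (2 * ((k : ℝ) - n - 1) + 1) = 2 * k - N - 1 := by rw [hn]; push_cast; ring
    rw [e, ← hφ] at this
    rw [this, zpow_sub₀ (by norm_num), zpow_sub₀ (by norm_num), zpow_natCast, zpow_natCast]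
    congr 1
    rcases neg_one_pow_eq_or ℝ n with h | h <;> rw [h, zpow_one] <;> ring
  have h6 : Real.sin ((N + 1) * φ) = (-1) ^ n * (ε * (N + 1)) := by
    have := sin_odd_mul_pi_div_two_sub n ψ
    push_cast at this
    have e : (2 * (n : ℝ) + 1) = N + 1 := by rw [hn]; push_cast; ring
    rw [e, ← hφ, hε, zpow_natCast] at this
    exact this
  rw [h6] at h3
  rw [h5] at h4
  have hz : ((-1 : ℝ) ^ ((k : ℤ) + 1)) = (-1) ^ k * (-1) := by
    rw [zpow_add₀ (by norm_num), zpow_natCast, zpow_one]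
  rw [vecEven, waveVec, hz, pow_succ]
  push_cast
  have hN1 : ((N : ℝ) + 1) ≠ 0 := by positivity
  have hsq : ((-1 : ℝ) ^ k) ^ 2 = 1 := by rw [← pow_mul, mul_comm, pow_mul]; norm_num
  rw [eq_comm, div_mul_eq_mul_div, div_eq_iff (pow_ne_zero 2 hc), eq_comm]
  have key : (chebU (↑k - 1) (Real.sin ψ) * chebU ↑k (Real.sin ψ) -
      chebU (↑N - ↑k) (Real.sin ψ) * chebU (↑N - ↑k + 1) (Real.sin ψ) +
      ((N : ℝ) + 1 - 2 * k) / (N + 1) * (chebU ↑N (Real.sin ψ) * chebU (↑N + 1) (Real.sin ψ))) *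
      Real.cos ψ ^ 2 = Real.sin ((N + 2) * φ) * ((-1) ^ n * ((-1) ^ k * (-1) *
        Real.cos ((2 * k - N - 1) * ψ) + (N + 1 - 2 * k) * ε)) := by
    have e3 : ((N : ℝ) + 1 - 2 * k) / (N + 1) *
        (chebU ↑N (Real.sin ψ) * chebU (↑N + 1) (Real.sin ψ)) * Real.cos ψ ^ 2 =
        (N + 1 - 2 * k) * ((-1) ^ n * ε * Real.sin ((N + 2) * φ)) := by
      rw [mul_assoc, h3]; field_simp
    linear_combination h1 - h2 + e3 + h4 / 2
  linear_combination ((-1) ^ k * (-1)) * key + (-1) ^ n * Real.sin ((N + 2) * φ) *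
    Real.cos ((2 * k - N - 1) * ψ) * hsq

/-! ### The least positive root for even degree -/

/-- The relation (n+1)T_{n+1} = xU_n - (1 - x²)U_n' at x = cos(π/2 - ψ), n = N + 1, turns the root
condition into the boundary condition of the wave. -/
theorem derivU_eval_sin {N n : ℕ} (hn : N = 2 * n) (ψ : ℝ) :
    Real.cos ψ ^ 3 * (derivative (Chebyshev.U ℝ ((N : ℤ) + 1))).eval (Real.sin ψ) =
      (-1) ^ n * critFun N ψ := by
  have h := congrArg (eval (Real.sin ψ)) (Chebyshev.add_one_mul_T_eq_poly_in_U (R := ℝ) (N + 1))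
  simp only [eval_mul, eval_add, eval_sub, eval_X, eval_pow, eval_one] at h
  have hint : eval (Real.sin ψ) (((N + 1 : ℤ) : ℝ[X])) = N + 1 := by
    push_cast; simp
  rw [hint] at h
  have hT : eval (Real.sin ψ) (Chebyshev.T ℝ ((N : ℤ) + 1 + 1)) =
      -(-1) ^ n * Real.cos ((N + 2) * ψ) := by
    rw [← Real.cos_pi_div_two_sub, Chebyshev.T_real_cos]
    have e : ((((N : ℤ) + 1 + 1 : ℤ)) : ℝ) * (Real.pi / 2 - ψ) =
        -((N + 2) * ψ) + (n + 1 : ℕ) * Real.pi := by rw [hn]; push_cast; ring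
    rw [e, Real.cos_add_nat_mul_pi, Real.cos_neg, pow_succ]; ring
  have hU : eval (Real.sin ψ) (Chebyshev.U ℝ ((N : ℤ) + 1)) * Real.cos ψ =
      (-1) ^ n * Real.sin ((N + 2) * ψ) := by
    have hu := Chebyshev.U_real_cos (Real.pi / 2 - ψ) (N + 1)
    rw [Real.cos_pi_div_two_sub, Real.sin_pi_div_two_sub] at hu
    rw [hu]
    have e : ((((N : ℤ) + 1 : ℤ)) + 1 : ℝ) * (Real.pi / 2 - ψ) =
        -((N + 2) * ψ) + (n + 1 : ℕ) * Real.pi := by rw [hn]; push_cast; ring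
    rw [e, Real.sin_add_nat_mul_pi, Real.sin_neg, pow_succ]; ring
  rw [hT] at h
  have hsc := Real.sin_sq_add_cos_sq ψ
  rw [critFun]
  have h1 : 1 - Real.sin ψ ^ 2 = Real.cos ψ ^ 2 := by linarith
  rw [h1] at h
  linear_combination Real.cos ψ * h + Real.sin ψ * hU

/-- `critFun` is N + 2 > 0 at 0, so a nonpositive value gives a zero in between; `U'_{N+1}` is a
nonzero polynomial, so among its finitely many positive roots there is a least one. -/
theorem exists_isLeastPosRootDerivU {N : ℕ} (hN : Even N) (hN2 : 2 ≤ N) {ψ₁ : ℝ} (h0 : 0 < ψ₁)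
    (h1 : ψ₁ < Real.pi / 2) (hcrit : critFun N ψ₁ ≤ 0) :
    ∃ ν, IsLeastPosRootDerivU N ν ∧ ν ≤ Real.sin ψ₁ := by
  obtain ⟨n, hn⟩ := hN
  have hn' : N = 2 * n := by omega
  have hcont : Continuous (critFun N) := by unfold critFun; fun_prop
  have hz : critFun N 0 = N + 2 := by simp [critFun]
  obtain ⟨ψ, ⟨hψ0, hψ1⟩, hψ⟩ := intermediate_value_Icc' h0.le hcont.continuousOn
    ⟨hcrit, by rw [hz]; positivity⟩
  have hψpos : 0 < ψ := by
    rcases eq_or_lt_of_le hψ0 with h | h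
    · rw [← h, hz] at hψ
      have : (0 : ℝ) < N + 2 := by positivity
      linarith
    · exact h
  set p := derivative (Chebyshev.U ℝ ((N : ℤ) + 1)) with hp
  have hcos : 0 < Real.cos ψ :=
    Real.cos_pos_of_mem_Ioo ⟨by linarith [Real.pi_pos], by linarith⟩
  have hroot : p.eval (Real.sin ψ) = 0 := by
    have := derivU_eval_sin hn' ψ
    rw [hψ, mul_zero] at this
    exact (mul_eq_zero.mp this).resolve_left (pow_ne_zero _ hcos.ne')
  have hp0 : p ≠ 0 := by
    intro h
    have h' := derivative_eq_zero.mp h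
    rw [show ((N : ℤ) + 1) = ((N + 1 : ℕ) : ℤ) by push_cast; ring,
      Chebyshev.natDegree_U_natCast] at h'
    omega
  have hfin : {x : ℝ | 0 < x ∧ p.eval x = 0}.Finite := by
    refine (p.roots.toFinset.finite_toSet).subset fun x hx => ?_
    simp only [Finset.mem_coe, Multiset.mem_toFinset, mem_roots hp0]
    exact hx.2
  have hmem : Real.sin ψ ∈ {x : ℝ | 0 < x ∧ p.eval x = 0} :=
    ⟨Real.sin_pos_of_pos_of_lt_pi hψpos (by linarith [Real.pi_pos]), hroot⟩
  obtain ⟨ν, hν, hmin⟩ := Set.exists_min_image _ id hfin ⟨_, hmem⟩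
  refine ⟨ν, ⟨hν, fun x hx => hmin x hx⟩, (hmin _ hmem).trans ?_⟩
  exact Real.sin_le_sin_of_le_of_le_pi_div_two (by linarith) h1.le hψ1

/-- The angle `ψ` with `sin ψ = ν`. -/
theorem IsLeastPosRootDerivU.exists_angle {N : ℕ} (hN : Even N) {ν : ℝ}
    (hν : IsLeastPosRootDerivU N ν) {ψ₁ : ℝ} (h0 : 0 < ψ₁) (h1 : ψ₁ < Real.pi / 2)
    (hle : ν ≤ Real.sin ψ₁) :
    ∃ ψ, 0 < ψ ∧ ψ ≤ ψ₁ ∧ Real.sin ψ = ν ∧ critFun N ψ = 0 := by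
  obtain ⟨n, hn⟩ := hN
  have hn' : N = 2 * n := by omega
  have hν0 : 0 < ν := hν.1.1
  have hs : Real.sin (Real.arcsin ν) = ν :=
    Real.sin_arcsin (by linarith) (hle.trans (Real.sin_le_one _))
  refine ⟨Real.arcsin ν, Real.arcsin_pos.mpr hν0, ?_, hs, ?_⟩
  · rw [← Real.arcsin_sin (by linarith : -(Real.pi / 2) ≤ ψ₁) h1.le]
    exact Real.arcsin_le_arcsin hle
  · have := derivU_eval_sin hn' (Real.arcsin ν)
    rw [hs, hν.1.2, mul_zero] at this
    exact (mul_eq_zero.mp this.symm).resolve_left (pow_ne_zero _ (by norm_num))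

theorem critFun_nonpos_three_quarters {N : ℕ} (hN2 : 2 ≤ N) :
    critFun N (3 * Real.pi / 4 / ((N : ℝ) + 2)) ≤ 0 := by
  have hN2' : (2 : ℝ) ≤ N := by exact_mod_cast hN2
  have hpi := Real.pi_pos
  set ψ := 3 * Real.pi / 4 / ((N : ℝ) + 2) with hψ
  have hψ0 : 0 < ψ := by positivity
  have hM : ((N : ℝ) + 2) * ψ = Real.pi - Real.pi / 4 := by rw [hψ]; field_simp; ring
  have hψ1 : ψ ≤ Real.pi / 4 := by nlinarith
  rw [critFun, hM, Real.cos_pi_sub, Real.sin_pi_sub, Real.cos_pi_div_four, Real.sin_pi_div_four]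
  have h1 : Real.sin ψ ≤ Real.cos ψ := by
    rw [← Real.cos_pi_div_two_sub]
    exact Real.cos_le_cos_of_nonneg_of_le_pi hψ0.le (by linarith) (by linarith)
  have h2 : 0 ≤ Real.sin ψ := Real.sin_nonneg_of_nonneg_of_le_pi hψ0.le (by linarith)
  have h3 : 0 < Real.sqrt 2 := by positivity
  nlinarith [mul_nonneg h3.le (sub_nonneg.mpr h1), mul_nonneg h3.le (h2.trans h1)]

/-- With (N+2)ψ = π/2 + x the function is -(N+2) sin x cos ψ + cos x sin ψ, and the estimates use
only N + 2 ≥ 6. The factor 1.0298 lies just below (9/8)^{1/4}, the loss allowed by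
`confinesMaximum_even`; the margin is narrow. -/
theorem critFun_nonpos_near {N : ℕ} (hN : 4 ≤ N) :
    critFun N (1.0298 * (Real.pi / 2) / ((N : ℝ) + 2)) ≤ 0 := by
  have hN' : (4 : ℝ) ≤ N := by exact_mod_cast hN
  have hpi := Real.pi_pos
  have hp1 := Real.pi_gt_d4
  have hp2 := Real.pi_lt_d4
  set ψ := 1.0298 * (Real.pi / 2) / ((N : ℝ) + 2) with hψ
  have hψ0 : 0 < ψ := by positivity
  set x := 0.0298 * (Real.pi / 2) with hx
  have hx1 : 0.0468 ≤ x := by rw [hx]; linarith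
  have hx2 : x ≤ 0.047 := by rw [hx]; linarith
  have hM : ((N : ℝ) + 2) * ψ = x + Real.pi / 2 := by rw [hψ, hx]; field_simp; ring
  have hψ1 : ψ ≤ 0.26962 := by
    rw [hψ, div_le_iff₀ (by positivity)]; nlinarith
  rw [critFun, hM, Real.cos_add_pi_div_two, Real.sin_add_pi_div_two]
  have h1 : 0.04678 ≤ Real.sin x := by
    have := Real.sin_gt_sub_cube (x := x) (by linarith)
    nlinarith [pow_le_pow_left₀ (by linarith : (0 : ℝ) ≤ x) hx2 3]
  have h2 : 0.9636 ≤ Real.cos ψ := by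
    have := Real.one_sub_sq_div_two_le_cos (x := ψ)
    nlinarith
  have h3 : Real.sin ψ ≤ 0.26962 := (Real.sin_le hψ0.le).trans hψ1
  have h4 := Real.cos_le_one x
  have h5 : 0 ≤ Real.sin ψ := Real.sin_nonneg_of_nonneg_of_le_pi hψ0.le (by linarith)
  have h6 : Real.cos x * Real.sin ψ ≤ 0.26962 := by nlinarith
  have h7 : 6 * 0.04678 ≤ ((N : ℝ) + 2) * Real.sin x := by nlinarith
  have h8 : 6 * 0.04678 * 0.9636 ≤ ((N : ℝ) + 2) * Real.sin x * Real.cos ψ := by nlinarith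
  nlinarith

/-! ### Odd and even nodes on the unit circle -/

/-- On the circle 1 - 2cz + z² = 2z(cos τ - c), so the kernel becomes a real factor times 1 ∓ z^L,
with the sign given by the parity of the node. -/
theorem sum_U_mul_exp_eq {L k : ℕ} (hk0 : 1 ≤ k) (hk : k < L) {τ : ℝ}
    (h : Real.cos τ ≠ Real.cos (k * Real.pi / L)) :
    ∑ j ∈ Finset.Icc 1 (L - 1),
      (((Chebyshev.U ℝ (j - 1)).eval (Real.cos (k * Real.pi / L)) : ℝ) : ℂ) *
        Complex.exp (τ * Complex.I) ^ j =
      (1 - (-1) ^ k * Complex.exp (τ * Complex.I) ^ L) *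
        ((1 / (2 * (Real.cos τ - Real.cos (k * Real.pi / L))) : ℝ) : ℂ) := by
  set c := Real.cos (k * Real.pi / L)
  set z := Complex.exp (τ * Complex.I) with hz
  have hz0 : z ≠ 0 := Complex.exp_ne_zero _
  have h1 := mul_sum_U_mul_pow c z (L - 1)
  have e1 : ((L - 1 : ℕ) : ℤ) = (L : ℤ) - 1 := by omega
  rw [e1, U_sub_one_node hk0 hk, show (L : ℤ) - 1 - 1 = L - 2 by ring, U_sub_two_node hk0 hk,
    show L - 1 + 2 = L + 1 by omega] at h1
  have hcos : (Real.cos τ : ℂ) * (2 * z) = z ^ 2 + 1 := by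
    have hm : z * Complex.exp (-τ * Complex.I) = 1 := by
      rw [hz, ← Complex.exp_add]; simp
    rw [Complex.ofReal_cos, Complex.cos, ← hz]
    linear_combination hm
  have hne : ((2 * (Real.cos τ - c) : ℝ) : ℂ) ≠ 0 := by
    exact_mod_cast mul_ne_zero two_ne_zero (sub_ne_zero.mpr h)
  rw [one_div, Complex.ofReal_inv, ← div_eq_mul_inv, eq_div_iff hne]
  apply mul_left_cancel₀ hz0
  push_cast at h1 ⊢
  push_cast at hcos
  linear_combination h1 + (∑ j ∈ Finset.Icc 1 (L - 1),
    (Polynomial.eval (c : ℂ) (Chebyshev.U ℂ (j - 1))) * z ^ j) * hcos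

theorem sum_exp_eq_sum_nodes {N L : ℕ} (hNL : N < L) (a : ℕ → ℝ) {τ : ℝ}
    (h : ∀ k : ℕ, 1 ≤ k → k < L → Real.cos τ ≠ Real.cos (k * Real.pi / L)) :
    ∑ j ∈ Finset.Icc 1 N, (a j : ℂ) * Complex.exp (τ * Complex.I) ^ j =
      ∑ k ∈ Finset.range L, (1 - (-1) ^ k * Complex.exp (τ * Complex.I) ^ L) / 2 *
        ((nodeWeight N L a k / (Real.cos τ - Real.cos (k * Real.pi / L)) : ℝ) : ℂ) := by
  rw [sum_coeff_mul_pow_eq N L hNL a]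
  refine Finset.sum_congr rfl fun k hk => ?_
  rw [Finset.mem_range] at hk
  rcases Nat.eq_zero_or_pos k with rfl | hk0
  · simp [nodeWeight_zero]
  · rw [sum_U_mul_exp_eq hk0 hk (h k hk0 hk)]
    push_cast
    rw [one_div, mul_inv]
    ring

/-- Sum over the odd nodes. -/
noncomputable def oddNodeSum (N L : ℕ) (a : ℕ → ℝ) (x : ℝ) : ℝ :=
  ∑ k ∈ (Finset.range L).filter Odd, nodeWeight N L a k / (x - Real.cos (k * Real.pi / L))

/-- Sum over the even nodes. -/
noncomputable def evenNodeSum (N L : ℕ) (a : ℕ → ℝ) (x : ℝ) : ℝ :=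
  ∑ k ∈ (Finset.range L).filter (fun k => ¬ Odd k),
    nodeWeight N L a k / (x - Real.cos (k * Real.pi / L))

/-- With E = e^{iLτ/2}, 1 + z^L = 2 cos(Lτ/2) E and 1 - z^L = -2i sin(Lτ/2) E. After removal of E
the odd nodes give the real part and the even nodes the imaginary part. -/
theorem norm_sq_sum_exp_eq {N L : ℕ} (hNL : N < L) (a : ℕ → ℝ) {τ : ℝ}
    (h : ∀ k : ℕ, 1 ≤ k → k < L → Real.cos τ ≠ Real.cos (k * Real.pi / L)) :
    ‖∑ j ∈ Finset.Icc 1 N, (a j : ℂ) * Complex.exp (τ * Complex.I) ^ j‖ ^ 2 =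
      (Real.cos (L * τ / 2) * oddNodeSum N L a (Real.cos τ)) ^ 2 +
      (Real.sin (L * τ / 2) * evenNodeSum N L a (Real.cos τ)) ^ 2 := by
  set E := Complex.exp ((L * τ / 2 : ℝ) * Complex.I) with hE
  have hzL : Complex.exp (τ * Complex.I) ^ L = E * E := by
    rw [hE, ← Complex.exp_nat_mul, ← Complex.exp_add]; push_cast; ring_nf
  have hEE : E * Complex.exp (-(L * τ / 2 : ℝ) * Complex.I) = 1 := by
    rw [hE, ← Complex.exp_add]; simp
  have hc : 1 + E * E = 2 * (Real.cos (L * τ / 2) : ℂ) * E := by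
    rw [Complex.ofReal_cos, Complex.cos, ← hE]; linear_combination -hEE
  have hs : 1 - E * E = -2 * (Real.sin (L * τ / 2) : ℂ) * Complex.I * E := by
    rw [Complex.ofReal_sin, Complex.sin, ← hE]
    linear_combination (-1) * hEE + (Complex.exp (-(L * τ / 2 : ℝ) * Complex.I) - E) * E *
      Complex.I_mul_I
  have key : ∑ j ∈ Finset.Icc 1 N, (a j : ℂ) * Complex.exp (τ * Complex.I) ^ j =
      E * (((Real.cos (L * τ / 2) * oddNodeSum N L a (Real.cos τ) : ℝ) : ℂ) +
        ((-(Real.sin (L * τ / 2) * evenNodeSum N L a (Real.cos τ)) : ℝ) : ℂ) * Complex.I) := by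
    rw [sum_exp_eq_sum_nodes hNL a h, ← Finset.sum_filter_add_sum_filter_not _ Odd]
    have h1 : ∑ k ∈ (Finset.range L).filter Odd,
        (1 - (-1) ^ k * Complex.exp (τ * Complex.I) ^ L) / 2 *
        ((nodeWeight N L a k / (Real.cos τ - Real.cos (k * Real.pi / L)) : ℝ) : ℂ) =
        (Real.cos (L * τ / 2) : ℂ) * E * (oddNodeSum N L a (Real.cos τ) : ℂ) := by
      rw [oddNodeSum, Complex.ofReal_sum, Finset.mul_sum]
      refine Finset.sum_congr rfl fun k hk => ?_
      rw [(Finset.mem_filter.mp hk).2.neg_one_pow, hzL]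
      congr 1
      linear_combination hc / 2
    have h2 : ∑ k ∈ (Finset.range L).filter (fun k => ¬ Odd k),
        (1 - (-1) ^ k * Complex.exp (τ * Complex.I) ^ L) / 2 *
        ((nodeWeight N L a k / (Real.cos τ - Real.cos (k * Real.pi / L)) : ℝ) : ℂ) =
        -(Real.sin (L * τ / 2) : ℂ) * Complex.I * E * (evenNodeSum N L a (Real.cos τ) : ℂ) := by
      rw [evenNodeSum, Complex.ofReal_sum, Finset.mul_sum]
      refine Finset.sum_congr rfl fun k hk => ?_
      rw [(Nat.not_odd_iff_even.mp (Finset.mem_filter.mp hk).2).neg_one_pow, hzL]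
      congr 1
      linear_combination hs / 2
    rw [h1, h2]
    push_cast
    ring
  rw [key, norm_mul, hE, Complex.norm_exp_ofReal_mul_I, one_mul, ← Complex.normSq_eq_norm_sq,
    Complex.normSq_add_mul_I, neg_sq]

/-- This is the reason for L = N + 2: the moment of order N + 1 is zero, and U_N is -(-1)^k at the
nodes, so the alternating sum of the weights vanishes while their sum is 1. -/
theorem sum_filter_nodeWeight {N : ℕ} (hN : 1 ≤ N) (a : ℕ → ℝ) (h1 : a 1 = 1) :
    ∑ k ∈ (Finset.range (N + 2)).filter Odd, nodeWeight N (N + 2) a k = 1 / 2 ∧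
    ∑ k ∈ (Finset.range (N + 2)).filter (fun k => ¬ Odd k), nodeWeight N (N + 2) a k = 1 / 2 := by
  have hs := sum_nodeWeight N (N + 2) hN (by omega) a h1
  have hd := sum_nodeWeight_mul_U N (N + 2) (by omega) a (N + 1) (by omega) (by omega)
  rw [if_neg (by omega)] at hd
  have hd' : ∑ k ∈ Finset.range (N + 2), (-1) ^ k * nodeWeight N (N + 2) a k = 0 := by
    have : ∑ k ∈ Finset.range (N + 2), -((-1) ^ k * nodeWeight N (N + 2) a k) = 0 := by
      rw [← hd]
      refine Finset.sum_congr rfl fun k hk => ?_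
      rw [Finset.mem_range] at hk
      rcases Nat.eq_zero_or_pos k with rfl | hk0
      · simp [nodeWeight_zero]
      · have := U_sub_two_node hk0 hk
        rw [show (((N + 2 : ℕ) : ℤ) - 2) = ((N + 1 : ℕ) : ℤ) - 1 by push_cast; ring] at this
        rw [this]; ring
    rw [Finset.sum_neg_distrib] at this
    linarith
  rw [← Finset.sum_filter_add_sum_filter_not _ Odd] at hs hd'
  have e1 : ∑ k ∈ (Finset.range (N + 2)).filter Odd, (-1) ^ k * nodeWeight N (N + 2) a k =
      -∑ k ∈ (Finset.range (N + 2)).filter Odd, nodeWeight N (N + 2) a k := by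
    rw [← Finset.sum_neg_distrib]
    refine Finset.sum_congr rfl fun k hk => ?_
    rw [(Finset.mem_filter.mp hk).2.neg_one_pow]; ring
  have e2 : ∑ k ∈ (Finset.range (N + 2)).filter (fun k => ¬ Odd k),
      (-1) ^ k * nodeWeight N (N + 2) a k =
      ∑ k ∈ (Finset.range (N + 2)).filter (fun k => ¬ Odd k), nodeWeight N (N + 2) a k := by
    refine Finset.sum_congr rfl fun k hk => ?_
    rw [(Nat.not_odd_iff_even.mp (Finset.mem_filter.mp hk).2).neg_one_pow]; ring
  rw [e1, e2] at hd'
  constructor <;> linarith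

/-- At τ = 0 the factor 1 - (-1)^k is 2 at odd nodes and 0 at even ones. -/
theorem oddNodeSum_one {N : ℕ} (a : ℕ → ℝ) :
    oddNodeSum N (N + 2) a 1 = ∑ j ∈ Finset.Icc 1 N, a j := by
  have hns : ∀ k : ℕ, 1 ≤ k → k < N + 2 →
      Real.cos 0 ≠ Real.cos (k * Real.pi / ((N + 2 : ℕ) : ℝ)) := by
    intro k hk0 hk
    have hk' : (0 : ℝ) < k := by exact_mod_cast hk0
    refine (Real.cos_lt_cos_of_nonneg_of_le_pi le_rfl (node_mem_Icc hk).2 ?_).ne'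
    have := Real.pi_pos
    positivity
  have h := sum_exp_eq_sum_nodes (by omega : N < N + 2) a hns
  simp only [Complex.ofReal_zero, zero_mul, Complex.exp_zero, one_pow, mul_one, Real.cos_zero] at h
  rw [← Finset.sum_filter_add_sum_filter_not (Finset.range (N + 2)) Odd] at h
  have e2 : ∑ k ∈ (Finset.range (N + 2)).filter (fun k => ¬ Odd k), (1 - (-1 : ℂ) ^ k) / 2 *
      ((nodeWeight N (N + 2) a k / (1 - Real.cos (k * Real.pi / ((N + 2 : ℕ) : ℝ))) : ℝ) : ℂ)
        = 0 := by
    refine Finset.sum_eq_zero fun k hk => ?_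
    rw [(Nat.not_odd_iff_even.mp (Finset.mem_filter.mp hk).2).neg_one_pow]; simp
  have e1 : ∑ k ∈ (Finset.range (N + 2)).filter Odd, (1 - (-1 : ℂ) ^ k) / 2 *
      ((nodeWeight N (N + 2) a k / (1 - Real.cos (k * Real.pi / ((N + 2 : ℕ) : ℝ))) : ℝ) : ℂ)
        = (oddNodeSum N (N + 2) a 1 : ℂ) := by
    rw [oddNodeSum, Complex.ofReal_sum]
    refine Finset.sum_congr rfl fun k hk => ?_
    rw [(Finset.mem_filter.mp hk).2.neg_one_pow]; norm_num
  rw [e1, e2, add_zero] at h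
  exact_mod_cast h.symm

theorem abs_sum_weight_le {s : Finset ℕ} {w d : ℕ → ℝ} {X m x : ℝ} (hw : ∀ k ∈ s, 0 ≤ w k)
    (hsum : ∑ k ∈ s, w k = m) (hd : ∀ k ∈ s, w k ≠ 0 → |x| / |d k| ≤ X) :
    |x * ∑ k ∈ s, w k / d k| ≤ m * X := by
  rw [Finset.mul_sum, ← hsum, Finset.sum_mul]
  refine (Finset.abs_sum_le_sum_abs _ _).trans (Finset.sum_le_sum fun k hk => ?_)
  by_cases h0 : w k = 0
  · simp [h0]
  · rw [abs_mul, abs_div, abs_of_nonneg (hw k hk), mul_div_left_comm]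
    exact mul_le_mul_of_nonneg_left (hd k hk h0) (hw k hk)

theorem abs_sin_nat_mul_le (n : ℕ) (x : ℝ) : |Real.sin (n * x)| ≤ n * |Real.sin x| := by
  induction n with
  | zero => simp
  | succ n ih =>
    push_cast
    rw [add_mul, one_mul, Real.sin_add]
    have h1 := abs_add_le (Real.sin (n * x) * Real.cos x) (Real.cos (n * x) * Real.sin x)
    rw [abs_mul, abs_mul] at h1
    have h2 := mul_le_mul_of_nonneg_left (Real.abs_cos_le_one x) (abs_nonneg (Real.sin (n * x)))
    have h3 := mul_le_mul_of_nonneg_right (Real.abs_cos_le_one (n * x)) (abs_nonneg (Real.sin x))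
    linarith

/-- The difference of cosines contains the factor sin((τ - s)/2), which cancels against |sin(Lx)| ≤
L|sin x|; the quotient stays bounded as τ approaches the node. -/
theorem abs_sin_mul_half_le (L : ℕ) (τ s : ℝ) (hs : 0 < Real.sin ((τ + s) / 2))
    (hne : Real.cos τ ≠ Real.cos s) :
    |Real.sin (L * ((τ - s) / 2))| / |Real.cos τ - Real.cos s| ≤
      L / (2 * Real.sin ((τ + s) / 2)) := by
  have h := abs_sin_nat_mul_le L ((τ - s) / 2)
  rw [div_le_div_iff₀ (abs_pos.mpr (sub_ne_zero.mpr hne)) (by positivity), Real.cos_sub_cos,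
    abs_mul, abs_mul, abs_neg, abs_two, abs_of_pos hs]
  nlinarith [mul_le_mul_of_nonneg_right h hs.le]

theorem abs_cos_half_eq_of_odd {L k : ℕ} (hL : 0 < L) (hk : Odd k) (τ : ℝ) :
    |Real.cos (L * τ / 2)| = |Real.sin (L * ((τ - k * Real.pi / L) / 2))| := by
  have hL' : (L : ℝ) ≠ 0 := by exact_mod_cast hL.ne'
  obtain ⟨m, rfl⟩ := hk
  have e : (L : ℝ) * ((τ - (2 * m + 1 : ℕ) * Real.pi / L) / 2) =
      (L * τ / 2 - Real.pi / 2) - m * Real.pi := by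
    push_cast; field_simp; ring
  rw [e, Real.sin_sub_nat_mul_pi, Real.sin_sub_pi_div_two]
  simp [abs_mul]

theorem abs_sin_half_eq_of_even {L k : ℕ} (hL : 0 < L) (hk : Even k) (τ : ℝ) :
    |Real.sin (L * τ / 2)| = |Real.sin (L * ((τ - k * Real.pi / L) / 2))| := by
  have hL' : (L : ℝ) ≠ 0 := by exact_mod_cast hL.ne'
  obtain ⟨m, rfl⟩ := hk
  have e : (L : ℝ) * ((τ - (m + m : ℕ) * Real.pi / L) / 2) = L * τ / 2 - m * Real.pi := by
    push_cast; field_simp; ring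
  rw [e, Real.sin_sub_nat_mul_pi]
  simp [abs_mul]

/-! ### Inequalities for the three arcs -/

/-- Factoring over the roots, the leading coefficient is eliminated through T_L(1) = 1. -/
theorem cos_mul_prod_eq {L : ℕ} (y : ℝ) :
    (Chebyshev.T ℝ L).eval y * ∏ k ∈ Finset.range L, (1 - Real.cos ((2 * k + 1) * Real.pi / (2 * L)))
      = ∏ k ∈ Finset.range L, (y - Real.cos ((2 * k + 1) * Real.pi / (2 * L))) := by
  set f : ℕ → ℝ := fun k => Real.cos ((2 * k + 1) * Real.pi / (2 * L)) with hf
  have hinj : Set.InjOn f (Finset.range L) :=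
    (Finset.range L).nodup_map_iff_injOn.mp (Chebyshev.roots_T_real_nodup L)
  have hroots := Chebyshev.roots_T_real L
  have hcard : Multiset.card (Chebyshev.T ℝ L).roots = (Chebyshev.T ℝ L).natDegree := by
    rw [hroots, Finset.card_val, Finset.card_image_of_injOn hinj, Finset.card_range,
      Chebyshev.natDegree_T, Int.natAbs_natCast]
  have hfac := C_leadingCoeff_mul_prod_multiset_X_sub_C hcard
  have hev : ∀ x : ℝ, (Chebyshev.T ℝ L).eval x =
      (Chebyshev.T ℝ L).leadingCoeff * ∏ k ∈ Finset.range L, (x - f k) := by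
    intro x
    conv_lhs => rw [← hfac]
    rw [hroots, eval_mul, eval_C, eval_multiset_prod, Multiset.map_map]
    congr 1
    rw [← Finset.prod_image (g := f) (f := fun y => x - y) hinj]
    simp [Finset.prod]
    rfl
  have h1 := hev 1
  rw [Chebyshev.T_eval_one] at h1
  rw [hev y]
  linear_combination -(∏ k ∈ Finset.range L, (y - f k)) * h1

/-- With y = cos(τ/2), cos(Lτ/2) = T_L(y) is the product of the quotients (y - f_k)/(1 - f_k) over
the roots, all in [0, 1]. Only four are kept; they pair up as ±f_0, ±f_1 and y² - f² is half a
difference of cosines. -/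
theorem cos_half_mul_le {L : ℕ} (hL : 4 ≤ L) {τ : ℝ} (h0 : 0 ≤ τ) (h1 : τ ≤ Real.pi / L) :
    Real.cos (L * τ / 2) * ((1 - Real.cos (Real.pi / L)) * (1 - Real.cos (3 * (Real.pi / L)))) ≤
      (Real.cos τ - Real.cos (Real.pi / L)) * (Real.cos τ - Real.cos (3 * (Real.pi / L))) := by
  have hpi := Real.pi_pos
  have hL' : (4 : ℝ) ≤ L := by exact_mod_cast hL
  have hL0 : (0 : ℝ) < L := by linarith
  set f : ℕ → ℝ := fun k => Real.cos ((2 * k + 1) * Real.pi / (2 * L)) with hf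
  set y := Real.cos (τ / 2) with hy
  have hT : (Chebyshev.T ℝ L).eval y = Real.cos (L * τ / 2) := by
    rw [hy, Chebyshev.T_real_cos]; push_cast; ring_nf
  have hprod := cos_mul_prod_eq (L := L) y
  rw [hT] at hprod
  have hτpi : τ ≤ Real.pi := h1.trans (div_le_self hpi.le (by linarith))
  have hfy : ∀ k ∈ Finset.range L, f k ≤ y := by
    intro k hk
    rw [Finset.mem_range] at hk
    have hk' : (k : ℝ) + 1 ≤ L := by exact_mod_cast hk
    apply Real.cos_le_cos_of_nonneg_of_le_pi (by positivity)
    · rw [div_le_iff₀ (by positivity)]; nlinarith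
    · rw [le_div_iff₀ (by positivity)]
      rw [le_div_iff₀ hL0] at h1
      have : (0 : ℝ) ≤ k := k.cast_nonneg
      nlinarith
  have hf1 : ∀ k ∈ Finset.range L, f k < 1 := by
    intro k hk
    rw [Finset.mem_range] at hk
    have hk' : (k : ℝ) + 1 ≤ L := by exact_mod_cast hk
    rw [← Real.cos_zero]
    apply Real.cos_lt_cos_of_nonneg_of_le_pi le_rfl
    · rw [div_le_iff₀ (by positivity)]; nlinarith
    · positivity
  have hy1 : y ≤ 1 := Real.cos_le_one _
  set s : Finset ℕ := {0, 1, L - 2, L - 1} with hs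
  have hsub : s ⊆ Finset.range L := by
    intro k hk
    simp only [hs, Finset.mem_insert, Finset.mem_singleton] at hk
    rw [Finset.mem_range]; omega
  rw [← Finset.prod_sdiff hsub, ← Finset.prod_sdiff hsub] at hprod
  have hR1 : 0 < ∏ k ∈ Finset.range L \ s, (1 - f k) :=
    Finset.prod_pos fun k hk => by linarith [hf1 k (Finset.sdiff_subset hk)]
  have hRy : ∏ k ∈ Finset.range L \ s, (y - f k) ≤ ∏ k ∈ Finset.range L \ s, (1 - f k) :=
    Finset.prod_le_prod (fun k hk => by linarith [hfy k (Finset.sdiff_subset hk)])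
      fun k _ => by linarith
  have hS0 : 0 ≤ ∏ k ∈ s, (y - f k) :=
    Finset.prod_nonneg fun k hk => by linarith [hfy k (hsub hk)]
  have hmain : Real.cos (L * τ / 2) * ∏ k ∈ s, (1 - f k) ≤ ∏ k ∈ s, (y - f k) := by
    have h2 : (∏ k ∈ Finset.range L \ s, (1 - f k)) *
        (Real.cos (L * τ / 2) * ∏ k ∈ s, (1 - f k)) ≤
        (∏ k ∈ Finset.range L \ s, (1 - f k)) * ∏ k ∈ s, (y - f k) := by
      calc _ = _ := by rw [mul_left_comm]
        _ = _ := hprod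
        _ ≤ _ := mul_le_mul_of_nonneg_right hRy hS0
    exact le_of_mul_le_mul_left h2 hR1
  have hfour : ∀ x : ℝ, ∏ k ∈ s, (x - f k) = (x ^ 2 - f 0 ^ 2) * (x ^ 2 - f 1 ^ 2) := by
    intro x
    have e1 : f (L - 1) = -f 0 := by
      simp only [hf]
      rw [← Real.cos_pi_sub]
      congr 1
      push_cast [Nat.cast_sub (by omega : 1 ≤ L)]
      field_simp; ring
    have e2 : f (L - 2) = -f 1 := by
      simp only [hf]
      rw [← Real.cos_pi_sub]
      congr 1
      push_cast [Nat.cast_sub (by omega : 2 ≤ L)]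
      field_simp; ring
    rw [hs, Finset.prod_insert (by simp; omega), Finset.prod_insert (by simp; omega),
      Finset.prod_insert (by simp; omega), Finset.prod_singleton, e1, e2]
    ring
  rw [hfour, hfour] at hmain
  have g0 : f 0 ^ 2 = (1 + Real.cos (Real.pi / L)) / 2 := by
    have := Real.cos_two_mul ((2 * (0 : ℕ) + 1) * Real.pi / (2 * L))
    have e : 2 * ((2 * ((0 : ℕ) : ℝ) + 1) * Real.pi / (2 * L)) = Real.pi / L := by
      push_cast; field_simp; ring
    rw [e] at this
    simp only [hf]; linarith
  have g1 : f 1 ^ 2 = (1 + Real.cos (3 * (Real.pi / L))) / 2 := by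
    have := Real.cos_two_mul ((2 * (1 : ℕ) + 1) * Real.pi / (2 * L))
    have e : 2 * ((2 * ((1 : ℕ) : ℝ) + 1) * Real.pi / (2 * L)) = 3 * (Real.pi / L) := by
      push_cast; field_simp; ring
    rw [e] at this
    simp only [hf]; linarith
  have gy : y ^ 2 = (1 + Real.cos τ) / 2 := by
    have := Real.cos_two_mul (τ / 2)
    rw [show 2 * (τ / 2) = τ by ring] at this
    rw [hy]; linarith
  rw [g0, g1, gy] at hmain
  linarith

/-- Here s = 1 + 2 cos t, w = (1 - cos τ)/(1 - cos t) and σ = sin²(Lτ/2). The two summands bound the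
shares of the odd and even nodes in |F|²/J². The range of s comes from t ≤ π/5. -/
theorem near_inequality {s w σ : ℝ} (hs1 : 2.618 ≤ s) (hs2 : s ≤ 3) (hw0 : 0 < w) (hw1 : w ≤ 1)
    (hσ1 : σ ≤ 1) (hσw : σ ≤ 2.4675 * w) :
    (1 - w / s ^ 2) ^ 2 + 9 / 8 * (σ / (1 + s - w) ^ 2) < 1 := by
  have hs0 : 0 < s := by linarith
  have hd : 0 < 1 + s - w := by linarith
  have key : 9 / 8 * σ * s ^ 4 < w * (2 * s ^ 2 - w) * (1 + s - w) ^ 2 := by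
    -- Near w = 1/2.4675 the two bounds on σ cross: below, σ ≤ 2.4675 w is used, above, σ ≤ 1. The
    -- further cut at 0.6 makes the resulting inequalities in s alone true.
    rcases le_total w 0.41 with h | h
    · have p1 : 9 / 8 * 2.4675 * s ^ 4 < (2 * s ^ 2 - 0.41) * (s + 0.59) ^ 2 := by
        nlinarith [mul_nonneg (sub_nonneg.mpr hs1) (sub_nonneg.mpr hs2),
          mul_nonneg (mul_nonneg (sub_nonneg.mpr hs1) (sub_nonneg.mpr hs2)) (sq_nonneg s),
          mul_nonneg (mul_nonneg (sub_nonneg.mpr hs1) (sub_nonneg.mpr hs2)) hs0.le]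
      have p2 : (2 * s ^ 2 - 0.41) * (s + 0.59) ^ 2 ≤ (2 * s ^ 2 - w) * (1 + s - w) ^ 2 := by
        apply mul_le_mul
        · linarith
        · exact pow_le_pow_left₀ (by linarith) (by linarith) 2
        · positivity
        · nlinarith
      have p3 : 9 / 8 * σ * s ^ 4 ≤ w * (9 / 8 * 2.4675 * s ^ 4) := by
        have : 0 < s ^ 4 := by positivity
        nlinarith
      have p4 := mul_lt_mul_of_pos_left (p1.trans_le p2) hw0
      linarith
    · have p0 : 9 / 8 * σ * s ^ 4 ≤ 9 / 8 * s ^ 4 := by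
        have : 0 < s ^ 4 := by positivity
        nlinarith
      have mono : ∀ u : ℝ, 0 ≤ u → u ≤ w → u * (1 + s - u) ^ 2 ≤ w * (1 + s - w) ^ 2 := by
        intro u hu huw
        have hA : 0 ≤ (1 + s - u) - w := by linarith
        have e : w * (1 + s - w) ^ 2 - u * (1 + s - u) ^ 2 =
          (w - u) * (((1 + s) - (w + u)) ^ 2 - w * u) := by ring
        have h2 : 0 ≤ ((1 + s) - (w + u)) ^ 2 - w * u := by nlinarith
        nlinarith [mul_nonneg (sub_nonneg.mpr huw) h2]
      rcases le_total w 0.6 with h' | h'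
      · have p1 : 9 / 8 * s ^ 4 < (2 * s ^ 2 - 0.6) * (0.41 * (s + 0.59) ^ 2) := by
          nlinarith [mul_nonneg (sub_nonneg.mpr hs1) (sub_nonneg.mpr hs2),
            mul_nonneg (mul_nonneg (sub_nonneg.mpr hs1) (sub_nonneg.mpr hs2)) (sq_nonneg s),
            mul_nonneg (mul_nonneg (sub_nonneg.mpr hs1) (sub_nonneg.mpr hs2)) hs0.le]
        have p2 := mono 0.41 (by norm_num) h
        rw [show 1 + s - 0.41 = s + 0.59 by ring] at p2
        have p3 : (2 * s ^ 2 - 0.6) * (0.41 * (s + 0.59) ^ 2) ≤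
            (2 * s ^ 2 - w) * (w * (1 + s - w) ^ 2) :=
          mul_le_mul (by linarith) p2 (by positivity) (by nlinarith)
        linarith
      · have p1 : 9 / 8 * s ^ 4 < (2 * s ^ 2 - 1) * (0.6 * (s + 0.4) ^ 2) := by
          nlinarith [mul_nonneg (sub_nonneg.mpr hs1) (sub_nonneg.mpr hs2),
            mul_nonneg (mul_nonneg (sub_nonneg.mpr hs1) (sub_nonneg.mpr hs2)) (sq_nonneg s),
            mul_nonneg (mul_nonneg (sub_nonneg.mpr hs1) (sub_nonneg.mpr hs2)) hs0.le]
        have p2 := mono 0.6 (by norm_num) h'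
        rw [show 1 + s - 0.6 = s + 0.4 by ring] at p2
        have p3 : (2 * s ^ 2 - 1) * (0.6 * (s + 0.4) ^ 2) ≤
            (2 * s ^ 2 - w) * (w * (1 + s - w) ^ 2) :=
          mul_le_mul (by linarith) p2 (by positivity) (by nlinarith)
        linarith
  have e : (1 - w / s ^ 2) ^ 2 + 9 / 8 * (σ / (1 + s - w) ^ 2) =
      1 + (9 / 8 * σ * s ^ 4 - w * (2 * s ^ 2 - w) * (1 + s - w) ^ 2) /
        (s ^ 4 * (1 + s - w) ^ 2) := by
    field_simp; ring
  rw [e]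
  have : (9 / 8 * σ * s ^ 4 - w * (2 * s ^ 2 - w) * (1 + s - w) ^ 2) /
      (s ^ 4 * (1 + s - w) ^ 2) < 0 := div_neg_of_neg_of_pos (by linarith) (by positivity)
  linarith

theorem sin_ge_mul_one_sub {x : ℝ} (hx : 0 ≤ x) : x * (1 - x ^ 2 / 6) ≤ Real.sin x := by
  rcases eq_or_lt_of_le hx with rfl | h
  · simp
  · have := Real.sin_gt_sub_cube h
    linarith [show x * (1 - x ^ 2 / 6) = x - x ^ 3 / 6 by ring]

/-- The numerical constraints on the half-spacing `t = π / L` and on `κ` used below. -/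
def NumericRange (t κ : ℝ) : Prop :=
  (κ ≤ 9 / 8 ∧ t ≤ Real.pi / 6) ∨ (κ ≤ 1 ∧ t ≤ Real.pi / 5)

/-- With π/t = L, ξ and η are the odd and even kernel bounds on [t, 5t/4] in units of 1/(1 - cos t).
The odd one uses sin((τ + θ)/2) ≥ sin t, the even one only the gap cos(5t/4) - cos 2t. -/
theorem middle_inequality {t κ : ℝ} (ht : 0 < t) (h : NumericRange t κ) :
    ∃ ξ η : ℝ, 0 ≤ ξ ∧ 0 ≤ η ∧ κ * (ξ ^ 2 + η ^ 2) < 1 ∧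
      Real.pi / t * (1 - Real.cos t) ≤ ξ * (2 * Real.sin t) ∧
      1 - Real.cos t ≤ η * (Real.cos (5 / 4 * t) - Real.cos (2 * t)) := by
  have hp1 := Real.pi_gt_d4
  have hp2 := Real.pi_lt_d4
  have hpi := Real.pi_pos
  have ht5 : t ≤ 0.62832 := by rcases h with h | h <;> linarith [h.2]
  have hc : 1 - t ^ 2 / 8 ≤ Real.cos (t / 2) := by
    have := Real.one_sub_sq_div_two_le_cos (x := t / 2)
    linarith [show (t / 2) ^ 2 / 2 = t ^ 2 / 8 by ring]
  have hs2 : Real.sin (t / 2) ≤ t / 2 := Real.sin_le (by positivity)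
  have hs20 : 0 < Real.sin (t / 2) := Real.sin_pos_of_pos_of_lt_pi (by positivity) (by linarith)
  have hq : 1 - Real.cos t = 2 * Real.sin (t / 2) ^ 2 := by
    have := Real.cos_two_mul (t / 2)
    rw [show 2 * (t / 2) = t by ring] at this
    have := Real.sin_sq_add_cos_sq (t / 2)
    linarith
  have hst : Real.sin t = 2 * Real.sin (t / 2) * Real.cos (t / 2) := by
    rw [← Real.sin_two_mul]; ring_nf
  have hcc : Real.cos (5 / 4 * t) - Real.cos (2 * t) =
      2 * Real.sin (13 / 8 * t) * Real.sin (3 / 8 * t) := by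
    rw [Real.cos_sub_cos, show (5 / 4 * t + 2 * t) / 2 = 13 / 8 * t by ring,
      show (5 / 4 * t - 2 * t) / 2 = -(3 / 8 * t) by ring, Real.sin_neg]; ring
  have b1 := sin_ge_mul_one_sub (x := 13 / 8 * t) (by positivity)
  have b2 := sin_ge_mul_one_sub (x := 3 / 8 * t) (by positivity)
  have gen : ∀ T ξ η : ℝ, t ^ 2 ≤ T → T ≤ 0.4 → 0 ≤ ξ → 0 ≤ η → 0.78541 ≤ ξ * (1 - T / 8) →
      1 / 2 ≤ η * (39 / 32 * ((1 - 169 / 384 * T) * (1 - 9 / 384 * T))) →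
      Real.pi / t * (1 - Real.cos t) ≤ ξ * (2 * Real.sin t) ∧
      1 - Real.cos t ≤ η * (Real.cos (5 / 4 * t) - Real.cos (2 * t)) := by
    intro T ξ η hT hT4 hξ hη h1 h2
    constructor
    · rw [hq, hst, div_mul_eq_mul_div, div_le_iff₀ ht]
      have : Real.pi * Real.sin (t / 2) ≤ 2 * ξ * Real.cos (t / 2) * t := by
        have q1 : 0.78541 ≤ ξ * Real.cos (t / 2) :=
          h1.trans (mul_le_mul_of_nonneg_left (by linarith) hξ)
        calc Real.pi * Real.sin (t / 2) ≤ Real.pi * (t / 2) :=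
              mul_le_mul_of_nonneg_left hs2 hpi.le
          _ ≤ 2 * 0.78541 * t := by nlinarith
          _ ≤ 2 * (ξ * Real.cos (t / 2)) * t := by nlinarith
          _ = _ := by ring
      have := mul_le_mul_of_nonneg_left this hs20.le
      linarith
    · rw [hcc, hq]
      have q1 : 2 * Real.sin (t / 2) ^ 2 ≤ t ^ 2 / 2 := by
        have := pow_le_pow_left₀ hs20.le hs2 2
        linarith [show (t / 2) ^ 2 = t ^ 2 / 4 by ring]
      have r1 : 1 - 169 / 384 * T ≤ 1 - (13 / 8 * t) ^ 2 / 6 := by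
        linarith [show (13 / 8 * t) ^ 2 / 6 = 169 / 384 * t ^ 2 by ring]
      have r2 : 1 - 9 / 384 * T ≤ 1 - (3 / 8 * t) ^ 2 / 6 := by
        linarith [show (3 / 8 * t) ^ 2 / 6 = 9 / 384 * t ^ 2 by ring]
      have r10 : 0 ≤ 1 - 169 / 384 * T := by linarith
      have r20 : 0 ≤ 1 - 9 / 384 * T := by linarith
      have s1 : 13 / 8 * t * (1 - 169 / 384 * T) ≤ Real.sin (13 / 8 * t) :=
        (mul_le_mul_of_nonneg_left r1 (by positivity)).trans b1
      have s2 : 3 / 8 * t * (1 - 9 / 384 * T) ≤ Real.sin (3 / 8 * t) :=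
        (mul_le_mul_of_nonneg_left r2 (by positivity)).trans b2
      have s3 : 13 / 8 * t * (1 - 169 / 384 * T) * (3 / 8 * t * (1 - 9 / 384 * T)) ≤
          Real.sin (13 / 8 * t) * Real.sin (3 / 8 * t) :=
        mul_le_mul s1 s2 (by positivity) (le_trans (by positivity) s1)
      have s4 := mul_le_mul_of_nonneg_left s3 (by positivity : 0 ≤ 2 * η)
      have s5 := mul_le_mul_of_nonneg_left h2 (sq_nonneg t)
      linarith
  rcases h with ⟨hκ, ht6⟩ | ⟨hκ, ht6⟩
  · have hT : t ^ 2 ≤ 0.27417 := by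
      have : t ≤ 0.5236 := by linarith
      nlinarith
    -- 0.27417 bounds (π/6)², and in the other case 0.3948 bounds (π/5)². The witnesses are slightly
    -- above the least values allowed by `gen`.
    exact ⟨0.8135, 0.4697, by norm_num, by norm_num, by linarith,
      gen 0.27417 _ _ hT (by norm_num) (by norm_num) (by norm_num) (by norm_num) (by norm_num)⟩
  · have hT : t ^ 2 ≤ 0.3948 := by nlinarith
    exact ⟨0.8265, 0.5015, by norm_num, by norm_num, by linarith,
      gen 0.3948 _ _ hT (by norm_num) (by norm_num) (by norm_num) (by norm_num) (by norm_num)⟩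

/-- For τ ≥ 5t/4 the mean of τ and a node is at least 9t/8 at odd nodes and 13t/8 at even ones,
where the node is at least 2t. -/
theorem far_inequality {t κ : ℝ} (ht : 0 < t) (h : NumericRange t κ) :
    ∃ ξ η : ℝ, 0 ≤ ξ ∧ 0 ≤ η ∧ κ * (ξ ^ 2 + η ^ 2) < 1 ∧
      Real.pi / t * (1 - Real.cos t) ≤ ξ * (2 * Real.sin (9 / 8 * t)) ∧
      Real.pi / t * (1 - Real.cos t) ≤ η * (2 * Real.sin (13 / 8 * t)) := by
  have hp1 := Real.pi_gt_d4
  have hp2 := Real.pi_lt_d4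
  have hpi := Real.pi_pos
  have ht5 : t ≤ 0.62832 := by rcases h with h | h <;> linarith [h.2]
  have hq : Real.pi / t * (1 - Real.cos t) ≤ 2 * 0.78541 * t := by
    have := Real.one_sub_sq_div_two_le_cos (x := t)
    rw [div_mul_eq_mul_div, div_le_iff₀ ht]
    nlinarith [sq_nonneg t]
  have gen : ∀ T r ξ : ℝ, t ^ 2 ≤ T → 0 ≤ ξ → 0 < r → 0.78541 ≤ ξ * (r * (1 - r ^ 2 * T / 6)) →
      Real.pi / t * (1 - Real.cos t) ≤ ξ * (2 * Real.sin (r * t)) := by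
    intro T r ξ hT hξ hr h1
    have b := sin_ge_mul_one_sub (x := r * t) (by positivity)
    have r1 : 1 - r ^ 2 * T / 6 ≤ 1 - (r * t) ^ 2 / 6 := by
      have := mul_le_mul_of_nonneg_left hT (sq_nonneg r)
      nlinarith
    have s1 : r * t * (1 - r ^ 2 * T / 6) ≤ Real.sin (r * t) :=
      (mul_le_mul_of_nonneg_left r1 (by positivity)).trans b
    have s2 := mul_le_mul_of_nonneg_left s1 (by positivity : 0 ≤ 2 * ξ)
    have s3 := mul_le_mul_of_nonneg_right h1 ht.le
    linarith
  rcases h with ⟨hκ, ht6⟩ | ⟨hκ, ht6⟩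
  · have hT : t ^ 2 ≤ 0.27417 := by
      have : t ≤ 0.5236 := by linarith
      nlinarith
    exact ⟨0.7415, 0.55, by norm_num, by norm_num, by linarith,
      gen 0.27417 _ _ hT (by norm_num) (by norm_num) (by norm_num),
      gen 0.27417 _ _ hT (by norm_num) (by norm_num) (by norm_num)⟩
  · have hT : t ^ 2 ≤ 0.3948 := by nlinarith
    exact ⟨0.762, 0.5855, by norm_num, by norm_num, by linarith,
      gen 0.3948 _ _ hT (by norm_num) (by norm_num) (by norm_num),
      gen 0.3948 _ _ hT (by norm_num) (by norm_num) (by norm_num)⟩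

/-! ### Strict bounds on the right quarter circle -/

/-- The node formulas divide by cos τ - cos θ_k; continuity restores the finitely many excluded
points. -/
theorem le_of_le_off_finite {g : ℝ → ℝ} (hg : Continuous g) {α β X : ℝ} (hαβ : α < β)
    {s : Set ℝ} (hs : s.Finite) (h : ∀ x ∈ Set.Icc α β, x ∉ s → g x ≤ X) :
    ∀ x ∈ Set.Icc α β, g x ≤ X := by
  have hd : Dense sᶜ := hs.countable.dense_compl ℝ
  have h1 : Set.Ioo α β ⊆ closure (Set.Ioo α β ∩ sᶜ) := hd.open_subset_closure_inter isOpen_Ioo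
  have h2 : Set.Icc α β ⊆ closure (Set.Ioo α β ∩ sᶜ) := by
    rw [← closure_Ioo hαβ.ne]
    exact closure_minimal h1 isClosed_closure
  have h3 : closure (Set.Ioo α β ∩ sᶜ) ⊆ {x | g x ≤ X} :=
    closure_minimal (fun x hx => h x (Set.Ioo_subset_Icc_self hx.1) hx.2)
      (isClosed_le hg continuous_const)
  exact fun x hx => h3 (h2 hx)

section CircleBound

variable {N : ℕ} {a : ℕ → ℝ}

/-- Each parity class has total weight 1/2, so each node sum times its trigonometric factor is at
most half the kernel bound. -/
theorem norm_sq_le_of_kernel_le (hN : 1 ≤ N) (h1 : a 1 = 1)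
    (ha : ∀ t ∈ Set.Icc (0 : ℝ) Real.pi, 0 ≤ sineSum N a t) {τ X Y : ℝ}
    (hns : ∀ k : ℕ, 1 ≤ k → k < N + 2 →
      Real.cos τ ≠ Real.cos (k * Real.pi / ((N + 2 : ℕ) : ℝ)))
    (hodd : ∀ k : ℕ, Odd k → k < N + 2 → |Real.cos ((N + 2 : ℕ) * τ / 2)| /
      |Real.cos τ - Real.cos (k * Real.pi / ((N + 2 : ℕ) : ℝ))| ≤ X)
    (heven : ∀ k : ℕ, Even k → 2 ≤ k → k < N + 2 → |Real.sin ((N + 2 : ℕ) * τ / 2)| /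
      |Real.cos τ - Real.cos (k * Real.pi / ((N + 2 : ℕ) : ℝ))| ≤ Y) :
    ‖∑ j ∈ Finset.Icc 1 N, (a j : ℂ) * Complex.exp (τ * Complex.I) ^ j‖ ^ 2 ≤
      (X ^ 2 + Y ^ 2) / 4 := by
  rw [norm_sq_sum_exp_eq (by omega) a hns]
  obtain ⟨m1, m2⟩ := sum_filter_nodeWeight hN a h1
  have b1 : |Real.cos ((N + 2 : ℕ) * τ / 2) * oddNodeSum N (N + 2) a (Real.cos τ)| ≤ 1 / 2 * X := by
    refine abs_sum_weight_le (fun k hk => ?_) m1 fun k hk _ => ?_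
    · rw [Finset.mem_filter, Finset.mem_range] at hk
      exact nodeWeight_nonneg ha hk.1
    · rw [Finset.mem_filter, Finset.mem_range] at hk
      exact hodd k hk.2 hk.1
  have b2 : |Real.sin ((N + 2 : ℕ) * τ / 2) * evenNodeSum N (N + 2) a (Real.cos τ)| ≤
      1 / 2 * Y := by
    refine abs_sum_weight_le (fun k hk => ?_) m2 fun k hk hw => ?_
    · rw [Finset.mem_filter, Finset.mem_range] at hk
      exact nodeWeight_nonneg ha hk.1
    · rw [Finset.mem_filter, Finset.mem_range] at hk
      have he := Nat.not_odd_iff_even.mp hk.2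
      -- The node 0 carries no weight, so the smallest even node that counts is 2.
      have hk0 : k ≠ 0 := by rintro rfl; exact hw (nodeWeight_zero _ _ _)
      exact heven k he (by obtain ⟨m, rfl⟩ := he; omega) hk.1
  have s1 := sq_le_sq' (abs_le.mp b1).1 (abs_le.mp b1).2
  have s2 := sq_le_sq' (abs_le.mp b2).1 (abs_le.mp b2).2
  linarith

theorem node_bounds {k : ℕ} (hk0 : 1 ≤ k) (hk : k < N + 2) :
    Real.pi / ((N + 2 : ℕ) : ℝ) ≤ k * Real.pi / ((N + 2 : ℕ) : ℝ) ∧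
      k * Real.pi / ((N + 2 : ℕ) : ℝ) ≤ Real.pi - Real.pi / ((N + 2 : ℕ) : ℝ) := by
  have hpi := Real.pi_pos
  have hk0' : (1 : ℝ) ≤ k := by exact_mod_cast hk0
  have hk' : (k : ℝ) + 1 ≤ ((N + 2 : ℕ) : ℝ) := by exact_mod_cast hk
  have hL : (0 : ℝ) < ((N + 2 : ℕ) : ℝ) := by positivity
  constructor
  · gcongr; nlinarith
  · rw [le_sub_iff_add_le, ← add_div, div_le_iff₀ hL]; nlinarith

theorem odd_kernel_le {k : ℕ} (hodd : Odd k) {τ ρ ξ q : ℝ}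
    (hρ0 : 0 < ρ) (h1 : ρ ≤ (τ + k * Real.pi / ((N + 2 : ℕ) : ℝ)) / 2)
    (h2 : (τ + k * Real.pi / ((N + 2 : ℕ) : ℝ)) / 2 ≤ Real.pi - ρ)
    (hne : Real.cos τ ≠ Real.cos (k * Real.pi / ((N + 2 : ℕ) : ℝ))) (hq : 0 < q)
    (hξ : ((N + 2 : ℕ) : ℝ) * q ≤ ξ * (2 * Real.sin ρ)) :
    |Real.cos ((N + 2 : ℕ) * τ / 2)| /
      |Real.cos τ - Real.cos (k * Real.pi / ((N + 2 : ℕ) : ℝ))| ≤ ξ / q := by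
  have hs : Real.sin ρ ≤ Real.sin ((τ + k * Real.pi / ((N + 2 : ℕ) : ℝ)) / 2) :=
    sin_le_sin_of_le_of_le_pi_sub hρ0.le h1 h2
  have hρ : 0 < Real.sin ρ := Real.sin_pos_of_pos_of_lt_pi hρ0 (by linarith)
  rw [abs_cos_half_eq_of_odd (by omega) hodd]
  refine (abs_sin_mul_half_le (N + 2) τ _ (hρ.trans_le hs) hne).trans ?_
  calc ((N + 2 : ℕ) : ℝ) / (2 * Real.sin ((τ + k * Real.pi / ((N + 2 : ℕ) : ℝ)) / 2))
      ≤ ((N + 2 : ℕ) : ℝ) / (2 * Real.sin ρ) := by gcongr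
    _ ≤ ξ / q := by rw [div_le_div_iff₀ (by positivity) hq]; exact hξ

theorem even_kernel_le {k : ℕ} (heven : Even k) {τ ρ ξ q : ℝ}
    (hρ0 : 0 < ρ) (h1 : ρ ≤ (τ + k * Real.pi / ((N + 2 : ℕ) : ℝ)) / 2)
    (h2 : (τ + k * Real.pi / ((N + 2 : ℕ) : ℝ)) / 2 ≤ Real.pi - ρ)
    (hne : Real.cos τ ≠ Real.cos (k * Real.pi / ((N + 2 : ℕ) : ℝ))) (hq : 0 < q)
    (hξ : ((N + 2 : ℕ) : ℝ) * q ≤ ξ * (2 * Real.sin ρ)) :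
    |Real.sin ((N + 2 : ℕ) * τ / 2)| /
      |Real.cos τ - Real.cos (k * Real.pi / ((N + 2 : ℕ) : ℝ))| ≤ ξ / q := by
  have hs : Real.sin ρ ≤ Real.sin ((τ + k * Real.pi / ((N + 2 : ℕ) : ℝ)) / 2) :=
    sin_le_sin_of_le_of_le_pi_sub hρ0.le h1 h2
  have hρ : 0 < Real.sin ρ := Real.sin_pos_of_pos_of_lt_pi hρ0 (by linarith)
  rw [abs_sin_half_eq_of_even (by omega) heven]
  refine (abs_sin_mul_half_le (N + 2) τ _ (hρ.trans_le hs) hne).trans ?_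
  calc ((N + 2 : ℕ) : ℝ) / (2 * Real.sin ((τ + k * Real.pi / ((N + 2 : ℕ) : ℝ)) / 2))
      ≤ ((N + 2 : ℕ) : ℝ) / (2 * Real.sin ρ) := by gcongr
    _ ≤ ξ / q := by rw [div_le_div_iff₀ (by positivity) hq]; exact hξ

theorem finite_singular (N : ℕ) : {τ : ℝ | τ ∈ Set.Icc (0 : ℝ) Real.pi ∧ ∃ k : ℕ, 1 ≤ k ∧
    k < N + 2 ∧ Real.cos τ = Real.cos (k * Real.pi / ((N + 2 : ℕ) : ℝ))}.Finite := by
  refine ((Finset.range (N + 2)).finite_toSet.image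
    fun k : ℕ => k * Real.pi / ((N + 2 : ℕ) : ℝ)).subset ?_
  rintro τ ⟨hτ, k, -, hk, h⟩
  exact ⟨k, by simpa using hk, (Real.injOn_cos hτ (node_mem_Icc hk) h).symm⟩

theorem norm_sq_le_of_kernel_le_on (hN : 1 ≤ N) (h1 : a 1 = 1)
    (ha : ∀ t ∈ Set.Icc (0 : ℝ) Real.pi, 0 ≤ sineSum N a t) {α β X Y : ℝ} (hα : 0 ≤ α)
    (hαβ : α < β) (hβ : β ≤ Real.pi)
    (hodd : ∀ τ ∈ Set.Icc α β, ∀ k : ℕ, Odd k → k < N + 2 →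
      Real.cos τ ≠ Real.cos (k * Real.pi / ((N + 2 : ℕ) : ℝ)) →
      |Real.cos ((N + 2 : ℕ) * τ / 2)| /
      |Real.cos τ - Real.cos (k * Real.pi / ((N + 2 : ℕ) : ℝ))| ≤ X)
    (heven : ∀ τ ∈ Set.Icc α β, ∀ k : ℕ, Even k → 2 ≤ k → k < N + 2 →
      Real.cos τ ≠ Real.cos (k * Real.pi / ((N + 2 : ℕ) : ℝ)) →
      |Real.sin ((N + 2 : ℕ) * τ / 2)| /
      |Real.cos τ - Real.cos (k * Real.pi / ((N + 2 : ℕ) : ℝ))| ≤ Y) :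
    ∀ τ ∈ Set.Icc α β, ‖∑ j ∈ Finset.Icc 1 N, (a j : ℂ) * Complex.exp (τ * Complex.I) ^ j‖ ^ 2 ≤
      (X ^ 2 + Y ^ 2) / 4 := by
  refine le_of_le_off_finite (by fun_prop) hαβ (finite_singular N) fun τ hτ hs => ?_
  have hns : ∀ k : ℕ, 1 ≤ k → k < N + 2 →
      Real.cos τ ≠ Real.cos (k * Real.pi / ((N + 2 : ℕ) : ℝ)) := fun k hk0 hk h =>
    hs ⟨⟨hα.trans hτ.1, hτ.2.trans hβ⟩, k, hk0, hk, h⟩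
  exact norm_sq_le_of_kernel_le hN h1 ha hns
    (fun k ho hk => hodd τ hτ k ho hk (hns k ho.pos hk))
    (fun k he hk2 hk => heven τ hτ k he hk2 hk (hns k (by omega) hk))

theorem norm_sq_lt_middle (hN : 3 ≤ N) (h1 : a 1 = 1)
    (ha : ∀ t ∈ Set.Icc (0 : ℝ) Real.pi, 0 ≤ sineSum N a t) {J κ t : ℝ} (hJ : 0 < J)
    (ht : t = Real.pi / ((N + 2 : ℕ) : ℝ))
    (hκ : (1 / (2 * (1 - Real.cos t))) ^ 2 ≤ κ * J ^ 2) (hr : NumericRange t κ) :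
    ∀ τ ∈ Set.Icc t (5 / 4 * t),
      ‖∑ j ∈ Finset.Icc 1 N, (a j : ℂ) * Complex.exp (τ * Complex.I) ^ j‖ ^ 2 < J ^ 2 := by
  have hpi := Real.pi_pos
  have hL : (0 : ℝ) < ((N + 2 : ℕ) : ℝ) := by positivity
  have ht0 : 0 < t := by rw [ht]; positivity
  have ht5 : t ≤ Real.pi / 5 := by rcases hr with h | h <;> linarith [h.2]
  obtain ⟨ξ, η, hξ, hη, hsum, i1, i2⟩ := middle_inequality ht0 hr
  have hπt : Real.pi / t = ((N + 2 : ℕ) : ℝ) := by rw [ht]; field_simp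
  rw [hπt] at i1
  have hq : 0 < 1 - Real.cos t := by
    have := Real.cos_lt_cos_of_nonneg_of_le_pi le_rfl (by linarith : t ≤ Real.pi) ht0
    rw [Real.cos_zero] at this; linarith
  intro τ hτ
  have hb := norm_sq_le_of_kernel_le_on (N := N) (a := a) (by omega) h1 ha
    (X := ξ / (1 - Real.cos t)) (Y := η / (1 - Real.cos t)) ht0.le
    (by linarith : t < 5 / 4 * t) (by linarith)
    (fun τ hτ k hk hkN hne => by
      obtain ⟨n1, n2⟩ := node_bounds hk.pos hkN
      rw [← ht] at n1 n2
      exact odd_kernel_le hk ht0 (by linarith [hτ.1]) (by linarith [hτ.2]) hne hq i1)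
    (fun τ hτ k hk hk2 hkN hne => by
      have n1 : 2 * t ≤ k * Real.pi / ((N + 2 : ℕ) : ℝ) := by
        have : (2 : ℝ) ≤ k := by exact_mod_cast hk2
        rw [ht, mul_div_assoc]
        exact mul_le_mul_of_nonneg_right this (by positivity)
      have n2 := (node_mem_Icc hkN).2
      have c1 : Real.cos (k * Real.pi / ((N + 2 : ℕ) : ℝ)) ≤ Real.cos (2 * t) :=
        Real.cos_le_cos_of_nonneg_of_le_pi (by linarith) n2 n1
      have c2 : Real.cos (5 / 4 * t) ≤ Real.cos τ :=
        Real.cos_le_cos_of_nonneg_of_le_pi (by linarith [hτ.1]) (by linarith) hτ.2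
      have c3 : Real.cos (2 * t) < Real.cos (5 / 4 * t) :=
        Real.cos_lt_cos_of_nonneg_of_le_pi (by linarith) (by linarith) (by linarith)
      rw [abs_of_pos (by linarith : 0 < Real.cos τ -
        Real.cos (k * Real.pi / ((N + 2 : ℕ) : ℝ))), div_le_div_iff₀ (by linarith) hq]
      have s1 := Real.abs_sin_le_one ((N + 2 : ℕ) * τ / 2)
      calc |Real.sin ((N + 2 : ℕ) * τ / 2)| * (1 - Real.cos t) ≤ 1 * (1 - Real.cos t) :=
            mul_le_mul_of_nonneg_right s1 hq.le
        _ ≤ η * (Real.cos (5 / 4 * t) - Real.cos (2 * t)) := by linarith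
        _ ≤ _ := mul_le_mul_of_nonneg_left (by linarith) hη)
    τ hτ
  refine hb.trans_lt ?_
  have e : ((ξ / (1 - Real.cos t)) ^ 2 + (η / (1 - Real.cos t)) ^ 2) / 4 =
      (ξ ^ 2 + η ^ 2) * (1 / (2 * (1 - Real.cos t))) ^ 2 := by field_simp; ring
  rw [e]
  calc _ ≤ (ξ ^ 2 + η ^ 2) * (κ * J ^ 2) := mul_le_mul_of_nonneg_left hκ (by positivity)
    _ = κ * (ξ ^ 2 + η ^ 2) * J ^ 2 := by ring
    _ < 1 * J ^ 2 := mul_lt_mul_of_pos_right hsum (by positivity)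
    _ = J ^ 2 := one_mul _

theorem norm_sq_lt_far (hN : 3 ≤ N) (h1 : a 1 = 1)
    (ha : ∀ t ∈ Set.Icc (0 : ℝ) Real.pi, 0 ≤ sineSum N a t) {J κ t : ℝ} (hJ : 0 < J)
    (ht : t = Real.pi / ((N + 2 : ℕ) : ℝ))
    (hκ : (1 / (2 * (1 - Real.cos t))) ^ 2 ≤ κ * J ^ 2) (hr : NumericRange t κ) :
    ∀ τ ∈ Set.Icc (5 / 4 * t) (Real.pi / 2),
      ‖∑ j ∈ Finset.Icc 1 N, (a j : ℂ) * Complex.exp (τ * Complex.I) ^ j‖ ^ 2 < J ^ 2 := by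
  have hpi := Real.pi_pos
  have hL : (0 : ℝ) < ((N + 2 : ℕ) : ℝ) := by positivity
  have ht0 : 0 < t := by rw [ht]; positivity
  have ht5 : t ≤ Real.pi / 5 := by rcases hr with h | h <;> linarith [h.2]
  obtain ⟨ξ, η, hξ, hη, hsum, i1, i2⟩ := far_inequality ht0 hr
  have hπt : Real.pi / t = ((N + 2 : ℕ) : ℝ) := by rw [ht]; field_simp
  rw [hπt] at i1 i2
  have hq : 0 < 1 - Real.cos t := by
    have := Real.cos_lt_cos_of_nonneg_of_le_pi le_rfl (by linarith : t ≤ Real.pi) ht0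
    rw [Real.cos_zero] at this; linarith
  intro τ hτ
  have hb := norm_sq_le_of_kernel_le_on (N := N) (a := a) (by omega) h1 ha
    (X := ξ / (1 - Real.cos t)) (Y := η / (1 - Real.cos t)) (by linarith : 0 ≤ 5 / 4 * t)
    (by linarith : 5 / 4 * t < Real.pi / 2) (by linarith)
    (fun τ hτ k hk hkN hne => by
      obtain ⟨n1, n2⟩ := node_bounds hk.pos hkN
      rw [← ht] at n1 n2
      exact odd_kernel_le hk (by linarith : 0 < 9 / 8 * t) (by linarith [hτ.1])
        (by linarith [hτ.2]) hne hq i1)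
    (fun τ hτ k hk hk2 hkN hne => by
      obtain ⟨-, n2⟩ := node_bounds (by omega : 1 ≤ k) hkN
      rw [← ht] at n2
      have n1 : 2 * t ≤ k * Real.pi / ((N + 2 : ℕ) : ℝ) := by
        have : (2 : ℝ) ≤ k := by exact_mod_cast hk2
        rw [ht, mul_div_assoc]
        exact mul_le_mul_of_nonneg_right this (by positivity)
      exact even_kernel_le hk (by linarith : 0 < 13 / 8 * t) (by linarith [hτ.1])
        (by linarith [hτ.2]) hne hq i2)
    τ hτ
  refine hb.trans_lt ?_
  have e : ((ξ / (1 - Real.cos t)) ^ 2 + (η / (1 - Real.cos t)) ^ 2) / 4 =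
      (ξ ^ 2 + η ^ 2) * (1 / (2 * (1 - Real.cos t))) ^ 2 := by field_simp; ring
  rw [e]
  calc _ ≤ (ξ ^ 2 + η ^ 2) * (κ * J ^ 2) := mul_le_mul_of_nonneg_left hκ (by positivity)
    _ = κ * (ξ ^ 2 + η ^ 2) * J ^ 2 := by ring
    _ < 1 * J ^ 2 := mul_lt_mul_of_pos_right hsum (by positivity)
    _ = J ^ 2 := one_mul _

/-- For d ≤ c the quotient (1 - d)/(x - d) is largest at d = c, so termwise comparison with the sum
at x = 1 costs only the factor of the nearest node, and that sum is F(1). -/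
theorem oddNodeSum_nonneg_and_le (ha : ∀ t ∈ Set.Icc (0 : ℝ) Real.pi, 0 ≤ sineSum N a t)
    {x c : ℝ} (hxc : c < x) (hx1 : x ≤ 1)
    (hc : ∀ k : ℕ, Odd k → k < N + 2 → Real.cos (k * Real.pi / ((N + 2 : ℕ) : ℝ)) ≤ c) :
    0 ≤ oddNodeSum N (N + 2) a x ∧
      oddNodeSum N (N + 2) a x ≤ (1 - c) / (x - c) * ∑ j ∈ Finset.Icc 1 N, a j := by
  rw [← oddNodeSum_one, oddNodeSum, oddNodeSum, Finset.mul_sum]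
  constructor
  · refine Finset.sum_nonneg fun k hk => ?_
    rw [Finset.mem_filter, Finset.mem_range] at hk
    exact div_nonneg (nodeWeight_nonneg ha hk.1) (by linarith [hc k hk.2 hk.1])
  · refine Finset.sum_le_sum fun k hk => ?_
    rw [Finset.mem_filter, Finset.mem_range] at hk
    have hk1 := hc k hk.2 hk.1
    have hw := nodeWeight_nonneg ha hk.1
    set d := Real.cos (k * Real.pi / ((N + 2 : ℕ) : ℝ))
    rw [div_mul_div_comm, div_le_div_iff₀ (by linarith) (mul_pos (by linarith) (by linarith))]
    have : (x - c) * (1 - d) ≤ (1 - c) * (x - d) := by nlinarith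
    nlinarith [mul_le_mul_of_nonneg_left this hw]

/-- From |sin(Lτ/2)| ≤ L|sin(τ/2)| and L²(1 - cos t) ≤ π²/2 the constant π²/4 appears, rounded up to
2.4675. -/
theorem sin_sq_half_le {L : ℕ} {τ t w : ℝ} (hL : 1 ≤ L) (ht : t = Real.pi / (L : ℝ))
    (hw : 1 - Real.cos τ = (1 - Real.cos t) * w) (hw0 : 0 ≤ w) :
    Real.sin (L * τ / 2) ^ 2 ≤ 2.4675 * w := by
  have hL' : (0 : ℝ) < L := by exact_mod_cast hL
  have g1 : Real.sin (L * τ / 2) ^ 2 ≤ ((L : ℝ) * |Real.sin (τ / 2)|) ^ 2 := by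
    rw [← sq_abs, mul_div_assoc]
    exact pow_le_pow_left₀ (abs_nonneg _) (abs_sin_nat_mul_le L (τ / 2)) 2
  rw [mul_pow, sq_abs] at g1
  have g2 : 2 * Real.sin (τ / 2) ^ 2 = (1 - Real.cos t) * w := by
    rw [← hw]
    have h2 := Real.cos_two_mul (τ / 2)
    rw [show 2 * (τ / 2) = τ by ring] at h2
    have := Real.sin_sq_add_cos_sq (τ / 2)
    linarith
  have g3 : 1 - Real.cos t ≤ t ^ 2 / 2 := by
    have := Real.one_sub_sq_div_two_le_cos (x := t)
    linarith
  have g4 : (L : ℝ) ^ 2 * (1 - Real.cos t) ≤ Real.pi ^ 2 / 2 := by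
    calc (L : ℝ) ^ 2 * (1 - Real.cos t) ≤ (L : ℝ) ^ 2 * (t ^ 2 / 2) :=
          mul_le_mul_of_nonneg_left g3 (by positivity)
      _ = Real.pi ^ 2 / 2 := by rw [ht]; field_simp
  have g5 : Real.pi ^ 2 ≤ 9.87 := by
    have := Real.pi_lt_d4
    have := Real.pi_pos
    nlinarith
  calc Real.sin (L * τ / 2) ^ 2 ≤ (L : ℝ) ^ 2 * Real.sin (τ / 2) ^ 2 := g1
    _ = (L : ℝ) ^ 2 * (1 - Real.cos t) * w / 2 := by linear_combination (L : ℝ) ^ 2 / 2 * g2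
    _ ≤ (Real.pi ^ 2 / 2) * w / 2 := by
        have := mul_le_mul_of_nonneg_right g4 hw0
        linarith
    _ ≤ 2.4675 * w := by
        have := mul_le_mul_of_nonneg_right g5 hw0
        linarith

-- Near z = 1 the weight bound for the odd nodes is too weak; F(1) ≤ J is used instead, and
-- `cos_half_mul_le` turns it into the factor 1 - w/s² < 1. This gain pays for the even nodes, whose
-- distance from cos τ is at least that of the node 2t.
set_option maxHeartbeats 800000 in
theorem norm_sq_lt_near (hN : 3 ≤ N) (h1 : a 1 = 1)
    (ha : ∀ t ∈ Set.Icc (0 : ℝ) Real.pi, 0 ≤ sineSum N a t) {J κ t : ℝ} (hJ : 0 < J)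
    (hF : ∑ j ∈ Finset.Icc 1 N, a j ≤ J) (ht : t = Real.pi / ((N + 2 : ℕ) : ℝ))
    (hκ : (1 / (2 * (1 - Real.cos t))) ^ 2 ≤ κ * J ^ 2) (hr : NumericRange t κ) :
    ∀ τ ∈ Set.Ioo 0 t,
      ‖∑ j ∈ Finset.Icc 1 N, (a j : ℂ) * Complex.exp (τ * Complex.I) ^ j‖ ^ 2 < J ^ 2 := by
  rintro τ ⟨hτ0, hτt⟩
  have hpi := Real.pi_pos
  have hL : (0 : ℝ) < ((N + 2 : ℕ) : ℝ) := by positivity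
  have ht0 : 0 < t := hτ0.trans hτt
  have ht5 : t ≤ Real.pi / 5 := by rcases hr with h | h <;> linarith [h.2]
  have hκ' : κ ≤ 9 / 8 := by rcases hr with h | h <;> linarith [h.1]
  set c := Real.cos t with hcdef
  have hc1 : c < 1 := by
    have := Real.cos_lt_cos_of_nonneg_of_le_pi le_rfl (by linarith : t ≤ Real.pi) ht0
    rwa [Real.cos_zero] at this
  have hc0 : 0.809 ≤ c := by
    have h5 : Real.cos (Real.pi / 5) ≤ c :=
      Real.cos_le_cos_of_nonneg_of_le_pi ht0.le (by linarith) ht5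
    rw [Real.cos_pi_div_five] at h5
    have : (2.236 : ℝ) ≤ Real.sqrt 5 := Real.le_sqrt_of_sq_le (by norm_num)
    linarith
  set q := 1 - c with hq
  have hq0 : 0 < q := by linarith
  set x := Real.cos τ with hx
  have hxc : c < x := Real.cos_lt_cos_of_nonneg_of_le_pi hτ0.le (by linarith) hτt
  have hx1 : x < 1 := by
    have := Real.cos_lt_cos_of_nonneg_of_le_pi le_rfl (by linarith : τ ≤ Real.pi) hτ0
    rwa [Real.cos_zero] at this
  have hnode : ∀ k : ℕ, 1 ≤ k → k < N + 2 → Real.cos (k * Real.pi / ((N + 2 : ℕ) : ℝ)) ≤ c := by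
    intro k hk0 hk
    obtain ⟨n1, n2⟩ := node_bounds hk0 hk
    rw [← ht] at n1 n2
    exact Real.cos_le_cos_of_nonneg_of_le_pi ht0.le (by linarith) n1
  have hns : ∀ k : ℕ, 1 ≤ k → k < N + 2 → x ≠ Real.cos (k * Real.pi / ((N + 2 : ℕ) : ℝ)) :=
    fun k hk0 hk => ((hnode k hk0 hk).trans_lt hxc).ne'
  rw [norm_sq_sum_exp_eq (by omega) a hns]
  set s := 1 + 2 * c with hs
  set w := (1 - x) / q with hw
  have hqw : q * w = 1 - x := by rw [hw]; field_simp
  have hw0 : 0 < w := div_pos (by linarith) hq0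
  have hw1 : w ≤ 1 := by rw [hw, div_le_one hq0]; linarith
  have hc2 : Real.cos (2 * t) = 1 - q * (1 + s) := by
    rw [Real.cos_two_mul, ← hcdef, hs, hq]; ring
  have hc3 : Real.cos (3 * t) = 1 - q * s ^ 2 := by
    rw [Real.cos_three_mul, ← hcdef, hs, hq]; ring
  have hs0 : 0 < s := by linarith
  have hds : 0 < 1 + s - w := by linarith
  -- the odd nodes
  have hθ0 : 0 ≤ Real.cos ((N + 2 : ℕ) * τ / 2) := by
    have : ((N + 2 : ℕ) : ℝ) * τ ≤ Real.pi := by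
      rw [ht, lt_div_iff₀ hL] at hτt; linarith
    exact Real.cos_nonneg_of_mem_Icc ⟨by linarith [mul_pos hL hτ0], by linarith⟩
  obtain ⟨o1, o2⟩ := oddNodeSum_nonneg_and_le (N := N) ha hxc hx1.le
    fun k hk hkN => hnode k hk.pos hkN
  have hprod := cos_half_mul_le (L := N + 2) (by omega) hτ0.le (by rw [← ht]; exact hτt.le)
  rw [← ht, hc3, ← hcdef, ← hx] at hprod
  have hxcq : x - c = q * (1 - w) := by linear_combination hqw - hq
  have hx3 : x - (1 - q * s ^ 2) = q * (s ^ 2 - w) := by linear_combination hqw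
  have hbound : Real.cos ((N + 2 : ℕ) * τ / 2) * ((1 - c) / (x - c)) ≤ 1 - w / s ^ 2 := by
    have hxc0 : 0 < x - c := by linarith
    rw [← mul_div_assoc, div_le_iff₀ hxc0]
    have h3 : q * s ^ 2 * (Real.cos ((N + 2 : ℕ) * τ / 2) * (1 - c)) ≤
        q * s ^ 2 * ((1 - w / s ^ 2) * (x - c)) := by
      have e : q * s ^ 2 * ((1 - w / s ^ 2) * (x - c)) = (x - c) * (x - (1 - q * s ^ 2)) := by
        rw [hx3]; field_simp
      rw [e]; linarith
    exact le_of_mul_le_mul_left h3 (by positivity)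
  have hodd : |Real.cos ((N + 2 : ℕ) * τ / 2) * oddNodeSum N (N + 2) a x| ≤
      J * (1 - w / s ^ 2) := by
    rw [abs_of_nonneg (mul_nonneg hθ0 o1)]
    have hr0 : 0 ≤ (1 - c) / (x - c) := div_nonneg (by linarith) (by linarith)
    calc Real.cos ((N + 2 : ℕ) * τ / 2) * oddNodeSum N (N + 2) a x
        ≤ Real.cos ((N + 2 : ℕ) * τ / 2) * ((1 - c) / (x - c) * J) :=
          mul_le_mul_of_nonneg_left (o2.trans (mul_le_mul_of_nonneg_left hF hr0)) hθ0
      _ = Real.cos ((N + 2 : ℕ) * τ / 2) * ((1 - c) / (x - c)) * J := by ring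
      _ ≤ (1 - w / s ^ 2) * J := mul_le_mul_of_nonneg_right hbound hJ.le
      _ = _ := by ring
  -- the even nodes
  obtain ⟨-, m2⟩ := sum_filter_nodeWeight (by omega : 1 ≤ N) a h1
  have hx2 : x - Real.cos (2 * t) = q * (1 + s - w) := by rw [hc2]; linear_combination hqw
  have heven : |Real.sin ((N + 2 : ℕ) * τ / 2) * evenNodeSum N (N + 2) a x| ≤
      1 / 2 * (|Real.sin ((N + 2 : ℕ) * τ / 2)| / (q * (1 + s - w))) := by
    refine abs_sum_weight_le (fun k hk => ?_) m2 fun k hk hwk => ?_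
    · rw [Finset.mem_filter, Finset.mem_range] at hk
      exact nodeWeight_nonneg ha hk.1
    · rw [Finset.mem_filter, Finset.mem_range] at hk
      have he := Nat.not_odd_iff_even.mp hk.2
      have hk0 : k ≠ 0 := by rintro rfl; exact hwk (nodeWeight_zero _ _ _)
      have hk2 : 2 ≤ k := by obtain ⟨m, rfl⟩ := he; omega
      have n1 : 2 * t ≤ k * Real.pi / ((N + 2 : ℕ) : ℝ) := by
        have : (2 : ℝ) ≤ k := by exact_mod_cast hk2
        rw [ht, mul_div_assoc]
        exact mul_le_mul_of_nonneg_right this (by positivity)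
      have c1 : Real.cos (k * Real.pi / ((N + 2 : ℕ) : ℝ)) ≤ Real.cos (2 * t) :=
        Real.cos_le_cos_of_nonneg_of_le_pi (by linarith) (node_mem_Icc hk.1).2 n1
      have hpos : 0 < q * (1 + s - w) := by positivity
      rw [abs_of_pos (by linarith : 0 < x - Real.cos (k * Real.pi / ((N + 2 : ℕ) : ℝ)))]
      exact div_le_div_of_nonneg_left (abs_nonneg _) hpos (by linarith)
  set σ := Real.sin ((N + 2 : ℕ) * τ / 2) ^ 2 with hσ
  have hσ1 : σ ≤ 1 := Real.sin_sq_le_one _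
  have hσw : σ ≤ 2.4675 * w := by
    refine sin_sq_half_le (t := t) (by omega) ht ?_ hw0.le
    rw [← hx, ← hqw, hq]
  have hnum := near_inequality (s := s) (w := w) (σ := σ) (by linarith) (by linarith) hw0 hw1
    hσ1 hσw
  have s1 := sq_le_sq' (abs_le.mp hodd).1 (abs_le.mp hodd).2
  have s2 := sq_le_sq' (abs_le.mp heven).1 (abs_le.mp heven).2
  have s3 : (1 / 2 * (|Real.sin ((N + 2 : ℕ) * τ / 2)| / (q * (1 + s - w)))) ^ 2 ≤
      J ^ 2 * (9 / 8 * (σ / (1 + s - w) ^ 2)) := by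
    have e : (1 / 2 * (|Real.sin ((N + 2 : ℕ) * τ / 2)| / (q * (1 + s - w)))) ^ 2 =
        (1 / (2 * q)) ^ 2 * (σ / (1 + s - w) ^ 2) := by
      rw [hσ, ← sq_abs (Real.sin _)]; field_simp
    rw [e]
    have hσ0 : 0 ≤ σ / (1 + s - w) ^ 2 := by positivity
    calc _ ≤ κ * J ^ 2 * (σ / (1 + s - w) ^ 2) := mul_le_mul_of_nonneg_right hκ hσ0
      _ ≤ 9 / 8 * J ^ 2 * (σ / (1 + s - w) ^ 2) := by gcongr
      _ = _ := by ring
  have hJ2 : 0 < J ^ 2 := by positivity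
  have := mul_lt_mul_of_pos_left hnum hJ2
  calc _ ≤ (J * (1 - w / s ^ 2)) ^ 2 + J ^ 2 * (9 / 8 * (σ / (1 + s - w) ^ 2)) :=
        add_le_add s1 (s2.trans s3)
    _ = J ^ 2 * ((1 - w / s ^ 2) ^ 2 + 9 / 8 * (σ / (1 + s - w) ^ 2)) := by ring
    _ < J ^ 2 := by linarith

/-- Away from `z = 1`, in the right half of the upper unit semicircle, `|F|` stays below `J`. -/
theorem norm_sum_exp_lt (hN : 3 ≤ N) (h1 : a 1 = 1)
    (ha : ∀ t ∈ Set.Icc (0 : ℝ) Real.pi, 0 ≤ sineSum N a t) {J κ t : ℝ} (hJ : 0 < J)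
    (hF : ∑ j ∈ Finset.Icc 1 N, a j ≤ J) (ht : t = Real.pi / ((N + 2 : ℕ) : ℝ))
    (hκ : (1 / (2 * (1 - Real.cos t))) ^ 2 ≤ κ * J ^ 2) (hr : NumericRange t κ) {τ : ℝ}
    (hτ0 : 0 < τ) (hτ : τ ≤ Real.pi / 2) :
    ‖∑ j ∈ Finset.Icc 1 N, (a j : ℂ) * Complex.exp (τ * Complex.I) ^ j‖ < J := by
  refine lt_of_pow_lt_pow_left₀ 2 hJ.le ?_
  rcases lt_or_ge τ t with h | h
  · exact norm_sq_lt_near hN h1 ha hJ hF ht hκ hr τ ⟨hτ0, h⟩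
  · rcases le_total τ (5 / 4 * t) with h' | h'
    · exact norm_sq_lt_middle hN h1 ha hJ ht hκ hr τ ⟨h, h'⟩
    · exact norm_sq_lt_far hN h1 ha hJ ht hκ hr τ ⟨h', hτ⟩

end CircleBound

/-! ### Symmetries and the whole circle -/

/-- The coefficients of `-F(-z)`. -/
def altSign (a : ℕ → ℝ) (j : ℕ) : ℝ := (-1) ^ (j + 1) * a j

theorem sineSum_altSign (N : ℕ) (a : ℕ → ℝ) (t : ℝ) :
    sineSum N (altSign a) t = sineSum N a (Real.pi - t) := by
  refine Finset.sum_congr rfl fun j _ => ?_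
  rw [mul_sub, Real.sin_nat_mul_pi_sub, altSign, pow_succ]
  ring

theorem sineSum_altSign_nonneg {N : ℕ} {a : ℕ → ℝ}
    (ha : ∀ t ∈ Set.Icc (0 : ℝ) Real.pi, 0 ≤ sineSum N a t) :
    ∀ t ∈ Set.Icc (0 : ℝ) Real.pi, 0 ≤ sineSum N (altSign a) t := by
  intro t ht
  rw [sineSum_altSign]
  exact ha _ ⟨by linarith [ht.2], by linarith [ht.1]⟩

theorem sum_altSign_mul_neg_pow (N : ℕ) (a : ℕ → ℝ) (w : ℂ) :
    ∑ j ∈ Finset.Icc 1 N, (altSign a j : ℂ) * (-w) ^ j =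
      -∑ j ∈ Finset.Icc 1 N, (a j : ℂ) * w ^ j := by
  rw [← Finset.sum_neg_distrib]
  refine Finset.sum_congr rfl fun j _ => ?_
  rw [altSign, neg_pow w]
  push_cast
  have : ((-1 : ℂ) ^ j) * (-1) ^ j = 1 := by rw [← mul_pow]; simp
  linear_combination (-(a j : ℂ) * w ^ j) * this

theorem sum_mul_conj_pow (N : ℕ) (a : ℕ → ℝ) (w : ℂ) :
    ∑ j ∈ Finset.Icc 1 N, (a j : ℂ) * (starRingEnd ℂ w) ^ j =
      starRingEnd ℂ (∑ j ∈ Finset.Icc 1 N, (a j : ℂ) * w ^ j) := by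
  rw [map_sum]
  exact Finset.sum_congr rfl fun j _ => by simp

/-- The comparison of `J` with `1 / (2 (1 - cos (π / (N + 2))))` that confines the maximum of `|F|`
to `±1` when `N ≥ 3`. -/
def ConfinesMaximum (N : ℕ) (J : ℝ) : Prop :=
  3 ≤ N → ∃ κ : ℝ, (1 / (2 * (1 - Real.cos (Real.pi / ((N + 2 : ℕ) : ℝ))))) ^ 2 ≤ κ * J ^ 2 ∧
    NumericRange (Real.pi / ((N + 2 : ℕ) : ℝ)) κ

section Circle

variable {N : ℕ} {J : ℝ} {a : ℕ → ℝ}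

theorem sum_nonneg_of_sineSum_nonneg (ha : ∀ t ∈ Set.Icc (0 : ℝ) Real.pi, 0 ≤ sineSum N a t) :
    0 ≤ ∑ j ∈ Finset.Icc 1 N, a j := by
  rw [← oddNodeSum_one, oddNodeSum]
  refine Finset.sum_nonneg fun k hk => ?_
  rw [Finset.mem_filter, Finset.mem_range] at hk
  exact div_nonneg (nodeWeight_nonneg ha hk.1) (by linarith [Real.cos_le_one (k * Real.pi /
    ((N + 2 : ℕ) : ℝ))])

theorem norm_sum_le_of_re_nonneg_of_im_nonneg (hN : 3 ≤ N) (hJ : 0 < J) (h1 : a 1 = 1)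
    (ha : ∀ t ∈ Set.Icc (0 : ℝ) Real.pi, 0 ≤ sineSum N a t)
    (hs : ∑ j ∈ Finset.Icc 1 N, a j ≤ J) (hb : ConfinesMaximum N J)
    {w : ℂ} (hw : ‖w‖ = 1) (hre : 0 ≤ w.re) (him : 0 ≤ w.im) :
    ‖∑ j ∈ Finset.Icc 1 N, (a j : ℂ) * w ^ j‖ ≤ J ∧
      (‖∑ j ∈ Finset.Icc 1 N, (a j : ℂ) * w ^ j‖ = J → ∑ j ∈ Finset.Icc 1 N, a j = J) := by
  obtain ⟨κ, hκ, hr⟩ := hb hN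
  have hexp : Complex.exp (w.arg * Complex.I) = w := by
    have := Complex.norm_mul_exp_arg_mul_I w
    rwa [hw, Complex.ofReal_one, one_mul] at this
  have harg0 : 0 ≤ w.arg := Complex.arg_nonneg_iff.mpr him
  have harg1 : w.arg ≤ Real.pi / 2 :=
    (abs_le.mp (Complex.abs_arg_le_pi_div_two_iff.mpr hre)).2
  rcases harg0.eq_or_lt with h | h
  · have hw1 : w = 1 := by rw [← hexp, ← h]; simp
    have e : ‖∑ j ∈ Finset.Icc 1 N, (a j : ℂ) * w ^ j‖ = ∑ j ∈ Finset.Icc 1 N, a j := by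
      rw [hw1]
      simp only [one_pow, mul_one]
      rw [← Complex.ofReal_sum, Complex.norm_real, Real.norm_eq_abs,
        abs_of_nonneg (sum_nonneg_of_sineSum_nonneg ha)]
    rw [e]
    exact ⟨hs, id⟩
  · have := norm_sum_exp_lt hN h1 ha hJ hs rfl hκ hr h harg1
    rw [hexp] at this
    exact ⟨this.le, fun h => absurd h this.ne⟩

/-- Here |F| ≤ 1 + |a_2| on the circle, and 1 + |a_2| is F(1) or -F(-1) according to the sign of
a_2. -/
theorem norm_sum_le_of_degree_le_two (hN : N ≤ 2) (hN1 : 1 ≤ N) (h1 : a 1 = 1)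
    (hs : ∑ j ∈ Finset.Icc 1 N, a j ≤ J) (hs' : ∑ j ∈ Finset.Icc 1 N, altSign a j ≤ J)
    {w : ℂ} (hw : ‖w‖ = 1) :
    ‖∑ j ∈ Finset.Icc 1 N, (a j : ℂ) * w ^ j‖ ≤ J ∧
      (‖∑ j ∈ Finset.Icc 1 N, (a j : ℂ) * w ^ j‖ = J →
        ∑ j ∈ Finset.Icc 1 N, a j = J ∨ ∑ j ∈ Finset.Icc 1 N, altSign a j = J) := by
  interval_cases N
  · simp only [Finset.Icc_self, Finset.sum_singleton, h1, pow_one, Complex.ofReal_one, one_mul, hw]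
      at hs ⊢
    exact ⟨hs, fun h => Or.inl h⟩
  · have e : Finset.Icc 1 2 = {1, 2} := by decide
    rw [e] at hs hs' ⊢
    simp only [Finset.sum_pair (show (1 : ℕ) ≠ 2 by decide), h1, altSign] at hs hs' ⊢
    norm_num at hs hs' ⊢
    have hn : ‖w + (a 2 : ℂ) * w ^ 2‖ ≤ 1 + |a 2| := by
      refine (norm_add_le _ _).trans ?_
      rw [norm_mul, norm_pow, hw, Complex.norm_real, Real.norm_eq_abs]; simp
    rcases abs_cases (a 2) with ⟨h, -⟩ | ⟨h, -⟩ <;> rw [h] at hn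
    · exact ⟨hn.trans hs, fun h => Or.inl (by linarith)⟩
    · exact ⟨hn.trans (by linarith), fun h => Or.inr (by linarith)⟩

/-- On the unit circle `|F|` is at most `J`, and equality forces `F(1) = J` or `-F(-1) = J`. -/
theorem norm_sum_pow_le_and_eq (hN : 1 ≤ N) (hJ : 0 < J) (h1 : a 1 = 1)
    (ha : ∀ t ∈ Set.Icc (0 : ℝ) Real.pi, 0 ≤ sineSum N a t)
    (hs : ∑ j ∈ Finset.Icc 1 N, a j ≤ J) (hs' : ∑ j ∈ Finset.Icc 1 N, altSign a j ≤ J)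
    (hb : ConfinesMaximum N J) {w : ℂ} (hw : ‖w‖ = 1) :
    ‖∑ j ∈ Finset.Icc 1 N, (a j : ℂ) * w ^ j‖ ≤ J ∧
      (‖∑ j ∈ Finset.Icc 1 N, (a j : ℂ) * w ^ j‖ = J →
        ∑ j ∈ Finset.Icc 1 N, a j = J ∨ ∑ j ∈ Finset.Icc 1 N, altSign a j = J) := by
  rcases le_or_gt N 2 with hN2 | hN3
  · exact norm_sum_le_of_degree_le_two hN2 hN h1 hs hs' hw
  have hupper : ∀ w : ℂ, ‖w‖ = 1 → 0 ≤ w.im →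
      ‖∑ j ∈ Finset.Icc 1 N, (a j : ℂ) * w ^ j‖ ≤ J ∧
      (‖∑ j ∈ Finset.Icc 1 N, (a j : ℂ) * w ^ j‖ = J →
        ∑ j ∈ Finset.Icc 1 N, a j = J ∨ ∑ j ∈ Finset.Icc 1 N, altSign a j = J) := by
    intro w hw him
    rcases le_total 0 w.re with hre | hre
    · obtain ⟨i, j⟩ := norm_sum_le_of_re_nonneg_of_im_nonneg hN3 hJ h1 ha hs hb hw hre him
      exact ⟨i, fun h => Or.inl (j h)⟩
    -- The reflection w ↦ -conj w moves the left upper quadrant to the right one and replaces F(z)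
    -- by -F(-z).
    · have h1' : altSign a 1 = 1 := by simp [altSign, h1]
      obtain ⟨i, j⟩ := norm_sum_le_of_re_nonneg_of_im_nonneg hN3 hJ h1'
        (sineSum_altSign_nonneg ha) hs' hb (w := -starRingEnd ℂ w) (by simpa using hw)
        (by simpa using hre) (by simpa using him)
      rw [sum_altSign_mul_neg_pow, norm_neg, sum_mul_conj_pow, RCLike.norm_conj] at i j
      exact ⟨i, fun h => Or.inr (j h)⟩
  rcases le_total 0 w.im with him | him
  · exact hupper w hw him
  · have := hupper (starRingEnd ℂ w) (by simpa using hw) (by simpa using him)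
    rwa [sum_mul_conj_pow, RCLike.norm_conj] at this

end Circle

/-! ### Extremal polynomials -/

section Polynomials

theorem coeff_neg_comp_neg_X {R : Type*} [CommRing R] (P : R[X]) (j : ℕ) :
    (-(P.comp (-X))).coeff j = (-1) ^ (j + 1) * P.coeff j := by
  have h : (-X : R[X]) = C (-1) * X := by simp
  rw [coeff_neg, h, comp_C_mul_X_coeff, pow_succ]; ring

theorem neg_comp_neg_X_involutive {R : Type*} [CommRing R] (P : R[X]) :
    -((-(P.comp (-X))).comp (-X)) = P := by
  ext j
  rw [coeff_neg_comp_neg_X, coeff_neg_comp_neg_X, ← mul_assoc, ← mul_pow]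
  simp

theorem natDegree_neg_comp_neg_X {R : Type*} [CommRing R] (P : R[X]) :
    (-(P.comp (-X))).natDegree = P.natDegree := by
  rw [natDegree_neg]
  exact natDegree_eq_of_degree_eq degree_comp_neg_X

theorem map_neg_comp_neg_X (P : ℝ[X]) :
    (-(P.comp (-X))).map Complex.ofRealHom = -((P.map Complex.ofRealHom).comp (-X)) := by
  simp [Polynomial.map_comp]

theorem coeff_neg_comp_neg_X_eq_altSign (P : ℝ[X]) :
    (fun j => (-(P.comp (-X))).coeff j) = altSign P.coeff :=
  funext fun j => coeff_neg_comp_neg_X P j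

theorem neg_comp_neg_X_mem_auxAdmissible {N : ℕ} {P : ℝ[X]} (hP : P ∈ auxAdmissible N) :
    -(P.comp (-X)) ∈ auxAdmissible N := by
  obtain ⟨hd, h0, h1, hS⟩ := hP
  refine ⟨by rwa [natDegree_neg_comp_neg_X], by rw [coeff_neg_comp_neg_X, h0, mul_zero],
    by rw [coeff_neg_comp_neg_X, h1]; norm_num, ?_⟩
  have := sineSum_altSign_nonneg (a := P.coeff) hS
  rwa [← coeff_neg_comp_neg_X_eq_altSign] at this

/-- The polynomial with the normalized sine coefficients of `|∑ z_j e^{ijt}|² sin t`. -/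
noncomputable def corrPoly (N : ℕ) (z : ℤ → ℝ) : ℝ[X] :=
  ∑ k ∈ Finset.Icc 1 N, monomial k (corrCoeff N z k / corrCoeff N z 1)

theorem coeff_corrPoly (N : ℕ) (z : ℤ → ℝ) (k : ℕ) :
    (corrPoly N z).coeff k =
      if k ∈ Finset.Icc 1 N then corrCoeff N z k / corrCoeff N z 1 else 0 := by
  simp only [corrPoly, finsetSum_coeff, coeff_monomial]
  rw [Finset.sum_ite_eq' (Finset.Icc 1 N) k]

theorem trigSq_nonneg (N : ℕ) (v : ℤ → ℝ) (t : ℝ) : 0 ≤ trigSq N v t := by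
  unfold trigSq; positivity

variable {N : ℕ} {J : ℝ} {z : ℤ → ℝ}

theorem IsUnimodalGroundState.corrCoeff_pos (hz : IsUnimodalGroundState N J z) {k : ℕ}
    (hk1 : 1 ≤ k) (hkN : k ≤ N) : 0 < corrCoeff N z k :=
  _root_.corrCoeff_pos hz.supp hz.pos hz.symm hz.mono hk1 hkN

theorem IsUnimodalGroundState.coeff_corrPoly_pos (hN : 1 ≤ N) (hz : IsUnimodalGroundState N J z) :
    ∀ k ∈ Finset.Icc 1 N, 0 < (corrPoly N z).coeff k := by
  intro k hk
  rw [coeff_corrPoly, if_pos hk]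
  rw [Finset.mem_Icc] at hk
  exact div_pos (hz.corrCoeff_pos hk.1 hk.2) (hz.corrCoeff_pos le_rfl hN)

theorem IsUnimodalGroundState.corrPoly_mem (hN : 1 ≤ N) (hz : IsUnimodalGroundState N J z) :
    corrPoly N z ∈ auxAdmissible N := by
  have hc := hz.corrCoeff_pos le_rfl hN
  refine ⟨?_, by simp [coeff_corrPoly], ?_, fun t ht => ?_⟩
  · rw [natDegree_le_iff_coeff_eq_zero]
    intro n hn
    rw [coeff_corrPoly, if_neg (by rw [Finset.mem_Icc]; omega)]
  · rw [coeff_corrPoly, if_pos (by simp [hN]), div_self hc.ne']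
  · have e : ∑ j ∈ Finset.Icc 1 N, (corrPoly N z).coeff j * Real.sin (j * t) =
        sineSum N (corrCoeff N z) t / corrCoeff N z 1 := by
      rw [sineSum, Finset.sum_div]
      refine Finset.sum_congr rfl fun j hj => ?_
      rw [coeff_corrPoly, if_pos hj]; ring
    rw [e, ← trigSq_mul_sin hz.supp]
    exact div_nonneg (mul_nonneg (trigSq_nonneg _ _ _) (Real.sin_nonneg_of_mem_Icc ht)) hc.le

theorem IsUnimodalGroundState.sum_coeff_corrPoly (hN : 1 ≤ N)
    (hz : IsUnimodalGroundState N J z) : ∑ j ∈ Finset.Icc 1 N, (corrPoly N z).coeff j = J := by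
  have hc := hz.corrCoeff_pos le_rfl hN
  have e : ∑ j ∈ Finset.Icc 1 N, (corrPoly N z).coeff j =
      (∑ j ∈ Finset.Icc 1 N, corrCoeff N z j) / corrCoeff N z 1 := by
    rw [Finset.sum_div]
    refine Finset.sum_congr rfl fun j hj => ?_
    rw [coeff_corrPoly, if_pos hj]
  rw [e, sum_corrCoeff hN hz.supp, hz.form_self, ← corrCoeff_one, mul_div_assoc, div_self hc.ne',
    mul_one]

/-- Positivity of the top coefficient places the extremal polynomial in the class of exact degree N,
which is why the two classes share maximum and extremals. -/
theorem IsUnimodalGroundState.natDegree_corrPoly (hN : 1 ≤ N)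
    (hz : IsUnimodalGroundState N J z) : (corrPoly N z).natDegree = N :=
  le_antisymm (hz.corrPoly_mem hN).1
    (le_natDegree_of_ne_zero (hz.coeff_corrPoly_pos hN N (by simp [hN])).ne')

theorem IsUnimodalGroundState.eq_corrPoly (hN : 1 ≤ N) (hz : IsUnimodalGroundState N J z)
    {Q : ℝ[X]} (hQ : Q ∈ auxAdmissible N) (hs : ∑ j ∈ Finset.Icc 1 N, Q.coeff j = J) :
    Q = corrPoly N z := by
  ext k
  rw [coeff_corrPoly]
  split_ifs with hk
  · exact hz.eq_of_sum_eq hN hQ.2.2.1 hQ.2.2.2 hs k hk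
  · rw [Finset.mem_Icc] at hk
    rcases Nat.eq_zero_or_pos k with rfl | h
    · exact hQ.2.1
    · exact coeff_eq_zero_of_natDegree_lt (hQ.1.trans_lt (by omega))

theorem IsUnimodalGroundState.isAuxExtremal_iff (hN : 1 ≤ N) (hz : IsUnimodalGroundState N J z)
    (Q : ℝ[X]) : IsAuxExtremal N Q ↔ Q = corrPoly N z := by
  have hle : ∀ R ∈ auxAdmissible N, ∑ j ∈ Finset.Icc 1 N, R.coeff j ≤ J :=
    fun R hR => hz.sum_le hN hR.2.2.1 hR.2.2.2
  constructor
  · rintro ⟨hQ, hmax⟩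
    refine hz.eq_corrPoly hN hQ (le_antisymm (hle Q hQ) ?_)
    have := hmax _ (hz.corrPoly_mem hN)
    rwa [hz.sum_coeff_corrPoly hN] at this
  · rintro rfl
    refine ⟨hz.corrPoly_mem hN, fun R hR => ?_⟩
    rw [hz.sum_coeff_corrPoly hN]
    exact hle R hR

theorem diskSup_neg_comp_neg_X (F : ℂ[X]) : diskSup (-(F.comp (-X))) = diskSup F := by
  unfold diskSup
  congr 1
  ext y
  simp only [Set.mem_image, mem_ball_zero_iff, eval_neg, eval_comp, eval_X, norm_neg]
  constructor
  · rintro ⟨w, hw, rfl⟩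
    exact ⟨-w, by simpa using hw, rfl⟩
  · rintro ⟨w, hw, rfl⟩
    exact ⟨-w, by simpa using hw, by simp⟩

/-- The bound for `sup |F|` over admissible polynomials, with the cases of equality. -/
theorem IsUnimodalGroundState.diskSup_le (hN : 1 ≤ N) (hz : IsUnimodalGroundState N J z)
    (hb : ConfinesMaximum N J) {Q : ℝ[X]} (hQ : Q ∈ auxAdmissible N) :
    diskSup (Q.map Complex.ofRealHom) ≤ J ∧ (diskSup (Q.map Complex.ofRealHom) = J →
      Q = corrPoly N z ∨ Q = -((corrPoly N z).comp (-X))) := by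
  obtain ⟨t, ht⟩ := (isGreatest_diskSup (Q.map Complex.ofRealHom)).1
  dsimp only at ht
  rw [eval_map_ofReal hQ.1 hQ.2.1] at ht
  have hQ' := neg_comp_neg_X_mem_auxAdmissible hQ
  have hs' := hz.sum_le hN hQ'.2.2.1 hQ'.2.2.2
  rw [coeff_neg_comp_neg_X_eq_altSign] at hs'
  obtain ⟨i, j⟩ := norm_sum_pow_le_and_eq hN hz.J_pos hQ.2.2.1 hQ.2.2.2
    (hz.sum_le hN hQ.2.2.1 hQ.2.2.2) hs' hb (Complex.norm_exp_ofReal_mul_I t)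
  rw [ht] at i j
  refine ⟨i, fun h => (j h).imp (hz.eq_corrPoly hN hQ) fun h' => ?_⟩
  rw [← coeff_neg_comp_neg_X_eq_altSign] at h'
  rw [← hz.eq_corrPoly hN hQ' h', neg_comp_neg_X_involutive]

theorem IsUnimodalGroundState.diskSup_corrPoly (hN : 1 ≤ N) (hz : IsUnimodalGroundState N J z)
    (hb : ConfinesMaximum N J) : diskSup ((corrPoly N z).map Complex.ofRealHom) = J := by
  have hP := hz.corrPoly_mem hN
  refine le_antisymm (hz.diskSup_le hN hb hP).1 ?_
  have h := (isGreatest_diskSup ((corrPoly N z).map Complex.ofRealHom)).2 ⟨0, rfl⟩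
  dsimp only at h
  rw [eval_map_ofReal hP.1 hP.2.1] at h
  simp only [Complex.ofReal_zero, zero_mul, Complex.exp_zero, one_pow, mul_one] at h
  rwa [← Complex.ofReal_sum, hz.sum_coeff_corrPoly hN, Complex.norm_real, Real.norm_eq_abs,
    abs_of_pos hz.J_pos] at h

theorem typicallyRealPolys_subset (N : ℕ) : typicallyRealPolys N ⊆ typicallyRealPolysLE N :=
  fun _ h => ⟨h.1.le, h.2⟩

theorem IsUnimodalGroundState.map_corrPoly_mem (hN : 1 ≤ N) (hz : IsUnimodalGroundState N J z) :
    (corrPoly N z).map Complex.ofRealHom ∈ typicallyRealPolys N := by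
  refine ⟨?_, (map_mem_typicallyRealPolysLE hN (hz.corrPoly_mem hN)).2⟩
  rw [natDegree_map, hz.natDegree_corrPoly hN]

theorem IsUnimodalGroundState.neg_comp_mem (hN : 1 ≤ N) (hz : IsUnimodalGroundState N J z) :
    -(((corrPoly N z).map Complex.ofRealHom).comp (-X)) ∈ typicallyRealPolys N := by
  rw [← map_neg_comp_neg_X]
  refine ⟨?_, (map_mem_typicallyRealPolysLE hN
    (neg_comp_neg_X_mem_auxAdmissible (hz.corrPoly_mem hN))).2⟩
  rw [natDegree_map, natDegree_neg_comp_neg_X, hz.natDegree_corrPoly hN]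

theorem IsUnimodalGroundState.isGreatest_image (hN : 1 ≤ N) (hz : IsUnimodalGroundState N J z)
    (hb : ConfinesMaximum N J) {T : Set ℂ[X]} (hT : typicallyRealPolys N ⊆ T)
    (hT' : T ⊆ typicallyRealPolysLE N) : IsGreatest (diskSup '' T) J := by
  refine ⟨⟨_, hT (hz.map_corrPoly_mem hN), hz.diskSup_corrPoly hN hb⟩, ?_⟩
  rintro _ ⟨F, hF, rfl⟩
  obtain ⟨Q, hQ, rfl⟩ := exists_auxAdmissible_of_typicallyReal (hT' hF)
  exact (hz.diskSup_le hN hb hQ).1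

theorem IsUnimodalGroundState.extremalPolys_eq (hN : 1 ≤ N) (hz : IsUnimodalGroundState N J z)
    (hb : ConfinesMaximum N J) {T : Set ℂ[X]} (hT : typicallyRealPolys N ⊆ T)
    (hT' : T ⊆ typicallyRealPolysLE N) :
    extremalPolys T = {(corrPoly N z).map Complex.ofRealHom,
      -(((corrPoly N z).map Complex.ofRealHom).comp (-X))} := by
  have hP := hz.diskSup_corrPoly hN hb
  have hle : ∀ F ∈ T, diskSup F ≤ J := fun F hF =>
    (hz.isGreatest_image hN hb hT hT').2 ⟨F, hF, rfl⟩
  ext F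
  simp only [Set.mem_insert_iff, Set.mem_singleton_iff]
  constructor
  · rintro ⟨hF, hmax⟩
    have hJ : diskSup F = J := le_antisymm (hle F hF)
      (hP ▸ hmax _ (hT (hz.map_corrPoly_mem hN)))
    obtain ⟨Q, hQ, rfl⟩ := exists_auxAdmissible_of_typicallyReal (hT' hF)
    rcases (hz.diskSup_le hN hb hQ).2 hJ with rfl | rfl
    · exact Or.inl rfl
    · exact Or.inr (map_neg_comp_neg_X _)
  · rintro (rfl | rfl)
    · exact ⟨hT (hz.map_corrPoly_mem hN), fun G hG => hP ▸ hle G hG⟩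
    · refine ⟨hT (hz.neg_comp_mem hN), fun G hG => ?_⟩
      rw [diskSup_neg_comp_neg_X, hP]
      exact hle G hG

/-- The coefficient of z² is positive and changes sign under F(z) ↦ -F(-z). -/
theorem IsUnimodalGroundState.map_ne_neg_comp (hN : 2 ≤ N) (hz : IsUnimodalGroundState N J z) :
    (corrPoly N z).map Complex.ofRealHom ≠
      -(((corrPoly N z).map Complex.ofRealHom).comp (-X)) := by
  intro h
  rw [← map_neg_comp_neg_X] at h
  have h2 := congrArg (fun P => P.coeff 2) (map_injective _ Complex.ofRealHom.injective h)
  have hpos := hz.coeff_corrPoly_pos (by omega) 2 (by simp [hN])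
  simp only [coeff_neg_comp_neg_X] at h2
  norm_num at h2
  linarith

end Polynomials

/-! ### Comparison of the constants and conclusion -/

theorem one_sub_cos_pi_div (N : ℕ) :
    2 * (1 - Real.cos (Real.pi / ((N + 2 : ℕ) : ℝ))) =
      4 * Real.sin (Real.pi / (2 * ((N : ℝ) + 2))) ^ 2 := by
  have h := Real.cos_two_mul (Real.pi / (2 * ((N : ℝ) + 2)))
  have e : 2 * (Real.pi / (2 * ((N : ℝ) + 2))) = Real.pi / ((N + 2 : ℕ) : ℝ) := by
    push_cast; field_simp
  rw [e] at h
  rw [h, Real.cos_sq']; ring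

/-- For odd N the value J is exactly 1/(2(1 - cos t)), so κ = 1, and N ≥ 3 gives t ≤ π/5. -/
theorem confinesMaximum_odd (N : ℕ) :
    ConfinesMaximum N (1 / (4 * Real.sin (Real.pi / (2 * ((N : ℝ) + 2))) ^ 2)) := by
  intro hN3
  refine ⟨1, by rw [one_sub_cos_pi_div, one_mul], Or.inr ⟨le_rfl, ?_⟩⟩
  have : (5 : ℝ) ≤ ((N + 2 : ℕ) : ℝ) := by exact_mod_cast (by omega : 5 ≤ N + 2)
  exact div_le_div_of_nonneg_left Real.pi_pos.le (by norm_num) this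

/-- Concavity of the sine turns ψ ≤ 1.0298 ψ₀ into the same bound for the sines, and 1.0298⁴ ≤ 9/8.
Even N ≥ 3 means N ≥ 4, so t ≤ π/6. -/
theorem confinesMaximum_even {N : ℕ} (hN : Even N) {ψ : ℝ} (hψ0 : 0 < ψ)
    (hψ : 4 ≤ N → ψ ≤ 1.0298 * (Real.pi / 2) / ((N : ℝ) + 2)) :
    ConfinesMaximum N (1 / (4 * Real.sin ψ ^ 2)) := by
  intro hN3
  have hN4 : 4 ≤ N := by obtain ⟨n, rfl⟩ := hN; omega
  have hN4' : (4 : ℝ) ≤ N := by exact_mod_cast hN4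
  have hpi := Real.pi_pos
  refine ⟨9 / 8, ?_, Or.inl ⟨le_rfl, ?_⟩⟩
  · rw [one_sub_cos_pi_div]
    set ψ₀ := Real.pi / (2 * ((N : ℝ) + 2)) with hψ₀
    have hψ1 : ψ ≤ 1.0298 * ψ₀ := by
      refine (hψ hN4).trans (le_of_eq ?_)
      rw [hψ₀]; field_simp
    have hψ₀0 : 0 < ψ₀ := by positivity
    have hψ₀1 : 1.0298 * ψ₀ ≤ Real.pi / 2 := by
      rw [hψ₀, ← mul_div_assoc, div_le_div_iff₀ (by positivity) (by norm_num)]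
      nlinarith
    have hs0 : 0 < Real.sin ψ₀ := Real.sin_pos_of_pos_of_lt_pi hψ₀0 (by linarith)
    have hs : 0 < Real.sin ψ := Real.sin_pos_of_pos_of_lt_pi hψ0 (by linarith)
    have hle : Real.sin ψ ≤ 1.0298 * Real.sin ψ₀ := by
      have h1 : Real.sin ψ ≤ Real.sin (1.0298 * ψ₀) :=
        Real.sin_le_sin_of_le_of_le_pi_div_two (by linarith) hψ₀1 hψ1
      have h2 := mul_sin_le_sin_mul (l := 1 / 1.0298) (y := 1.0298 * ψ₀) (by norm_num)
        (by norm_num) (by positivity) (by linarith)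
      rw [← mul_assoc, one_div_mul_cancel (by norm_num), one_mul] at h2
      linarith
    have h4 : Real.sin ψ ^ 4 ≤ 9 / 8 * Real.sin ψ₀ ^ 4 := by
      calc Real.sin ψ ^ 4 ≤ (1.0298 * Real.sin ψ₀) ^ 4 := pow_le_pow_left₀ hs.le hle 4
        _ = 1.0298 ^ 4 * Real.sin ψ₀ ^ 4 := by ring
        _ ≤ 9 / 8 * Real.sin ψ₀ ^ 4 := mul_le_mul_of_nonneg_right (by norm_num) (by positivity)
    rw [div_pow, div_pow, ← mul_div_assoc, div_le_div_iff₀ (by positivity) (by positivity)]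
    linarith
  · have : (6 : ℝ) ≤ ((N + 2 : ℕ) : ℝ) := by exact_mod_cast (by omega : 6 ≤ N + 2)
    exact div_le_div_of_nonneg_left hpi.le (by norm_num) this

theorem waveVecCut_natCast {N j : ℕ} (ψ a b : ℝ) (h1 : 1 ≤ j) (hN : j ≤ N) :
    waveVecCut N ψ a b j = waveVec N ψ a b j :=
  if_pos (by rw [Finset.mem_Icc]; omega)

theorem corrCoeff_div_eq_odd {N : ℕ} (hN : Odd N) {k : ℕ} (hk : 1 ≤ k) :
    let ψ := Real.pi / (2 * ((N : ℝ) + 2))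
    corrCoeff N (waveVecCut N ψ (Real.sin ψ) 0) k / corrCoeff N (waveVecCut N ψ (Real.sin ψ) 0) 1 =
      coeffOfVec N (vecOdd (Real.sin ψ)) k := by
  intro ψ
  have hpi := Real.pi_pos
  have hM : ((N : ℝ) + 2) * ψ = Real.pi / 2 := by simp only [ψ]; field_simp
  have hψ0 : 0 < ψ := by positivity
  have hc : Real.cos ψ ≠ 0 := by
    refine (Real.cos_pos_of_mem_Ioo ⟨by linarith, ?_⟩).ne'
    have : (0 : ℝ) ≤ N := by positivity
    nlinarith
  refine (coeffOfVec_eq (c := 1 / (2 * Real.cos ψ ^ 2)) (by positivity)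
    (isUnimodalGroundState_odd hN).supp (fun j h1 h2 => ?_) hk).symm
  rw [vecOdd_eq hM hc]
  exact congrArg _ (waveVecCut_natCast _ _ _ h1 h2).symm

theorem corrCoeff_div_eq_even {N : ℕ} (hN : Even N) (hN2 : 2 ≤ N) {ψ : ℝ} (hψ0 : 0 < ψ)
    (hψ1 : ((N : ℝ) + 2) * ψ ≤ 3 * Real.pi / 4) (hcrit : critFun N ψ = 0) {k : ℕ} (hk : 1 ≤ k) :
    let z := waveVecCut N ψ 0 (-(Real.sin (((N : ℝ) + 2) * ψ) * Real.sin ψ / ((N : ℝ) + 2)))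
    corrCoeff N z k / corrCoeff N z 1 = coeffOfVec N (vecEven N (Real.sin ψ)) k := by
  intro z
  have hpi := Real.pi_pos
  have hN2' : (2 : ℝ) ≤ N := by exact_mod_cast hN2
  have hgs := isUnimodalGroundState_even hN hN2 hψ0 hψ1 hcrit
  obtain ⟨n, hn⟩ := hN
  have hn' : N = 2 * n := by omega
  have hM0 : 0 < (N : ℝ) + 2 := by positivity
  have hc : Real.cos ψ ≠ 0 := (Real.cos_pos_of_mem_Ioo ⟨by linarith, by nlinarith⟩).ne'
  have hsM : 0 < Real.sin (((N : ℝ) + 2) * ψ) :=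
    Real.sin_pos_of_pos_of_lt_pi (by positivity) (by linarith)
  have hε : Real.cos (((N : ℝ) + 1) * ψ) =
      Real.sin (((N : ℝ) + 2) * ψ) * Real.sin ψ / ((N : ℝ) + 2) * ((N : ℝ) + 1) := by
    rw [show ((N : ℝ) + 1) * ψ = ((N : ℝ) + 2) * ψ - ψ by ring, Real.cos_sub]
    rw [critFun] at hcrit
    field_simp
    linear_combination hcrit
  have hsφ : Real.sin (((N : ℝ) + 2) * (Real.pi / 2 - ψ)) ≠ 0 := by
    have e : ((N : ℝ) + 2) * (Real.pi / 2 - ψ) = ((n + 1 : ℕ) : ℝ) * Real.pi - ((N : ℝ) + 2) * ψ := by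
      rw [hn']; push_cast; ring
    rw [e, Real.sin_nat_mul_pi_sub]
    exact neg_ne_zero.mpr (mul_ne_zero (pow_ne_zero _ (by norm_num)) hsM.ne')
  refine (coeffOfVec_eq (c := (-1) ^ n * Real.sin (((N : ℝ) + 2) * (Real.pi / 2 - ψ)) /
    Real.cos ψ ^ 2) ?_ hgs.supp (fun j h1 h2 => ?_) hk).symm
  · exact div_ne_zero (mul_ne_zero (pow_ne_zero _ (by norm_num)) hsφ) (pow_ne_zero _ hc)
  · rw [vecEven_eq hn' hc hε]
    exact congrArg _ (waveVecCut_natCast _ _ _ h1 h2).symm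

/-- The ground state for even `N`, in terms of the least positive root of `U'_{N+1}`. -/
theorem exists_groundState_even {N : ℕ} (hN : Even N) (hN2 : 2 ≤ N) :
    ∃ ν z, IsLeastPosRootDerivU N ν ∧ IsUnimodalGroundState N (1 / (4 * ν ^ 2)) z ∧
      ConfinesMaximum N (1 / (4 * ν ^ 2)) ∧
      ∀ k, 1 ≤ k → corrCoeff N z k / corrCoeff N z 1 = coeffOfVec N (vecEven N ν) k := by
  have hpi := Real.pi_pos
  have hN2' : (2 : ℝ) ≤ N := by exact_mod_cast hN2
  set ψ₁ := 3 * Real.pi / 4 / ((N : ℝ) + 2) with hψ₁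
  have h0 : 0 < ψ₁ := by positivity
  have h1 : ψ₁ < Real.pi / 2 := by
    rw [hψ₁, div_lt_div_iff₀ (by positivity) (by norm_num)]; nlinarith
  obtain ⟨ν, hν, hle⟩ := exists_isLeastPosRootDerivU hN hN2 h0 h1
    (critFun_nonpos_three_quarters hN2)
  obtain ⟨ψ, hψ0, hψ1, rfl, hcrit⟩ := hν.exists_angle hN h0 h1 hle
  have hψM : ((N : ℝ) + 2) * ψ ≤ 3 * Real.pi / 4 := by
    rw [hψ₁, le_div_iff₀ (by positivity)] at hψ1; linarith
  refine ⟨Real.sin ψ, _, hν, isUnimodalGroundState_even hN hN2 hψ0 hψM hcrit,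
    confinesMaximum_even hN hψ0 fun hN4 => ?_,
    fun k hk => corrCoeff_div_eq_even hN hN2 hψ0 hψM hcrit hk⟩
  have hN4' : (4 : ℝ) ≤ N := by exact_mod_cast hN4
  set ψ₂ := 1.0298 * (Real.pi / 2) / ((N : ℝ) + 2) with hψ₂
  have k0 : 0 < ψ₂ := by positivity
  have k1 : ψ₂ < Real.pi / 2 := by
    rw [hψ₂, div_lt_div_iff₀ (by positivity) (by norm_num)]; nlinarith
  -- The least root is unique, so the sharper location of the sign change applies to the same ν.
  obtain ⟨ν', hν', hle'⟩ := exists_isLeastPosRootDerivU hN hN2 k0 k1 (critFun_nonpos_near hN4)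
  rw [← hν.unique hν'] at hle'
  by_contra hlt
  exact absurd hle' (not_le.mpr (Real.sin_lt_sin_of_lt_of_le_pi_div_two (by linarith)
    (by linarith) (not_le.mp hlt)))

theorem mainTheorem1 (N : ℕ) (hN : 1 ≤ N) :
    -- the supremum on the disk is the maximum on the unit circle
    (∀ F ∈ typicallyRealPolysLE N,
      IsGreatest (Set.range fun t : ℝ => ‖F.eval (Complex.exp (t * Complex.I))‖) (diskSup F)) ∧
    -- `J_N` is a maximum, over degree exactly `N` and also over degree at most `N`
    IsGreatest (diskSup '' typicallyRealPolys N) (extremalValue N) ∧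
    IsGreatest (diskSup '' typicallyRealPolysLE N) (extremalValue N) ∧
    -- the value of `J_N`
    (Odd N → extremalValue N = 1 / 4 * (1 / Real.sin (Real.pi / (2 * ((N : ℝ) + 2)))) ^ 2) ∧
    (Even N → ∃ ν : ℝ, IsLeastPosRootDerivU N ν ∧ extremalValue N = 1 / (4 * ν ^ 2)) ∧
    -- the unique extremal polynomial of the auxiliary problem gives all the extremal polynomials
    ∃ P : ℝ[X],
      (∀ Q : ℝ[X], IsAuxExtremal N Q ↔ Q = P) ∧
      (∀ k ∈ Finset.Icc 1 N, 0 < P.coeff k) ∧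
      (Odd N → ∀ k ∈ Finset.Icc 1 N,
        P.coeff k = coeffOfVec N (vecOdd (Real.sin (Real.pi / (2 * ((N : ℝ) + 2))))) k) ∧
      (Even N → ∀ ν : ℝ, IsLeastPosRootDerivU N ν → ∀ k ∈ Finset.Icc 1 N,
        P.coeff k = coeffOfVec N (vecEven N ν) k) ∧
      extremalPolys (typicallyRealPolys N) =
        {P.map Complex.ofRealHom, -((P.map Complex.ofRealHom).comp (-X))} ∧
      extremalPolys (typicallyRealPolysLE N) =
        {P.map Complex.ofRealHom, -((P.map Complex.ofRealHom).comp (-X))} ∧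
      (2 ≤ N → P.map Complex.ofRealHom ≠ -((P.map Complex.ofRealHom).comp (-X))) := by
  obtain ⟨J, z, hz, hb, hodd, heven⟩ : ∃ J z, IsUnimodalGroundState N J z ∧
      ConfinesMaximum N J ∧
      (Odd N → J = 1 / 4 * (1 / Real.sin (Real.pi / (2 * ((N : ℝ) + 2)))) ^ 2 ∧
        ∀ k, 1 ≤ k → corrCoeff N z k / corrCoeff N z 1 =
          coeffOfVec N (vecOdd (Real.sin (Real.pi / (2 * ((N : ℝ) + 2))))) k) ∧
      (Even N → ∃ ν, IsLeastPosRootDerivU N ν ∧ J = 1 / (4 * ν ^ 2) ∧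
        ∀ k, 1 ≤ k → corrCoeff N z k / corrCoeff N z 1 = coeffOfVec N (vecEven N ν) k) := by
    rcases Nat.even_or_odd N with h | h
    · obtain ⟨ν, z, hν, hz, hb, hk⟩ :=
        exists_groundState_even h (by obtain ⟨n, rfl⟩ := h; omega)
      exact ⟨_, z, hz, hb, fun h' => absurd h (Nat.not_even_iff_odd.mpr h'),
        fun _ => ⟨ν, hν, rfl, hk⟩⟩
    · exact ⟨_, _, isUnimodalGroundState_odd h, confinesMaximum_odd N,
        fun _ => ⟨by rw [one_div_pow, one_div_mul_one_div], fun k hk => corrCoeff_div_eq_odd h hk⟩,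
        fun h' => absurd h' (Nat.not_even_iff_odd.mpr h)⟩
  have hE := hz.isGreatest_image hN hb le_rfl (typicallyRealPolys_subset N)
  have hLE := hz.isGreatest_image hN hb (typicallyRealPolys_subset N) le_rfl
  have hJ : extremalValue N = J := hE.csSup_eq
  have hcoeff : ∀ k ∈ Finset.Icc 1 N,
      (corrPoly N z).coeff k = corrCoeff N z k / corrCoeff N z 1 := fun k hk => by
    rw [coeff_corrPoly, if_pos hk]
  rw [hJ]
  refine ⟨fun F _ => isGreatest_diskSup F, hE, hLE, fun h => (hodd h).1, fun h => ?_,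
    corrPoly N z, hz.isAuxExtremal_iff hN, hz.coeff_corrPoly_pos hN, fun h k hk => ?_,
    fun h ν hν k hk => ?_, hz.extremalPolys_eq hN hb le_rfl (typicallyRealPolys_subset N),
    hz.extremalPolys_eq hN hb (typicallyRealPolys_subset N) le_rfl,
    fun h2 => hz.map_ne_neg_comp h2⟩
  · obtain ⟨ν, hν, hJν, -⟩ := heven h
    exact ⟨ν, hν, hJν⟩
  · rw [hcoeff k hk, (hodd h).2 k (Finset.mem_Icc.mp hk).1]
  · obtain ⟨ν', hν', -, hk'⟩ := heven h
    rw [hcoeff k hk, hν.unique hν', hk' k (Finset.mem_Icc.mp hk).1]
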